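/- **Setting.** Let $n=(0,0,1)^\top$, let $R(\alpha,\beta,\gamma)=R_z(\alpha)R_y(\beta)R_z(\gamma)\in SO(3)$ be the rotation with $z$-$y$-$z$ Euler angles $\alpha,\gamma\in[0,2\pi]$, $\beta\in[0,\pi]$, and let $u(\beta,\alpha)=(\cos\alpha\sin\beta,\sin\alpha\sin\beta,\cos\beta)^\top\in S^2$. Put $du=\sin\beta\,d\beta\,d\alpha$ on $S^2$ and $dR=(8\pi^2)^{-1}\sin\beta\,d\alpha\,d\beta\,d\gamma$ on $SO(3)$. For $\ell\ge 0$ and $-\ell\le m\le\ell$ let $Y_\ell^m(u(\beta,\alpha))=c_\ell^mP_\ell^m(\cos\beta)e^{-im\alpha}$ with $c_\ell^m=\sqrt{\frac{2\ell+1}{4\pi}\frac{(\ell-m)!}{(\ell+m)!}}$ and $P_\ell^m$ the associated Legendre functions (with the factor $(-1)^m$), and let $D_\ell(R(\alpha,\beta,\gamma))=\big(e^{-im\alpha}d_\ell^{mn}(\beta)e^{-in\gamma}\big)_{-\ell\le m,n\le\ell}$ be the Wigner matrices, with the standard phases: $D_\ell(RS)=D_\ell(R)D_\ell(S)$, $D_\ell(R)$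 is unitary, and $Y_\ell^m(u(\beta,\alpha))=c_\ell^0D_\ell^{m0}(R(\alpha,\beta,0))$. For $f\in L^1(S^2)$ let $F_\ell$ be the row vector $\big(\int_{S^2} f(u)\overline{Y_\ell^m(u)}\,du\big)_{-\ell\le m\le\ell}$; for $h\in L^1(SO(3))$ let $H(\ell)=\int_{SO(3)} h(R)D_\ell(R)^\dagger\,dR$. Functions are complex valued. Let $\widetilde f(R)=f(Rn)$, and for functions $a,h$ on $SO(3)$ let $(a\star_o h)(V)=\int_{SO(3)}h(R)\,a(R^{-1}V)\,dR$. The projected convolution of $f$ on $S^2$ with a kernel $h$ on $SO(3)$ is $$(f\star h)(u(\beta,\alpha))=\frac1{2\pi}\int_0^{2\pi}(\widetilde f\star_o h)(R(\alpha,\beta,\gamma))\,d\gamma .$$ When the kernel is a complex Borel measure $\mu$ on $SO(3)$, $h(R)\,dR$ is replaced by $\mu(dR)$ in these formulas. **Theorem.** *Fourier representation and F1.* Let $f\in L^1(S^2)$, $h\in L^1(SO(3))$. The integral defining $(\widetilde f\star_o h)(V)$ converges absolutely for almost every $V$, and the integral $\int h(R)f(R^{-1}u)\,dR$ for almost every $u$.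 The output $g=f\star h$ is a function in $L^1(S^2)$, is in $L^2(S^2)$ if $f$ is, satisfies $(\widetilde f\star_o h)(V)=g(Vn)$ for all $V$, and its coefficient row vectors are $$G_\ell=F_\ell\,H(\ell)\qquad(\ell\ge0).$$ *F2 (axially symmetric or directional kernels).* (a) Let $h\in L^1(S^2)$ be axially symmetric about $n$ (i.e. $h(Ru)=h(u)$ whenever $Rn=n$), with coefficients $H_\ell^m$. If $k\in L^1(SO(3))$ satisfies $K(\ell)=\frac{1}{4\pi c_\ell^0}H_\ell^0\,I$ for all $\ell$, then for every $f\in L^1(S^2)$ and almost every $u$, $(f\star k)(u)=\int_{SO(3)}f(Rn)\,h(R^{-1}u)\,dR$. A kernel $k\in L^2(SO(3))$ with these coefficients exists if and only if $\sum_\ell(2\ell+1)|H_\ell^0|^2<\infty$. (b) For every $L$ and all $(2\ell+1)\times(2\ell+1)$ complex matrices $M_\ell$, there is a continuous kernel $h$ on $SO(3)$ with $H(\ell)=M_\ell$ for $\ell<L$ and $H(\ell)=0$ for $\ell\ge L$. Moreover, for $0<\beta<\pi$ the filter $f\mapsto\frac12f(u)+\frac14f(R_y(\beta)u)+\frac14f(R_y(\beta)^{-1}u)$,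 which is a projected convolution with a sum of point masses, is directional: no axially symmetric $h\in L^1(S^2)$ satisfies that for every continuous $f$ its output equals $\int_{SO(3)}f(Rn)h(R^{-1}u)\,dR$ for almost every $u$. *F3 (associativity).* Let $f\in L^1(S^2)$ and $h_1,h_2\in L^1(SO(3))$. The integral defining $h_1\star_o h_2$ converges absolutely almost everywhere, $h_1\star_o h_2\in L^1(SO(3))$, its $\ell$-th Fourier coefficient is $H_1(\ell)H_2(\ell)$, and $(f\star h_1)\star h_2=f\star(h_1\star_o h_2)$ almost everywhere. *F4 (FIR filtering).* If $h\in L^1(SO(3))$, then the measure kernel $h(R)\,dR$ has the Fourier coefficients $H(\ell)$, and for $f\in L^1(S^2)$ its projected convolution with $f$ is $f\star h$ almost everywhere. For $b_0,\dots,b_{N-1}\in\mathbb C$ and $R_0,\dots,R_{N-1}\in SO(3)$, the measure kernel $\mu=\sum_k b_k\,\delta_{R_k^{-1}}$ satisfies $(f\star\mu)(u)=\sum_k b_k f(R_ku)$ for every $f$ and $u$, and has the transfer function $H(\ell)=\sum_k b_kD_\ell(R_k)$; and if $f\in L^1(S^2)$, then the coefficients of $\sum_k b_kf(R_k\,\cdot)$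 are $F_\ell\sum_k b_kD_\ell(R_k)$. -/

import Mathlib

open MeasureTheory Matrix
open scoped Real

noncomputable section

namespace SphFilter

/-! ### Rotations and the sphere -/

/-- The rotation group of real orthogonal `3 × 3` matrices of determinant one. -/
abbrev SO3 : Type := Matrix.specialOrthogonalGroup (Fin 3) ℝ

instance instMeasurableSpaceSO3 : MeasurableSpace SO3 := borel SO3

instance instBorelSpaceSO3 : BorelSpace SO3 := ⟨rfl⟩

/-- The unit sphere of Euclidean three-space. -/
abbrev S2 : Type := Metric.sphere (0 : EuclideanSpace ℝ (Fin 3)) 1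

theorem mem_SO3_iff (A : Matrix (Fin 3) (Fin 3) ℝ) :
    A ∈ Matrix.specialOrthogonalGroup (Fin 3) ℝ ↔ A * Aᵀ = 1 ∧ A.det = 1 := by
  rw [Matrix.mem_specialOrthogonalGroup_iff, Matrix.mem_orthogonalGroup_iff]

theorem mem_S2_iff (v : Fin 3 → ℝ) :
    (WithLp.toLp 2 v : EuclideanSpace ℝ (Fin 3)) ∈ Metric.sphere (0 : EuclideanSpace ℝ (Fin 3)) 1 ↔
      v ⬝ᵥ v = 1 := by
  rw [mem_sphere_zero_iff_norm, EuclideanSpace.norm_eq, Real.sqrt_eq_one]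
  simp [dotProduct, Fin.sum_univ_three, pow_two]

/-- The rotated point `R u`. -/
def rot (R : SO3) (u : S2) : S2 :=
  ⟨WithLp.toLp 2 ((R : Matrix (Fin 3) (Fin 3) ℝ) *ᵥ u.1.ofLp), by
    have hR := ((mem_SO3_iff _).1 R.2).1
    have hu : u.1.ofLp ⬝ᵥ u.1.ofLp = 1 := (mem_S2_iff _).1 u.2
    rw [mem_S2_iff, Matrix.dotProduct_mulVec, Matrix.vecMul_mulVec,
      mul_eq_one_comm.1 hR]
    simpa using hu⟩

/-- The point with colatitude `β` and longitude `α`. -/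
def sphPoint (β α : ℝ) : S2 :=
  ⟨WithLp.toLp 2 ![Real.cos α * Real.sin β, Real.sin α * Real.sin β, Real.cos β], by
    rw [mem_S2_iff]
    simp only [dotProduct, Fin.sum_univ_three, Matrix.cons_val]
    nlinarith [Real.sin_sq_add_cos_sq α, Real.sin_sq_add_cos_sq β]⟩

/-- The North pole. -/
def north : S2 := sphPoint 0 0

/-- A longitude of `u` (its value at the two poles is immaterial). -/
def lon (u : S2) : ℝ := Complex.arg (⟨u.1 0, u.1 1⟩ : ℂ)

/-- The colatitude of `u`. -/
def colat (u : S2) : ℝ := Real.arccos (u.1 2)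

/-- Rotation by `α` about the `z` axis. -/
def rotZ (α : ℝ) : SO3 :=
  ⟨!![Real.cos α, -Real.sin α, 0; Real.sin α, Real.cos α, 0; 0, 0, 1], by
    have h := Real.sin_sq_add_cos_sq α
    rw [mem_SO3_iff]
    constructor
    · ext i j
      fin_cases i <;> fin_cases j <;>
        simp [Matrix.mul_apply, Fin.sum_univ_three] <;> nlinarith
    · simp [Matrix.det_fin_three]
      nlinarith⟩

/-- Rotation by `β` about the `y` axis. -/
def rotY (β : ℝ) : SO3 :=
  ⟨!![Real.cos β, 0, Real.sin β; 0, 1, 0; -Real.sin β, 0, Real.cos β], by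
    have h := Real.sin_sq_add_cos_sq β
    rw [mem_SO3_iff]
    constructor
    · ext i j
      fin_cases i <;> fin_cases j <;>
        simp [Matrix.mul_apply, Fin.sum_univ_three] <;> nlinarith
    · simp [Matrix.det_fin_three]
      nlinarith⟩

/-- The rotation with `z`-`y`-`z` Euler angles `α`, `β`, `γ`. -/
def euler (α β γ : ℝ) : SO3 := rotZ α * rotY β * rotZ γ

/-! ### Invariant measures, as densities in the angles -/

/-- The measure `sin β dβ` on `[0, π]`. -/
def colatMeasure : Measure ℝ :=
  (volume.restrict (Set.Icc 0 π)).withDensity fun β => ENNReal.ofReal (Real.sin β)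

/-- Lebesgue measure on `[0, 2π]`. -/
def circMeasure : Measure ℝ := volume.restrict (Set.Icc 0 (2 * π))

/-- The surface measure `du = sin β dβ dα` of the sphere. -/
def sphMeasure : Measure S2 :=
  (colatMeasure.prod circMeasure).map fun p => sphPoint p.1 p.2

/-- The normalized rotation-invariant measure `dR = (8π²)⁻¹ sin β dα dβ dγ`. -/
def rotMeasure : Measure SO3 :=
  ENNReal.ofReal ((8 * π ^ 2)⁻¹) •
    (circMeasure.prod (colatMeasure.prod circMeasure)).map fun p => euler p.1 p.2.1 p.2.2

/-! ### Spherical harmonics -/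

/-- The order `m ∈ {-ℓ, …, ℓ}` at position `i` of a vector of length `2ℓ + 1`. -/
def order (l : ℕ) (i : Fin (2 * l + 1)) : ℤ := (i : ℤ) - (l : ℤ)

/-- The middle position, of order `0`. -/
def mid (l : ℕ) : Fin (2 * l + 1) := ⟨l, by omega⟩

/-- The associated Legendre function `P_ℓ^m`, `-ℓ ≤ m ≤ ℓ`, by Rodrigues' formula
`(-1)^m / (2^ℓ ℓ!) (1 - x²)^(m/2) (d/dx)^(ℓ+m) (x² - 1)^ℓ`. -/
def assocLegendre (l : ℕ) (m : ℤ) (x : ℝ) : ℝ :=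
  (-1) ^ m / (2 ^ l * (l.factorial : ℝ)) * Real.sqrt (1 - x ^ 2) ^ m *
    (Polynomial.derivative^[((l : ℤ) + m).toNat]
      ((Polynomial.X ^ 2 - 1 : Polynomial ℝ) ^ l)).eval x

/-- The normalization constant `c_ℓ^m`. -/
def normConst (l : ℕ) (m : ℤ) : ℝ :=
  Real.sqrt ((2 * (l : ℝ) + 1) / (4 * π) *
    ((((l : ℤ) - m).toNat.factorial : ℝ) / (((l : ℤ) + m).toNat.factorial : ℝ)))

/-- The spherical harmonics `Y_ℓ^m(u) = c_ℓ^m P_ℓ^m(cos β) e^{-imα}`, as a vector over `m`. -/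
def sphHarm (l : ℕ) (u : S2) (i : Fin (2 * l + 1)) : ℂ :=
  ((normConst l (order l i) * assocLegendre l (order l i) (Real.cos (colat u)) : ℝ) : ℂ) *
    Complex.exp (-Complex.I * (order l i : ℂ) * (lon u : ℂ))

/-- The row vector `F_ℓ` of spherical-harmonic coefficients of `f`. -/
def sphCoeff (f : S2 → ℂ) (l : ℕ) : Fin (2 * l + 1) → ℂ := fun i =>
  ∫ u, f u * star (sphHarm l u i) ∂sphMeasure

/-! ### Wigner matrices -/

/-- Wigner's function `d_ℓ^{mn}(β)` with `m = i - ℓ`, `n = j - ℓ`; all the natural-number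
differences below are nonnegative on the range of summation, where
`j - s = ℓ+n-s`, `i + s - j = m-n+s` and `2ℓ - (i + s) = ℓ-m-s`. -/
def littleD (l : ℕ) (β : ℝ) (i j : Fin (2 * l + 1)) : ℝ :=
  Real.sqrt ((i : ℕ).factorial * (2 * l - (i : ℕ)).factorial *
      ((j : ℕ).factorial * (2 * l - (j : ℕ)).factorial)) *
    ∑ s ∈ (Finset.range (2 * l + 1)).filter
        (fun s => s ≤ (j : ℕ) ∧ (j : ℕ) ≤ (i : ℕ) + s ∧ (i : ℕ) + s ≤ 2 * l),
      (-1) ^ ((i : ℕ) + s - (j : ℕ)) *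
        Real.cos (β / 2) ^ ((2 * l - ((i : ℕ) + s)) + ((j : ℕ) - s)) *
        Real.sin (β / 2) ^ (((i : ℕ) + s - (j : ℕ)) + s) /
      ((((j : ℕ) - s).factorial : ℝ) * (s.factorial : ℝ) *
        (((i : ℕ) + s - (j : ℕ)).factorial : ℝ) * ((2 * l - ((i : ℕ) + s)).factorial : ℝ))

/-- The Wigner matrix in Euler angles, `D_ℓ^{mn} = e^{-imα} d_ℓ^{mn}(β) e^{-inγ}`. -/
def wignerEuler (l : ℕ) (α β γ : ℝ) : Matrix (Fin (2 * l + 1)) (Fin (2 * l + 1)) ℂ :=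
  Matrix.of fun i j =>
    Complex.exp (-Complex.I * (order l i : ℂ) * (α : ℂ)) * (littleD l β i j : ℂ) *
      Complex.exp (-Complex.I * (order l j : ℂ) * (γ : ℂ))

theorem exists_angle {a b : ℝ} (h : a ^ 2 + b ^ 2 = 1) :
    ∃ t : ℝ, Real.cos t = a ∧ Real.sin t = b := by
  have hn : ‖(⟨a, b⟩ : ℂ)‖ = 1 := by
    rw [Complex.norm_def, Complex.normSq_mk, ← pow_two, ← pow_two, h, Real.sqrt_one]
  have h0 : (⟨a, b⟩ : ℂ) ≠ 0 := by
    intro h0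
    simp [h0] at hn
  refine ⟨Complex.arg ⟨a, b⟩, ?_, ?_⟩
  · rw [Complex.cos_arg h0, hn, div_one]
  · rw [Complex.sin_arg, hn, div_one]

theorem exists_rotZ (A : SO3) (h0 : A.1 0 2 = 0) (h1 : A.1 1 2 = 0) (h2 : A.1 2 2 = 1) :
    ∃ γ : ℝ, A = rotZ γ := by
  obtain ⟨hA, hd⟩ := (mem_SO3_iff _).1 A.2
  have hA' := mul_eq_one_comm.1 hA
  have e (i j : Fin 3) := congrFun (congrFun hA i) j
  have e' (i j : Fin 3) := congrFun (congrFun hA' i) j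
  have e22 := e 2 2
  have a00 := e' 0 0
  have a01 := e' 0 1
  have a11 := e' 1 1
  simp only [Matrix.mul_apply, Fin.sum_univ_three, Matrix.transpose_apply, Matrix.one_apply,
    h2, Fin.isValue, if_true, Fin.reduceEq, if_false] at e22 a00 a01 a11
  have h20 : A.1 2 0 = 0 := by nlinarith [sq_nonneg (A.1 2 0), sq_nonneg (A.1 2 1)]
  have h21 : A.1 2 1 = 0 := by nlinarith [sq_nonneg (A.1 2 0), sq_nonneg (A.1 2 1)]
  rw [Matrix.det_fin_three, h0, h1, h2, h20, h21] at hd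
  rw [h20] at a00 a01
  rw [h21] at a01 a11
  have hc : (A.1 0 0 - A.1 1 1) ^ 2 + (A.1 0 1 + A.1 1 0) ^ 2 = 0 := by nlinarith
  have hc1 : A.1 1 1 = A.1 0 0 := by
    nlinarith [sq_nonneg (A.1 0 0 - A.1 1 1), sq_nonneg (A.1 0 1 + A.1 1 0)]
  have hc2 : A.1 0 1 = -A.1 1 0 := by
    nlinarith [sq_nonneg (A.1 0 0 - A.1 1 1), sq_nonneg (A.1 0 1 + A.1 1 0)]
  obtain ⟨t, ht, hs⟩ := exists_angle (a := A.1 0 0) (b := A.1 1 0) (by nlinarith)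
  refine ⟨t, Subtype.ext ?_⟩
  ext i j
  fin_cases i <;> fin_cases j <;> simp [rotZ, *]

/-- Every rotation has Euler angles, with `0 ≤ β ≤ π`. -/
theorem exists_euler (R : SO3) :
    ∃ p : ℝ × ℝ × ℝ, p.2.1 ∈ Set.Icc 0 π ∧ euler p.1 p.2.1 p.2.2 = R := by
  obtain ⟨hA, -⟩ := (mem_SO3_iff _).1 R.2
  have hA' := mul_eq_one_comm.1 hA
  have a22 := congrFun (congrFun hA' 2) 2
  simp only [Matrix.mul_apply, Fin.sum_univ_three, Matrix.transpose_apply, Matrix.one_apply,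
    Fin.isValue, if_true] at a22
  have hz : R.1 2 2 ∈ Set.Icc (-1 : ℝ) 1 := by
    constructor <;> nlinarith [sq_nonneg (R.1 0 2), sq_nonneg (R.1 1 2)]
  set β := Real.arccos (R.1 2 2) with hβ
  have hcos : Real.cos β = R.1 2 2 := Real.cos_arccos hz.1 hz.2
  have hsc := Real.sin_sq_add_cos_sq β
  obtain ⟨α, h0, h1⟩ : ∃ α : ℝ, Real.cos α * Real.sin β = R.1 0 2 ∧
      Real.sin α * Real.sin β = R.1 1 2 := by
    by_cases hs : Real.sin β = 0
    · rw [hs, hcos] at hsc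
      refine ⟨0, ?_, ?_⟩ <;> rw [hs] <;>
        nlinarith [sq_nonneg (R.1 0 2), sq_nonneg (R.1 1 2)]
    · obtain ⟨α, h, h'⟩ := exists_angle (a := R.1 0 2 / Real.sin β) (b := R.1 1 2 / Real.sin β)
        (by
          rw [hcos] at hsc
          field_simp
          nlinarith)
      exact ⟨α, by rw [h]; field_simp, by rw [h']; field_simp⟩
  have hinv : (((rotZ α * rotY β)⁻¹ * R : SO3) : Matrix (Fin 3) (Fin 3) ℝ) =
      ((rotZ α).1 * (rotY β).1)ᵀ * R.1 := by
    rfl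
  have hsc' := Real.sin_sq_add_cos_sq α
  obtain ⟨γ, hγ⟩ := exists_rotZ ((rotZ α * rotY β)⁻¹ * R)
    (by
      rw [hinv]
      simp [rotZ, rotY, Matrix.mul_apply, Fin.sum_univ_three, ← h0, ← h1, ← hcos]
      linear_combination (Real.sin β * Real.cos β) * hsc')
    (by
      rw [hinv]
      simp [rotZ, rotY, Matrix.mul_apply, Fin.sum_univ_three, ← h0, ← h1, ← hcos]
      try ring)
    (by
      rw [hinv]
      simp [rotZ, rotY, Matrix.mul_apply, Fin.sum_univ_three, ← h0, ← h1, ← hcos]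
      linear_combination (Real.sin β ^ 2) * hsc' + hsc)
  refine ⟨(α, β, γ), ⟨Real.arccos_nonneg _, Real.arccos_le_pi _⟩, ?_⟩
  simp only [euler]
  rw [← hγ, mul_inv_cancel_left]

/-- The Wigner matrix `D_ℓ(R)`, through Euler angles of `R` (its value does not depend on which
Euler angles of `R` are taken). -/
def wignerD (l : ℕ) (R : SO3) : Matrix (Fin (2 * l + 1)) (Fin (2 * l + 1)) ℂ :=
  wignerEuler l (exists_euler R).choose.1 (exists_euler R).choose.2.1
    (exists_euler R).choose.2.2

/-- The Fourier coefficient matrix `H(ℓ) = ∫ h(R) D_ℓ(R)† dR`. -/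
def so3Coeff (h : SO3 → ℂ) (l : ℕ) : Matrix (Fin (2 * l + 1)) (Fin (2 * l + 1)) ℂ :=
  Matrix.of fun i j => ∫ R, h R * (wignerD l R)ᴴ i j ∂rotMeasure

/-! ### Convolutions -/

/-- The lift `R ↦ f(R n)` of a spherical function. -/
def lift (f : S2 → ℂ) : SO3 → ℂ := fun R => f (rot R north)

/-- The convolution on the rotation group, `V ↦ ∫ h(R) f(R⁻¹ V) dR`. -/
def so3Conv (f h : SO3 → ℂ) : SO3 → ℂ := fun V =>
  ∫ R, h R * f (R⁻¹ * V) ∂rotMeasure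

/-- The projection to the sphere: average over the third Euler angle. -/
def proj (g : SO3 → ℂ) : S2 → ℂ := fun u =>
  (((2 * π)⁻¹ : ℝ) : ℂ) * ∫ γ in (0 : ℝ)..(2 * π), g (euler (lon u) (colat u) γ)

/-- The projected convolution `f ⋆ h` of a spherical function with a kernel function on the
rotation group. -/
def projConv (f : S2 → ℂ) (h : SO3 → ℂ) : S2 → ℂ := proj (so3Conv (lift f) h)

/-- The convolution on the sphere with a spherical kernel, `u ↦ ∫ f(R n) h(R⁻¹ u) dR`. -/
def leftConv (f h : S2 → ℂ) : S2 → ℂ := fun u =>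
  ∫ R, f (rot R north) * h (rot R⁻¹ u) ∂rotMeasure

/-- Symmetry about the North pole. -/
def IsAxial (h : S2 → ℂ) : Prop :=
  ∀ R : SO3, rot R north = north → ∀ u : S2, h (rot R u) = h u

/-! ### Kernels that are complex Borel measures (for instance, sums of point masses) -/

/-- Convolution with a complex measure, `V ↦ ∫ f(R⁻¹ V) μ(dR)`. -/
def so3ConvMeasure (f : SO3 → ℂ) (μ : ComplexMeasure SO3) : SO3 → ℂ := fun V =>
  VectorMeasure.integral μ (fun R => f (R⁻¹ * V)) (ContinuousLinearMap.mul ℝ ℂ)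

/-- The projected convolution with a complex measure as kernel. -/
def projConvMeasure (f : S2 → ℂ) (μ : ComplexMeasure SO3) : S2 → ℂ :=
  proj (so3ConvMeasure (lift f) μ)

/-- The Fourier coefficient matrix `∫ D_ℓ(R)† μ(dR)` of a complex measure. -/
def so3CoeffMeasure (μ : ComplexMeasure SO3) (l : ℕ) :
    Matrix (Fin (2 * l + 1)) (Fin (2 * l + 1)) ℂ :=
  Matrix.of fun i j =>
    VectorMeasure.integral μ (fun R => (wignerD l R)ᴴ i j) (ContinuousLinearMap.mul ℝ ℂ)

/-- The finite-impulse-response filter `u ↦ ∑ b_k f(R_k u)`. -/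
def fir {N : ℕ} (b : Fin N → ℂ) (R : Fin N → SO3) (f : S2 → ℂ) : S2 → ℂ := fun u =>
  ∑ k, b k * f (rot (R k) u)

/-- The kernel `∑ b_k δ_{R_k⁻¹}` of point masses. -/
def firKernel {N : ℕ} (b : Fin N → ℂ) (R : Fin N → SO3) : ComplexMeasure SO3 :=
  ∑ k, VectorMeasure.dirac (R k)⁻¹ (b k)

end SphFilter

end

open SphFilter

/-!
The proof reduces every identity between functions on the sphere to an identity between coefficient
vectors, so it rests on two facts: the Wigner matrices form unitary representations of the rotation
group, and an integrable function on the sphere is determined by its coefficients.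

*Representations.* Wigner's explicit formula for `d_ℓ(β)` is the symmetric power of order `2ℓ` of
the plane rotation by `β / 2`. Hence `wignerD l R` is the symmetric power (`spinRep`) of the matrix
in `SU(2)` of either unit quaternion over `R` (`wignerD_eq_spinRep`), whichever Euler angles are
chosen in its definition. This makes it multiplicative, unitary and continuous. Its middle column
is constant on the fibres of `R ↦ R n` and defines a continuous function `sphY` on the sphere;
Leibniz' rule applied to `(x + 1)^ℓ (x - 1)^ℓ` in Rodrigues' formula identifies it with `sphHarm`
away from the poles (`sphHarm_eq_sphY`).

*Completeness and invariance.* For each `m`, the polynomials `(d/dx)^(ℓ+m) (x² - 1)^ℓ`, `ℓ ≥ m`,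
have degrees `0, 1, 2, …`. Therefore the spherical harmonics span all functions `(x ∓ i y)^m p(z)`,
hence all polynomial functions, and they are dense by Stone–Weierstrass (`dense_harmSpan`). It
follows that a finite measure (`measure_ext_sphY`) and an integrable function (`ae_eq_of_sphCoeff`)
are determined by their moments. Since the harmonics of positive degree have mean zero and every
degree is stable under rotations, the surface measure is invariant; disintegrating `dR` over the
sphere, so is `dR`.

*Convolution.* The inner convolution in `f ⋆ h` depends on the rotation `V` through `V n` only, so
`f ⋆ h` is the convolution `actConv h f` for the action on the sphere, and both convolutions are
instances of `actConv`. Invariance gives absolute convergence (Fubini), the `L²` bound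
(Cauchy–Schwarz) and, by moving the rotation onto the harmonic, the products of coefficients
(`sphCoeff_actConv`, `so3Coeff_so3Conv`). Associativity is then associativity of matrix products.

*Kernels.* An axially symmetric function has coefficients of order `0` only, so that convolution
with it multiplies the degree `ℓ` by a scalar (`sphCoeff_leftConv`). Schur orthogonality provides
the band-limited kernels and makes the characters orthonormal in `L²`; square-integrable kernels
with scalar coefficients are the convergent series of characters. Comparing scalars also shows that
the three-tap filter is directional: in degree one its transfer matrix has two different diagonal
entries. For complex measures, the integral against `h dR` is compared with the Bochner integral
of `h φ` on indicators and extended by density (`integral_withDensityᵥ`).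
-/

noncomputable section

namespace SphFilter

/-! ### Symmetric powers of the two-dimensional representation -/

/-- The indices `s` of the terms of `symCoeff N g i j`, which are those of `littleD`. A term takes
`y` from `s` of the first `j` factors of `(a x + c y) ^ j * (b x + d y) ^ (N - j)`; the inequalities
say that the numbers of factors giving `x` or `y` are nonnegative. -/
def splitRange (N i j : ℕ) : Finset ℕ :=
  (Finset.range (N + 1)).filter fun s => s ≤ j ∧ j ≤ i + s ∧ i + s ≤ N

/-- The coefficient of `x ^ i * y ^ (N - i)` in `(a x + c y) ^ j * (b x + d y) ^ (N - j)`, where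
`g = !![a, b; c, d]`, divided by `j! (N - j)!`. -/
def symCoeff (N : ℕ) (g : Matrix (Fin 2) (Fin 2) ℂ) (i j : ℕ) : ℂ :=
  ∑ s ∈ splitRange N i j,
    g 0 0 ^ (j - s) * g 1 0 ^ s * g 0 1 ^ (i + s - j) * g 1 1 ^ (N - (i + s)) /
      (((j - s).factorial : ℂ) * (s.factorial : ℂ) * ((i + s - j).factorial : ℂ) *
        ((N - (i + s)).factorial : ℂ))

theorem mem_splitRange {N i j s : ℕ} :
    s ∈ splitRange N i j ↔ s ≤ j ∧ j ≤ i + s ∧ i + s ≤ N := by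
  simp only [splitRange, Finset.mem_filter, Finset.mem_range]
  omega

/-- The generating function of a column of `symCoeff`, in any commutative algebra. -/
theorem sum_symCoeff {A : Type*} [CommRing A] [Algebra ℂ A] (N : ℕ)
    (g : Matrix (Fin 2) (Fin 2) ℂ) (x y : A) {j : ℕ} (hj : j ≤ N) :
    ∑ i ∈ Finset.range (N + 1), algebraMap ℂ A
        ((j.factorial : ℂ) * ((N - j).factorial : ℂ) * symCoeff N g i j) * (x ^ i * y ^ (N - i)) =
      (algebraMap ℂ A (g 0 0) * x + algebraMap ℂ A (g 1 0) * y) ^ j *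
        (algebraMap ℂ A (g 0 1) * x + algebraMap ℂ A (g 1 1) * y) ^ (N - j) := by
  rw [add_comm (algebraMap ℂ A (g 0 0) * x), add_comm (algebraMap ℂ A (g 0 1) * x), add_pow,
    add_comm (algebraMap ℂ A (g 1 1) * y), add_pow, Finset.sum_mul_sum, ← Finset.sum_product']
  simp only [symCoeff, Finset.mul_sum, map_sum, Finset.sum_mul]
  rw [Finset.sum_sigma']
  refine Finset.sum_bij' (fun p _ => (p.2, p.1 + p.2 - j)) (fun p _ => ⟨p.2 + j - p.1, p.1⟩)
    ?_ ?_ ?_ ?_ ?_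
  · rintro ⟨i, s⟩ h
    simp only [Finset.mem_sigma, Finset.mem_range, mem_splitRange, Finset.mem_product] at h ⊢
    omega
  · rintro ⟨s, t⟩ h
    simp only [Finset.mem_sigma, Finset.mem_range, mem_splitRange, Finset.mem_product] at h ⊢
    omega
  · rintro ⟨i, s⟩ h
    simp only [Finset.mem_sigma, Finset.mem_range, mem_splitRange] at h
    simp only [Sigma.mk.injEq, heq_eq_eq, and_true]
    omega
  · rintro ⟨s, t⟩ h
    simp only [Finset.mem_range, Finset.mem_product] at h
    simp only [Prod.mk.injEq, true_and]
    omega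
  · rintro ⟨i, s⟩ h
    simp only [Finset.mem_sigma, Finset.mem_range, mem_splitRange] at h
    obtain ⟨h1, h2, h3, h4⟩ := h
    obtain ⟨t, rfl⟩ : ∃ t, i = t + j - s := ⟨i + s - j, by omega⟩
    have e1 : t + j - s + s - j = t := by omega
    have e2 : N - (t + j - s + s) = N - j - t := by omega
    have e3 : t + j - s = (j - s) + t := by omega
    have e4 : N - (t + j - s) = s + (N - j - t) := by omega
    have hb1 : (j.factorial : ℂ) = (j.choose s : ℂ) * (s.factorial * (j - s).factorial) := by
      rw [← Nat.choose_mul_factorial_mul_factorial h2]; push_cast; ring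
    have hb2 : ((N - j).factorial : ℂ) =
        ((N - j).choose t : ℂ) * (t.factorial * (N - j - t).factorial) := by
      rw [← Nat.choose_mul_factorial_mul_factorial (show t ≤ N - j by omega)]; push_cast; ring
    have key : (j.factorial : ℂ) * ((N - j).factorial : ℂ) *
        (g 0 0 ^ (j - s) * g 1 0 ^ s * g 0 1 ^ t * g 1 1 ^ (N - j - t) /
          (((j - s).factorial : ℂ) * (s.factorial : ℂ) * (t.factorial : ℂ) *
            ((N - j - t).factorial : ℂ))) =
        (j.choose s : ℂ) * ((N - j).choose t : ℂ) *
          (g 0 0 ^ (j - s) * g 1 0 ^ s * g 0 1 ^ t * g 1 1 ^ (N - j - t)) := by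
      rw [hb1, hb2]
      have f1 : ((j - s).factorial : ℂ) ≠ 0 := Nat.cast_ne_zero.2 (Nat.factorial_ne_zero _)
      have f2 : (s.factorial : ℂ) ≠ 0 := Nat.cast_ne_zero.2 (Nat.factorial_ne_zero _)
      have f3 : (t.factorial : ℂ) ≠ 0 := Nat.cast_ne_zero.2 (Nat.factorial_ne_zero _)
      have f4 : ((N - j - t).factorial : ℂ) ≠ 0 := Nat.cast_ne_zero.2 (Nat.factorial_ne_zero _)
      field_simp
    simp only [e1, e2, e4]
    rw [key, e3]
    simp only [map_mul, map_pow, map_natCast, mul_pow, pow_add]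
    ring

/-- `symCoeff` is multiplicative, with the weights `k! (N - k)!`: substitute the linear forms of `g`
into the generating function of `h` and compare coefficients. -/
theorem symCoeff_mul (N : ℕ) (g h : Matrix (Fin 2) (Fin 2) ℂ) {i j : ℕ} (hi : i ≤ N)
    (hj : j ≤ N) :
    symCoeff N (g * h) i j = ∑ k ∈ Finset.range (N + 1),
      symCoeff N g i k * ((k.factorial : ℂ) * ((N - k).factorial : ℂ)) * symCoeff N h k j := by
  open Polynomial in
  have H1 := sum_symCoeff N (g * h) (X : ℂ[X]) 1 hj
  have H2 := sum_symCoeff N h (C (g 0 0) * X + C (g 1 0) * 1 : ℂ[X])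
    (C (g 0 1) * X + C (g 1 1) * 1) hj
  have H3 : ∀ k ∈ Finset.range (N + 1), _ := fun k hk =>
    (sum_symCoeff N g (X : ℂ[X]) 1 (Nat.lt_succ_iff.1 (Finset.mem_range.1 hk))).symm
  have e : (C ((g * h) 0 0) * X + C ((g * h) 1 0) * 1 : ℂ[X]) =
        C (h 0 0) * (C (g 0 0) * X + C (g 1 0) * 1) +
          C (h 1 0) * (C (g 0 1) * X + C (g 1 1) * 1) ∧
      (C ((g * h) 0 1) * X + C ((g * h) 1 1) * 1 : ℂ[X]) =
        C (h 0 1) * (C (g 0 0) * X + C (g 1 0) * 1) +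
          C (h 1 1) * (C (g 0 1) * X + C (g 1 1) * 1) := by
    simp only [Matrix.mul_apply, Fin.sum_univ_two, map_add, map_mul]
    constructor <;> ring
  simp only [Polynomial.algebraMap_eq] at H1 H2 H3
  rw [e.1, e.2, ← H2] at H1
  have H4 := congrArg (fun p => p.coeff i)
    (H1.trans (Finset.sum_congr rfl fun k hk => congrArg _ (H3 k hk)))
  simp only [Polynomial.finsetSum_coeff, one_pow, mul_one, Polynomial.coeff_C_mul,
    Polynomial.coeff_X_pow, mul_ite, mul_zero, Finset.sum_ite_eq, Finset.mem_range,
    Nat.lt_succ_iff, hi, if_true] at H4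
  have f1 : (j.factorial : ℂ) ≠ 0 := Nat.cast_ne_zero.2 (Nat.factorial_ne_zero _)
  have f2 : ((N - j).factorial : ℂ) ≠ 0 := Nat.cast_ne_zero.2 (Nat.factorial_ne_zero _)
  refine mul_left_cancel₀ (mul_ne_zero f1 f2) (H4.trans ?_)
  rw [Finset.mul_sum]
  refine Finset.sum_congr rfl fun k _ => ?_
  ring

theorem symCoeff_transpose (N : ℕ) (g : Matrix (Fin 2) (Fin 2) ℂ) {i j : ℕ} :
    symCoeff N gᵀ i j = symCoeff N g j i := by
  refine Finset.sum_bij' (fun s _ => i + s - j) (fun s _ => j + s - i) ?_ ?_ ?_ ?_ ?_ <;>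
    intro s hs <;> rw [mem_splitRange] at *
  · omega
  · omega
  · omega
  · omega
  · have e1 : i - (i + s - j) = j - s := by omega
    have e2 : j + (i + s - j) - i = s := by omega
    have e3 : N - (j + (i + s - j)) = N - (i + s) := by omega
    simp only [e1, e2, e3, Matrix.transpose_apply]
    ring

theorem symCoeff_star (N : ℕ) (g : Matrix (Fin 2) (Fin 2) ℂ) {i j : ℕ} :
    symCoeff N (g.map star) i j = star (symCoeff N g i j) := by
  simp [symCoeff]

theorem symCoeff_diag (N : ℕ) (a d : ℂ) {i j : ℕ} (hj : j ≤ N) :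
    symCoeff N !![a, 0; 0, d] i j =
      if i = j then a ^ j * d ^ (N - j) / ((j.factorial : ℂ) * ((N - j).factorial : ℂ)) else 0 := by
  have h0 : ∀ s ∈ splitRange N i j, s ≠ 0 → !![a, 0; 0, d] 0 0 ^ (j - s) *
      !![a, 0; 0, d] 1 0 ^ s * !![a, 0; 0, d] 0 1 ^ (i + s - j) *
      !![a, 0; 0, d] 1 1 ^ (N - (i + s)) / (((j - s).factorial : ℂ) * (s.factorial : ℂ) *
        ((i + s - j).factorial : ℂ) * ((N - (i + s)).factorial : ℂ)) = 0 := by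
    intro s _ hs
    simp [hs]
  split_ifs with hij
  · subst hij
    rw [symCoeff, Finset.sum_eq_single 0 h0]
    · simp
    · intro h
      exact absurd (mem_splitRange.2 ⟨by omega, by omega, by omega⟩) h
  · refine Finset.sum_eq_zero fun s hs => ?_
    by_cases hs0 : s = 0
    · subst hs0
      rw [mem_splitRange] at hs
      have : i + 0 - j ≠ 0 := by omega
      have h1 : !![a, 0; 0, d] 0 1 = 0 := rfl
      rw [h1, zero_pow this]
      simp
    · exact h0 s hs hs0

/-- The weight `i! (N - i)!` (with `N = 2ℓ`), which makes the symmetric power unitary. -/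
def spinWeight (l i : ℕ) : ℝ := (i.factorial : ℝ) * ((2 * l - i).factorial : ℝ)

theorem spinWeight_pos (l i : ℕ) : 0 < spinWeight l i := by
  have := Nat.factorial_pos i
  have := Nat.factorial_pos (2 * l - i)
  unfold spinWeight
  positivity

/-- The symmetric power of order `2ℓ` of a `2 × 2` matrix, in the basis of the monomials
`x ^ i * y ^ (2ℓ - i)` divided by the square roots of their weights. -/
def spinRep (l : ℕ) (g : Matrix (Fin 2) (Fin 2) ℂ) :
    Matrix (Fin (2 * l + 1)) (Fin (2 * l + 1)) ℂ :=
  Matrix.of fun i j => (Real.sqrt (spinWeight l i * spinWeight l j) : ℂ) * symCoeff (2 * l) g i j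

theorem spinRep_mul (l : ℕ) (g h : Matrix (Fin 2) (Fin 2) ℂ) :
    spinRep l (g * h) = spinRep l g * spinRep l h := by
  ext i j
  rw [Matrix.mul_apply]
  simp only [spinRep, Matrix.of_apply]
  rw [symCoeff_mul _ _ _ (Nat.lt_succ_iff.1 i.2) (Nat.lt_succ_iff.1 j.2), Finset.sum_range,
    Finset.mul_sum]
  refine Finset.sum_congr rfl fun k _ => ?_
  have hk := (spinWeight_pos l k).le
  have hi := (spinWeight_pos l i).le
  rw [Real.sqrt_mul hi, Real.sqrt_mul hi, Real.sqrt_mul hk]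
  have : ((k : ℕ).factorial : ℂ) * ((2 * l - (k : ℕ)).factorial : ℂ) =
      (Real.sqrt (spinWeight l k) : ℂ) * (Real.sqrt (spinWeight l k) : ℂ) := by
    rw [← Complex.ofReal_mul, Real.mul_self_sqrt hk]
    simp [spinWeight]
  rw [this]
  push_cast
  ring

theorem spinRep_conjTranspose (l : ℕ) (g : Matrix (Fin 2) (Fin 2) ℂ) :
    spinRep l gᴴ = (spinRep l g)ᴴ := by
  ext i j
  rw [Matrix.conjTranspose_apply]
  simp only [spinRep, Matrix.of_apply, star_mul']
  rw [Matrix.conjTranspose, symCoeff_star, symCoeff_transpose, mul_comm (spinWeight l i)]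
  simp

/-- The symmetric power has even order, so that it does not see the sign. -/
theorem spinRep_neg (l : ℕ) (g : Matrix (Fin 2) (Fin 2) ℂ) : spinRep l (-g) = spinRep l g := by
  ext i j
  simp only [spinRep, Matrix.of_apply, symCoeff]
  congr 1
  refine Finset.sum_congr rfl fun s hs => ?_
  rw [mem_splitRange] at hs
  simp only [Matrix.neg_apply]
  rw [neg_pow (g 0 0), neg_pow (g 1 0), neg_pow (g 0 1), neg_pow (g 1 1)]
  have : ((-1 : ℂ) ^ ((j : ℕ) - s) * (-1) ^ s) * ((-1) ^ ((i : ℕ) + s - j) *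
      (-1) ^ (2 * l - (i + s))) = 1 := by
    rw [← pow_add, ← pow_add, ← pow_add, show (j : ℕ) - s + s + (i + s - j + (2 * l - (i + s))) =
      2 * l by omega, pow_mul]
    simp
  linear_combination (g 0 0 ^ ((j : ℕ) - s) * g 1 0 ^ s * g 0 1 ^ ((i : ℕ) + s - j) *
    g 1 1 ^ (2 * l - ((i : ℕ) + s)) / ((((j : ℕ) - s).factorial : ℂ) * (s.factorial : ℂ) *
      (((i : ℕ) + s - j).factorial : ℂ) * ((2 * l - ((i : ℕ) + s)).factorial : ℂ))) * this

theorem spinRep_diag (l : ℕ) (a d : ℂ) :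
    spinRep l !![a, 0; 0, d] =
      Matrix.diagonal fun j : Fin (2 * l + 1) => a ^ (j : ℕ) * d ^ (2 * l - (j : ℕ)) := by
  ext i j
  simp only [spinRep, Matrix.of_apply, Matrix.diagonal_apply]
  rw [symCoeff_diag _ _ _ (Nat.lt_succ_iff.1 j.2)]
  simp only [Fin.ext_iff]
  split_ifs with h
  · rw [h, Real.sqrt_mul_self (spinWeight_pos l j).le]
    have f1 : ((j : ℕ).factorial : ℂ) ≠ 0 := Nat.cast_ne_zero.2 (Nat.factorial_ne_zero _)
    have f2 : ((2 * l - (j : ℕ)).factorial : ℂ) ≠ 0 := Nat.cast_ne_zero.2 (Nat.factorial_ne_zero _)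
    simp only [spinWeight]
    push_cast
    field_simp
  · simp

theorem spinRep_one (l : ℕ) : spinRep l 1 = 1 := by
  rw [Matrix.one_fin_two, spinRep_diag]
  simp

theorem continuous_spinRep (l : ℕ) : Continuous (spinRep l) := by
  refine continuous_matrix fun i j => ?_
  simp only [spinRep, Matrix.of_apply, symCoeff]
  fun_prop

/-- Wigner's formula for `d_ℓ(β)` is the symmetric power of the plane rotation by `β / 2`. -/
theorem spinRep_rotation (l : ℕ) (β : ℝ) :
    spinRep l !![(Real.cos (β / 2) : ℂ), -(Real.sin (β / 2) : ℂ);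
      (Real.sin (β / 2) : ℂ), (Real.cos (β / 2) : ℂ)] = (Matrix.of (littleD l β)).map (↑) := by
  ext i j
  simp only [spinRep, Matrix.of_apply, Matrix.map_apply, littleD, symCoeff, spinWeight,
    splitRange, Complex.ofReal_mul, Complex.ofReal_sum]
  congr 1
  refine Finset.sum_congr rfl fun s _ => ?_
  simp only [Matrix.cons_val', Matrix.cons_val_zero, Matrix.cons_val_one, Matrix.cons_val_fin_one,
    Matrix.empty_val']
  rw [neg_pow]
  push_cast
  rw [pow_add, pow_add]
  ring

/-! ### Unit quaternions as double cover of the rotation group -/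

open scoped Quaternion

/-- The `2 × 2` complex matrix `w - i (x σ₁ + y σ₂ + z σ₃)` of the quaternion `(w, x, y, z)`. -/
def qmat (q : ℍ[ℝ]) : Matrix (Fin 2) (Fin 2) ℂ :=
  !![⟨q.re, -q.imK⟩, ⟨-q.imJ, -q.imI⟩; ⟨q.imJ, -q.imI⟩, ⟨q.re, q.imK⟩]

/-- The matrix of `v ↦ q v q*` on imaginary quaternions. -/
def qrot (q : ℍ[ℝ]) : Matrix (Fin 3) (Fin 3) ℝ :=
  !![q.re ^ 2 + q.imI ^ 2 - q.imJ ^ 2 - q.imK ^ 2, 2 * (q.imI * q.imJ - q.re * q.imK),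
      2 * (q.imI * q.imK + q.re * q.imJ);
    2 * (q.imI * q.imJ + q.re * q.imK), q.re ^ 2 - q.imI ^ 2 + q.imJ ^ 2 - q.imK ^ 2,
      2 * (q.imJ * q.imK - q.re * q.imI);
    2 * (q.imI * q.imK - q.re * q.imJ), 2 * (q.imJ * q.imK + q.re * q.imI),
      q.re ^ 2 - q.imI ^ 2 - q.imJ ^ 2 + q.imK ^ 2]

theorem qmat_mul (p q : ℍ[ℝ]) : qmat (p * q) = qmat p * qmat q := by
  ext i j
  fin_cases i <;> fin_cases j <;> apply Complex.ext <;>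
    simp [qmat, Matrix.mul_apply, Fin.sum_univ_two] <;> ring

theorem qrot_mul (p q : ℍ[ℝ]) : qrot (p * q) = qrot p * qrot q := by
  ext i j
  fin_cases i <;> fin_cases j <;>
    simp [qrot, Matrix.mul_apply, Fin.sum_univ_three] <;> ring

theorem qmat_star (q : ℍ[ℝ]) : qmat (star q) = (qmat q)ᴴ := by
  ext i j
  fin_cases i <;> fin_cases j <;> apply Complex.ext <;> simp [qmat]

theorem qrot_star (q : ℍ[ℝ]) : qrot (star q) = (qrot q)ᵀ := by
  ext i j
  fin_cases i <;> fin_cases j <;> simp [qrot] <;> ring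

theorem qmat_neg (q : ℍ[ℝ]) : qmat (-q) = -qmat q := by
  ext i j
  fin_cases i <;> fin_cases j <;> apply Complex.ext <;> simp [qmat]

theorem qmat_one : qmat 1 = 1 := by
  ext i j
  fin_cases i <;> fin_cases j <;> apply Complex.ext <;> simp [qmat]

theorem mul_star_self_of_normSq {q : ℍ[ℝ]} (h : Quaternion.normSq q = 1) : q * star q = 1 := by
  rw [Quaternion.self_mul_star, h]
  rfl

theorem eq_or_eq_neg_one_of_qrot {q : ℍ[ℝ]} (hn : Quaternion.normSq q = 1) (h : qrot q = 1) :
    q = 1 ∨ q = -1 := by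
  rw [Quaternion.normSq_def'] at hn
  have h0 := congrFun (congrFun h 0) 0
  have h1 := congrFun (congrFun h 1) 1
  have h2 := congrFun (congrFun h 2) 2
  simp [qrot] at h0 h1 h2
  have hI : q.imI = 0 := by nlinarith
  have hJ : q.imJ = 0 := by nlinarith
  have hK : q.imK = 0 := by nlinarith
  rw [hI, hJ, hK] at hn
  have : (q.re - 1) * (q.re + 1) = 0 := by nlinarith
  rcases mul_eq_zero.1 this with h | h
  · left
    ext <;> simp [hI, hJ, hK]
    linarith
  · right
    ext <;> simp [hI, hJ, hK]
    linarith

/-- Two unit quaternions over the same rotation differ by a sign. -/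
theorem eq_or_eq_neg_of_qrot {p q : ℍ[ℝ]} (hp : Quaternion.normSq p = 1)
    (hq : Quaternion.normSq q = 1) (h : qrot p = qrot q) (hO : (qrot p)ᵀ * qrot p = 1) :
    q = p ∨ q = -p := by
  have hpq : Quaternion.normSq (star p * q) = 1 := by
    rw [map_mul, Quaternion.normSq_star, hp, hq, one_mul]
  have hr : qrot (star p * q) = 1 := by rw [qrot_mul, qrot_star, ← h, hO]
  have hmul : p * (star p * q) = q := by rw [← mul_assoc, mul_star_self_of_normSq hp, one_mul]
  rcases eq_or_eq_neg_one_of_qrot hpq hr with h | h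
  · left
    rw [← hmul, h, mul_one]
  · right
    rw [← hmul, h, mul_neg, mul_one]

/-- The quaternion over the rotation by `α` about the `z` axis. -/
def quatZ (α : ℝ) : ℍ[ℝ] := ⟨Real.cos (α / 2), 0, 0, Real.sin (α / 2)⟩

/-- The quaternion over the rotation by `β` about the `y` axis. -/
def quatY (β : ℝ) : ℍ[ℝ] := ⟨Real.cos (β / 2), 0, Real.sin (β / 2), 0⟩

theorem normSq_quatZ (α : ℝ) : Quaternion.normSq (quatZ α) = 1 := by
  rw [Quaternion.normSq_def']
  simp [quatZ]

theorem normSq_quatY (α : ℝ) : Quaternion.normSq (quatY α) = 1 := by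
  rw [Quaternion.normSq_def']
  simp [quatY]

theorem cos_eq_half (t : ℝ) : Real.cos t = Real.cos (t / 2) ^ 2 - Real.sin (t / 2) ^ 2 := by
  conv_lhs => rw [← mul_div_cancel₀ t (two_ne_zero (α := ℝ)), Real.cos_two_mul']

theorem sin_eq_half (t : ℝ) : Real.sin t = 2 * Real.sin (t / 2) * Real.cos (t / 2) := by
  conv_lhs => rw [← mul_div_cancel₀ t (two_ne_zero (α := ℝ)), Real.sin_two_mul]

theorem qrot_quatZ (α : ℝ) : qrot (quatZ α) = (rotZ α).1 := by
  ext i j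
  fin_cases i <;> fin_cases j <;> simp [qrot, quatZ, rotZ, cos_eq_half α, sin_eq_half α] <;> ring

theorem qrot_quatY (β : ℝ) : qrot (quatY β) = (rotY β).1 := by
  ext i j
  fin_cases i <;> fin_cases j <;> simp [qrot, quatY, rotY, cos_eq_half β, sin_eq_half β] <;> ring

/-- The quaternion over a rotation given by Euler angles. -/
def quatEuler (α β γ : ℝ) : ℍ[ℝ] := quatZ α * quatY β * quatZ γ

theorem normSq_quatEuler (α β γ : ℝ) : Quaternion.normSq (quatEuler α β γ) = 1 := by
  simp [quatEuler, normSq_quatZ, normSq_quatY]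

theorem qrot_quatEuler (α β γ : ℝ) : qrot (quatEuler α β γ) = (euler α β γ).1 := by
  rw [quatEuler, qrot_mul, qrot_mul, qrot_quatZ, qrot_quatY, qrot_quatZ]
  rfl

theorem qmat_quatZ (α : ℝ) : qmat (quatZ α) =
    !![Complex.exp (-Complex.I * (α / 2)), 0; 0, Complex.exp (Complex.I * (α / 2))] := by
  have e1 : Complex.exp (-Complex.I * (α / 2)) = ⟨Real.cos (α / 2), -Real.sin (α / 2)⟩ := by
    rw [show -Complex.I * ((α : ℂ) / 2) = ((-(α / 2) : ℝ) : ℂ) * Complex.I by push_cast; ring]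
    apply Complex.ext
    · rw [Complex.exp_ofReal_mul_I_re, Real.cos_neg]
    · rw [Complex.exp_ofReal_mul_I_im, Real.sin_neg]
  have e2 : Complex.exp (Complex.I * (α / 2)) = ⟨Real.cos (α / 2), Real.sin (α / 2)⟩ := by
    rw [show Complex.I * ((α : ℂ) / 2) = (((α / 2) : ℝ) : ℂ) * Complex.I by push_cast; ring]
    apply Complex.ext
    · rw [Complex.exp_ofReal_mul_I_re]
    · rw [Complex.exp_ofReal_mul_I_im]
  rw [e1, e2]
  ext i j
  fin_cases i <;> fin_cases j <;> apply Complex.ext <;> simp [qmat, quatZ]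

theorem qmat_quatY (β : ℝ) : qmat (quatY β) = !![(Real.cos (β / 2) : ℂ), -(Real.sin (β / 2) : ℂ);
      (Real.sin (β / 2) : ℂ), (Real.cos (β / 2) : ℂ)] := by
  ext i j
  fin_cases i <;> fin_cases j <;> apply Complex.ext <;>
    simp [qmat, quatY, -Complex.ofReal_cos, -Complex.ofReal_sin]

/-- The powers `e^{-ijα/2} e^{i(2ℓ-j)α/2}` on the diagonal are `e^{-i(j-ℓ)α}`. -/
theorem spinRep_quatZ (l : ℕ) (α : ℝ) : spinRep l (qmat (quatZ α)) =
    Matrix.diagonal fun j : Fin (2 * l + 1) =>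
      Complex.exp (-Complex.I * (order l j : ℂ) * (α : ℂ)) := by
  rw [qmat_quatZ, spinRep_diag]
  congr 1
  funext j
  rw [← Complex.exp_nat_mul, ← Complex.exp_nat_mul, ← Complex.exp_add]
  congr 1
  rw [Nat.cast_sub (Nat.lt_succ_iff.1 j.2)]
  simp only [order]
  push_cast
  ring

theorem spinRep_quatY (l : ℕ) (β : ℝ) :
    spinRep l (qmat (quatY β)) = (Matrix.of (littleD l β)).map (↑) := by
  rw [qmat_quatY, spinRep_rotation]

theorem spinRep_quatEuler (l : ℕ) (α β γ : ℝ) :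
    spinRep l (qmat (quatEuler α β γ)) = wignerEuler l α β γ := by
  rw [quatEuler, qmat_mul, qmat_mul, spinRep_mul, spinRep_mul, spinRep_quatZ, spinRep_quatY,
    spinRep_quatZ]
  ext i j
  simp [wignerEuler, Matrix.mul_diagonal, Matrix.diagonal_mul]

theorem SO3.transpose_mul_self (R : SO3) : R.1ᵀ * R.1 = 1 :=
  mul_eq_one_comm.1 ((mem_SO3_iff _).1 R.2).1

/-- The Wigner matrix is computed from any of the two unit quaternions over a rotation. -/
theorem wignerD_eq_spinRep (l : ℕ) {R : SO3} {q : ℍ[ℝ]} (hq : Quaternion.normSq q = 1)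
    (h : qrot q = R.1) : wignerD l R = spinRep l (qmat q) := by
  rw [wignerD, ← spinRep_quatEuler]
  have he := (exists_euler R).choose_spec.2
  set a := (exists_euler R).choose
  have h1 : qrot (quatEuler a.1 a.2.1 a.2.2) = R.1 := by rw [qrot_quatEuler, he]
  rcases eq_or_eq_neg_of_qrot hq (normSq_quatEuler a.1 a.2.1 a.2.2) (h.trans h1.symm)
    (by rw [h, SO3.transpose_mul_self]) with h2 | h2
  · rw [h2]
  · rw [h2, qmat_neg, spinRep_neg]

theorem exists_quat (R : SO3) : ∃ q : ℍ[ℝ], Quaternion.normSq q = 1 ∧ qrot q = R.1 := by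
  obtain ⟨p, -, hp⟩ := exists_euler R
  exact ⟨_, normSq_quatEuler _ _ _, by rw [qrot_quatEuler, hp]⟩

/-! ### The Wigner matrices as unitary representation -/

theorem wignerD_euler (l : ℕ) (α β γ : ℝ) : wignerD l (euler α β γ) = wignerEuler l α β γ := by
  rw [wignerD_eq_spinRep l (normSq_quatEuler α β γ) (qrot_quatEuler α β γ), spinRep_quatEuler]

theorem wignerD_rotZ (l : ℕ) (α : ℝ) : wignerD l (rotZ α) =
    Matrix.diagonal fun j : Fin (2 * l + 1) =>
      Complex.exp (-Complex.I * (order l j : ℂ) * (α : ℂ)) := by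
  rw [wignerD_eq_spinRep l (normSq_quatZ α) (qrot_quatZ α), spinRep_quatZ]

theorem wignerD_rotY (l : ℕ) (β : ℝ) :
    wignerD l (rotY β) = (Matrix.of (littleD l β)).map (↑) := by
  rw [wignerD_eq_spinRep l (normSq_quatY β) (qrot_quatY β), spinRep_quatY]

theorem wignerD_mul (l : ℕ) (R S : SO3) : wignerD l (R * S) = wignerD l R * wignerD l S := by
  obtain ⟨p, hp, hp'⟩ := exists_quat R
  obtain ⟨q, hq, hq'⟩ := exists_quat S
  rw [wignerD_eq_spinRep l hp hp', wignerD_eq_spinRep l hq hq', ← spinRep_mul, ← qmat_mul]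
  refine wignerD_eq_spinRep l (by rw [map_mul, hp, hq, one_mul]) ?_
  rw [qrot_mul, hp', hq']
  rfl

theorem wignerD_inv (l : ℕ) (R : SO3) : wignerD l R⁻¹ = (wignerD l R)ᴴ := by
  obtain ⟨p, hp, hp'⟩ := exists_quat R
  rw [wignerD_eq_spinRep l hp hp', ← spinRep_conjTranspose, ← qmat_star]
  refine wignerD_eq_spinRep l (by rw [Quaternion.normSq_star, hp]) ?_
  rw [qrot_star, hp']
  rfl

theorem wignerD_one (l : ℕ) : wignerD l 1 = 1 := by
  rw [wignerD_eq_spinRep l (q := 1) (by simp), qmat_one, spinRep_one]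
  ext i j
  fin_cases i <;> fin_cases j <;> simp [qrot]

theorem wignerD_mul_conjTranspose (l : ℕ) (R : SO3) : wignerD l R * (wignerD l R)ᴴ = 1 := by
  rw [← wignerD_inv, ← wignerD_mul, mul_inv_cancel, wignerD_one]

theorem wignerD_conjTranspose_mul (l : ℕ) (R : SO3) : (wignerD l R)ᴴ * wignerD l R = 1 := by
  rw [← wignerD_inv, ← wignerD_mul, inv_mul_cancel, wignerD_one]

/-! ### Topology of the rotation group -/

instance : SecondCountableTopology (Matrix (Fin 3) (Fin 3) ℝ) :=
  inferInstanceAs (SecondCountableTopology (Fin 3 → Fin 3 → ℝ))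

instance : SecondCountableTopology SO3 := TopologicalSpace.Subtype.secondCountableTopology _

instance : IsTopologicalGroup SO3 where
  continuous_mul := continuous_mul
  continuous_inv := Continuous.subtype_mk (Continuous.matrix_transpose continuous_subtype_val) _

theorem qrot_mem {q : ℍ[ℝ]} (hq : q ∈ Metric.sphere (0 : ℍ[ℝ]) 1) :
    qrot q ∈ Matrix.specialOrthogonalGroup (Fin 3) ℝ := by
  have hn : Quaternion.normSq q = 1 := by
    rw [Quaternion.normSq_eq_norm_mul_self, mem_sphere_zero_iff_norm.1 hq, one_mul]
  rw [mem_SO3_iff]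
  constructor
  · rw [← qrot_star, ← qrot_mul, mul_star_self_of_normSq hn]
    ext i j
    fin_cases i <;> fin_cases j <;> simp [qrot]
  · have h : (qrot q).det = Quaternion.normSq q ^ 3 := by
      rw [Quaternion.normSq_def']
      simp [Matrix.det_fin_three, qrot]
      ring
    rw [h, hn, one_pow]

/-- The double cover of the rotation group by the unit quaternions. -/
def quatCover (q : Metric.sphere (0 : ℍ[ℝ]) 1) : SO3 := ⟨qrot q.1, qrot_mem q.2⟩

theorem continuous_qrot : Continuous qrot := by
  have := Quaternion.continuous_re
  have := Quaternion.continuous_imI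
  have := Quaternion.continuous_imJ
  have := Quaternion.continuous_imK
  refine continuous_matrix fun i j => ?_
  fin_cases i <;> fin_cases j <;> simp [qrot] <;> fun_prop

theorem continuous_qmat : Continuous qmat := by
  have := Quaternion.continuous_re
  have := Quaternion.continuous_imI
  have := Quaternion.continuous_imJ
  have := Quaternion.continuous_imK
  have h (f g : ℍ[ℝ] → ℝ) (hf : Continuous f) (hg : Continuous g) :
      Continuous fun q => (⟨f q, g q⟩ : ℂ) := by
    have : (fun q => (⟨f q, g q⟩ : ℂ)) = fun q => (f q : ℂ) + (g q : ℂ) * Complex.I := by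
      funext q
      exact (Complex.mk_eq_add_mul_I _ _)
    rw [this]
    fun_prop
  refine continuous_matrix fun i j => ?_
  fin_cases i <;> fin_cases j <;> simp [qmat] <;> apply h <;> fun_prop

theorem continuous_quatCover : Continuous quatCover :=
  (continuous_qrot.comp continuous_subtype_val).subtype_mk _

theorem surjective_quatCover : Function.Surjective quatCover := by
  intro R
  obtain ⟨q, hq, h⟩ := exists_quat R
  refine ⟨⟨q, ?_⟩, Subtype.ext h⟩
  rw [mem_sphere_zero_iff_norm]
  have := Quaternion.normSq_eq_norm_mul_self q
  nlinarith [norm_nonneg q]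

instance : CompactSpace SO3 := by
  have : ProperSpace ℍ[ℝ] := FiniteDimensional.proper_real _
  exact surjective_quatCover.compactSpace continuous_quatCover

/-- The Wigner matrices, which are defined by choosing Euler angles, are continuous: the compact
sphere of unit quaternions maps onto the rotation group, and the pullback is polynomial. -/
theorem continuous_wignerD (l : ℕ) : Continuous (wignerD l) := by
  have : ProperSpace ℍ[ℝ] := FiniteDimensional.proper_real _
  have hq : Topology.IsQuotientMap quatCover :=
    continuous_quatCover.isClosedMap.isQuotientMap continuous_quatCover surjective_quatCover
  rw [hq.continuous_iff]
  have : wignerD l ∘ quatCover = fun q => spinRep l (qmat q.1) := by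
    funext q
    refine wignerD_eq_spinRep l ?_ rfl
    rw [Quaternion.normSq_eq_norm_mul_self, mem_sphere_zero_iff_norm.1 q.2, one_mul]
  rw [this]
  exact (continuous_spinRep l).comp (continuous_qmat.comp continuous_subtype_val)

theorem continuous_wignerD_apply (l : ℕ) (i j : Fin (2 * l + 1)) :
    Continuous fun R => wignerD l R i j :=
  (continuous_wignerD l).matrix_elem i j

theorem norm_wignerD_apply_le (l : ℕ) (R : SO3) (i j : Fin (2 * l + 1)) :
    ‖wignerD l R i j‖ ≤ 1 :=
  entry_norm_bound_of_unitary (Matrix.mem_unitaryGroup_iff.2 (wignerD_mul_conjTranspose l R)) i j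

/-! ### The action on the sphere -/

instance : MulAction SO3 S2 where
  smul := rot
  one_smul u := by
    refine Subtype.ext ?_
    change WithLp.toLp 2 ((1 : Matrix (Fin 3) (Fin 3) ℝ) *ᵥ u.1.ofLp) = u.1
    rw [Matrix.one_mulVec]
  mul_smul R S u := by
    refine Subtype.ext ?_
    change WithLp.toLp 2 ((R.1 * S.1) *ᵥ u.1.ofLp) = WithLp.toLp 2 (R.1 *ᵥ (S.1 *ᵥ u.1.ofLp))
    rw [Matrix.mulVec_mulVec]

theorem rot_eq_smul (R : SO3) (u : S2) : rot R u = R • u := rfl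

theorem smul_apply (R : SO3) (u : S2) (i : Fin 3) :
    (R • u).1 i = R.1 i 0 * u.1 0 + R.1 i 1 * u.1 1 + R.1 i 2 * u.1 2 := by
  change (R.1 *ᵥ u.1.ofLp) i = _
  simp [Matrix.mulVec, dotProduct, Fin.sum_univ_three]

theorem sphere_ext {u v : S2} (h : ∀ i, u.1 i = v.1 i) : u = v :=
  Subtype.ext (PiLp.ext h)

instance : ContinuousSMul SO3 S2 where
  continuous_smul := by
    refine Continuous.subtype_mk ?_ _
    refine (PiLp.continuous_toLp 2 _).comp ?_
    exact Continuous.matrix_mulVec (continuous_subtype_val.comp continuous_fst)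
      ((PiLp.continuous_ofLp 2 _).comp (continuous_subtype_val.comp continuous_snd))

theorem north_apply : north.1 0 = 0 ∧ north.1 1 = 0 ∧ north.1 2 = 1 := by
  simp [north, sphPoint]

theorem smul_north_apply (R : SO3) (i : Fin 3) : (R • north).1 i = R.1 i 2 := by
  rw [smul_apply, north_apply.1, north_apply.2.1, north_apply.2.2]
  ring

theorem sq_sum_eq_one (u : S2) : u.1 0 ^ 2 + u.1 1 ^ 2 + u.1 2 ^ 2 = 1 := by
  have h : u.1.ofLp ⬝ᵥ u.1.ofLp = 1 := (mem_S2_iff _).1 u.2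
  simp only [dotProduct, Fin.sum_univ_three] at h
  linarith

theorem euler_smul_north (α β γ : ℝ) : euler α β γ • north = sphPoint β α := by
  refine sphere_ext fun i => ?_
  rw [smul_north_apply]
  fin_cases i <;>
    simp [euler, rotZ, rotY, sphPoint]

theorem neg_one_le_z (u : S2) : -1 ≤ u.1 2 := by nlinarith [sq_sum_eq_one u]

theorem z_le_one (u : S2) : u.1 2 ≤ 1 := by nlinarith [sq_sum_eq_one u]

theorem cos_colat (u : S2) : Real.cos (colat u) = u.1 2 :=
  Real.cos_arccos (neg_one_le_z u) (z_le_one u)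

theorem sin_colat (u : S2) : Real.sin (colat u) = ‖(⟨u.1 0, u.1 1⟩ : ℂ)‖ := by
  rw [colat, Real.sin_arccos, Complex.norm_def, Complex.normSq_mk]
  congr 1
  linarith [sq_sum_eq_one u]

theorem sin_colat_nonneg (u : S2) : 0 ≤ Real.sin (colat u) := by
  rw [sin_colat]
  exact norm_nonneg _

theorem sphPoint_colat_lon (u : S2) : sphPoint (colat u) (lon u) = u := by
  refine sphere_ext fun i => ?_
  have h1 : Real.cos (lon u) * Real.sin (colat u) = u.1 0 := by
    rw [sin_colat, mul_comm]
    exact Complex.norm_mul_cos_arg _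
  have h2 : Real.sin (lon u) * Real.sin (colat u) = u.1 1 := by
    rw [sin_colat, mul_comm]
    exact Complex.norm_mul_sin_arg _
  fin_cases i
  · simpa [sphPoint] using h1
  · simpa [sphPoint] using h2
  · simpa [sphPoint] using cos_colat u

theorem euler_lon_colat_smul_north (u : S2) (γ : ℝ) : euler (lon u) (colat u) γ • north = u := by
  rw [euler_smul_north, sphPoint_colat_lon]

theorem rotZ_smul_north (γ : ℝ) : rotZ γ • north = north := by
  refine sphere_ext fun i => ?_
  rw [smul_north_apply]
  fin_cases i <;> simp [rotZ, north, sphPoint]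

theorem surjective_smul_north : Function.Surjective fun R : SO3 => R • north :=
  fun u => ⟨_, euler_lon_colat_smul_north u 0⟩

theorem continuous_smul_north : Continuous fun R : SO3 => R • north :=
  continuous_id.smul continuous_const

/-- The stabilizer of the North pole consists of the rotations about the `z` axis. -/
theorem exists_mul_rotZ {R S : SO3} (h : R • north = S • north) : ∃ γ, S = R * rotZ γ := by
  have h' : (R⁻¹ * S) • north = north := by rw [mul_smul, ← h, inv_smul_smul]
  have e (i : Fin 3) : (R⁻¹ * S).1 i 2 = north.1 i := by rw [← smul_north_apply, h']
  obtain ⟨γ, hγ⟩ := exists_rotZ (R⁻¹ * S) (by rw [e, north_apply.1]) (by rw [e, north_apply.2.1])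
    (by rw [e, north_apply.2.2])
  exact ⟨γ, by rw [← hγ, mul_inv_cancel_left]⟩

theorem rotZ_add (s t : ℝ) : rotZ (s + t) = rotZ s * rotZ t := by
  refine Subtype.ext ?_
  change _ = (rotZ s).1 * (rotZ t).1
  ext i j
  fin_cases i <;> fin_cases j <;>
    simp [rotZ, Matrix.mul_apply, Fin.sum_univ_three, Real.cos_add, Real.sin_add] <;> ring

/-! ### Spherical harmonics as columns of the Wigner matrices -/

theorem order_mid (l : ℕ) : order l (mid l) = 0 := by simp [order, mid]

theorem wignerD_mul_rotZ_mid (l : ℕ) (R : SO3) (γ : ℝ) (i : Fin (2 * l + 1)) :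
    wignerD l (R * rotZ γ) i (mid l) = wignerD l R i (mid l) := by
  rw [wignerD_mul, wignerD_rotZ, Matrix.mul_diagonal, order_mid]
  simp

/-- The continuous version of the spherical harmonics: the middle column of the Wigner matrix of
any rotation that takes the North pole to `u`. It agrees with `sphHarm` away from the poles. -/
def sphY (l : ℕ) (u : S2) (i : Fin (2 * l + 1)) : ℂ :=
  (normConst l 0 : ℂ) * wignerD l (euler (lon u) (colat u) 0) i (mid l)

theorem sphY_smul_north (l : ℕ) (R : SO3) (i : Fin (2 * l + 1)) :
    sphY l (R • north) i = (normConst l 0 : ℂ) * wignerD l R i (mid l) := by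
  obtain ⟨γ, hγ⟩ := exists_mul_rotZ (euler_lon_colat_smul_north (R • north) 0).symm
  rw [sphY, hγ, wignerD_mul_rotZ_mid]

theorem sphY_smul (l : ℕ) (R : SO3) (u : S2) (i : Fin (2 * l + 1)) :
    sphY l (R • u) i = ∑ k, wignerD l R i k * sphY l u k := by
  obtain ⟨V, rfl⟩ := surjective_smul_north u
  simp only
  rw [← mul_smul, sphY_smul_north, wignerD_mul, Matrix.mul_apply, Finset.mul_sum]
  refine Finset.sum_congr rfl fun k _ => ?_
  rw [sphY_smul_north]
  ring

/-- Continuity descends from the rotation group, of which the sphere is a quotient. -/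
theorem continuous_sphY (l : ℕ) (i : Fin (2 * l + 1)) : Continuous fun u => sphY l u i := by
  have hq : Topology.IsQuotientMap fun R : SO3 => R • north :=
    continuous_smul_north.isClosedMap.isQuotientMap continuous_smul_north surjective_smul_north
  rw [hq.continuous_iff]
  have : ((fun u => sphY l u i) ∘ fun R : SO3 => R • north) =
      fun R => (normConst l 0 : ℂ) * wignerD l R i (mid l) :=
    funext fun R => sphY_smul_north l R i
  rw [this]
  exact continuous_const.mul (continuous_wignerD_apply l i (mid l))

theorem sphY_sphPoint (l : ℕ) (β α : ℝ) (i : Fin (2 * l + 1)) :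
    sphY l (sphPoint β α) i = (normConst l 0 : ℂ) *
      (Complex.exp (-Complex.I * (order l i : ℂ) * (α : ℂ)) * (littleD l β i (mid l) : ℂ)) := by
  rw [← euler_smul_north α β 0, sphY_smul_north, wignerD_euler]
  simp [wignerEuler]

/-! ### Rodrigues' formula -/

open Polynomial in
/-- The polynomial `(d/dx)^i (x² - 1)^ℓ` of Rodrigues' formula. -/
def rodrigues (l i : ℕ) : ℝ[X] := derivative^[i] ((X ^ 2 - 1 : ℝ[X]) ^ l)

/-- The product of factorials in the denominators of `littleD` in the middle column. -/
def midDenom (l i s : ℕ) : ℝ :=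
  ((l - s).factorial : ℝ) * (s.factorial : ℝ) * ((i + s - l).factorial : ℝ) *
    ((2 * l - (i + s)).factorial : ℝ)

theorem midDenom_ne_zero (l i s : ℕ) : midDenom l i s ≠ 0 := by
  simp [midDenom, Nat.factorial_ne_zero]

/-- Leibniz' rule for `(x + 1)^ℓ (x - 1)^ℓ`, at `x + 1 = 2 cos² (β / 2)` and
`x - 1 = -2 sin² (β / 2)`. -/
theorem eval_rodrigues (l : ℕ) {i : ℕ} (hi : i ≤ 2 * l) (β : ℝ) :
    (rodrigues l i).eval (Real.cos β) = (i.factorial : ℝ) * (l.factorial : ℝ) ^ 2 *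
      2 ^ (2 * l - i) * ∑ s ∈ splitRange (2 * l) i l,
        (-1) ^ s * Real.cos (β / 2) ^ (2 * (2 * l - (i + s))) * Real.sin (β / 2) ^ (2 * s) /
          midDenom l i s := by
  have hp : (Polynomial.X ^ 2 - 1 : Polynomial ℝ) ^ l =
      (Polynomial.X + Polynomial.C 1) ^ l * (Polynomial.X - Polynomial.C 1) ^ l := by
    rw [← mul_pow, map_one]
    ring
  have hc : Real.cos β + 1 = 2 * Real.cos (β / 2) ^ 2 := by
    rw [cos_eq_half β]; linarith [Real.sin_sq_add_cos_sq (β / 2)]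
  have hs : Real.cos β - 1 = -1 * (2 * Real.sin (β / 2) ^ 2) := by
    rw [cos_eq_half β]; linarith [Real.sin_sq_add_cos_sq (β / 2)]
  rw [rodrigues, hp, Polynomial.iterate_derivative_mul]
  simp only [Polynomial.iterate_derivative_X_add_pow, Polynomial.iterate_derivative_X_sub_pow,
    Polynomial.eval_finsetSum, Polynomial.eval_smul, Polynomial.eval_mul, Polynomial.eval_pow,
    Polynomial.eval_add, Polynomial.eval_sub, Polynomial.eval_X, Polynomial.eval_C, hc, hs]
  rw [Finset.mul_sum]
  symm
  refine Finset.sum_of_injOn (fun s => l - s) ?_ ?_ ?_ ?_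
  · intro s hs t ht h
    simp only [Finset.mem_coe, mem_splitRange] at hs ht h
    omega
  · intro s hs
    simp only [Finset.coe_range, Set.mem_Iio, Finset.mem_coe, mem_splitRange] at hs ⊢
    omega
  · intro k hk hk'
    simp only [Finset.mem_range] at hk
    by_cases h1 : l < k
    · simp [Nat.descFactorial_eq_zero_iff_lt.2 h1]
    · by_cases h2 : l < i - k
      · simp [Nat.descFactorial_eq_zero_iff_lt.2 h2]
      · refine absurd ⟨l - k, ?_, by simp only; omega⟩ hk'
        simp only [Finset.mem_coe, mem_splitRange]
        omega
  · intro s hs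
    rw [mem_splitRange] at hs
    have e1 : i - (l - s) = i + s - l := by omega
    have e2 : l - (i + s - l) = 2 * l - (i + s) := by omega
    have e3 : l - (l - s) = s := by omega
    have h1 : (i.choose (l - s) : ℝ) * ((l - s).factorial : ℝ) * ((i + s - l).factorial : ℝ) =
        (i.factorial : ℝ) := by
      rw [← e1]
      exact_mod_cast Nat.choose_mul_factorial_mul_factorial (by omega)
    have h2 : ((2 * l - (i + s)).factorial : ℝ) * (l.descFactorial (i + s - l) : ℝ) =
        (l.factorial : ℝ) := by
      rw [← e2]
      exact_mod_cast Nat.factorial_mul_descFactorial (by omega)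
    have h3 : (s.factorial : ℝ) * (l.descFactorial (l - s) : ℝ) = (l.factorial : ℝ) := by
      conv_lhs => rw [← e3]
      rw [e3]
      have := Nat.factorial_mul_descFactorial (show l - s ≤ l by omega)
      rw [e3] at this
      exact_mod_cast this
    have h4 : (2 : ℝ) ^ (2 * l - i) = 2 ^ (2 * l - (i + s)) * 2 ^ s := by
      rw [← pow_add]
      congr 1
      omega
    simp only [e1, e2, e3, nsmul_eq_mul]
    rw [mul_div_assoc', div_eq_iff (midDenom_ne_zero l i s), ← h1, h4, pow_two (l.factorial : ℝ)]
    nth_rw 1 [← h2]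
    nth_rw 1 [← h3]
    rw [midDenom, mul_pow, mul_pow, mul_pow, ← pow_mul, ← pow_mul]
    ring

/-- The sum in the middle column of `littleD`. -/
def midSum (l i : ℕ) (β : ℝ) : ℝ :=
  ∑ s ∈ splitRange (2 * l) i l, (-1) ^ (i + s - l) *
    Real.cos (β / 2) ^ ((2 * l - (i + s)) + (l - s)) *
    Real.sin (β / 2) ^ ((i + s - l) + s) / midDenom l i s

theorem littleD_mid (l : ℕ) (β : ℝ) (i : Fin (2 * l + 1)) :
    littleD l β i (mid l) =
      Real.sqrt ((i : ℕ).factorial * (2 * l - (i : ℕ)).factorial) * l.factorial *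
        midSum l i β := by
  have h : 2 * l - l = l := by omega
  simp only [littleD, mid, midSum, midDenom, splitRange, h]
  rw [Real.sqrt_mul (by positivity), Real.sqrt_mul_self (by positivity)]
  rfl

theorem pow_mul_eval_rodrigues (l m : ℕ) (hm : m ≤ l) (β : ℝ) :
    Real.sin β ^ m * (rodrigues l (l + m)).eval (Real.cos β) =
      (-1) ^ m * 2 ^ l * ((l + m).factorial : ℝ) * (l.factorial : ℝ) ^ 2 * midSum l (l + m) β := by
  rw [eval_rodrigues l (by omega), sin_eq_half β, midSum, Finset.mul_sum, Finset.mul_sum,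
    Finset.mul_sum]
  refine Finset.sum_congr rfl fun s hs => ?_
  rw [mem_splitRange] at hs
  have e1 : l + m + s - l = m + s := by omega
  obtain ⟨t, ht⟩ : ∃ t, l = m + s + t := ⟨l - (m + s), by omega⟩
  have e2 : 2 * l - (l + m + s) = t := by omega
  have e3 : l - s = m + t := by omega
  have e4 : 2 * l - (l + m) = s + t := by omega
  have e5 : (2 : ℝ) ^ l = 2 ^ m * 2 ^ (s + t) := by rw [ht]; ring
  have e6 : (-1 : ℝ) ^ m * (-1) ^ m = 1 := by rw [← mul_pow]; simp
  simp only [e1, e2, e3, e4]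
  rw [e5]
  linear_combination (-(2 ^ m * 2 ^ (s + t) * ((l + m).factorial : ℝ) * (l.factorial : ℝ) ^ 2 *
    ((-1) ^ s * Real.cos (β / 2) ^ (2 * t + m) * Real.sin (β / 2) ^ (2 * s + m) /
      midDenom l (l + m) s))) * e6

theorem eval_rodrigues_sub (l m : ℕ) (hm : m ≤ l) (β : ℝ) :
    (rodrigues l (l - m)).eval (Real.cos β) =
      (-1) ^ m * 2 ^ l * ((l - m).factorial : ℝ) * (l.factorial : ℝ) ^ 2 *
        (Real.sin β ^ m * midSum l (l - m) β) := by
  rw [eval_rodrigues l (by omega), sin_eq_half β, midSum, Finset.mul_sum, Finset.mul_sum,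
    Finset.mul_sum]
  refine Finset.sum_congr rfl fun s hs => ?_
  rw [mem_splitRange] at hs
  obtain ⟨r, hr⟩ : ∃ r, s = m + r := ⟨s - m, by omega⟩
  obtain ⟨t, ht⟩ : ∃ t, l = m + r + t := ⟨l - (m + r), by omega⟩
  have e1 : l - m + s - l = r := by omega
  have e2 : 2 * l - (l - m + s) = m + t := by omega
  have e3 : l - s = t := by omega
  have e4 : 2 * l - (l - m) = m + m + r + t := by omega
  have e5 : (2 : ℝ) ^ l = 2 ^ m * 2 ^ (r + t) := by rw [ht]; ring
  simp only [e1, e2, e3, e4]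
  rw [e5, hr]
  ring

/-- The symmetry `P_ℓ^{-m} ∝ P_ℓ^m`. -/
theorem midSum_sub (l m : ℕ) (hm : m ≤ l) (β : ℝ) :
    midSum l (l - m) β = (-1) ^ m * midSum l (l + m) β := by
  rw [midSum, midSum, Finset.mul_sum]
  refine Finset.sum_bij' (fun s _ => s - m) (fun s _ => s + m) ?_ ?_ ?_ ?_ ?_ <;> intro s hs <;>
    rw [mem_splitRange] at *
  · omega
  · omega
  · omega
  · omega
  · obtain ⟨r, rfl⟩ : ∃ r, s = m + r := ⟨s - m, by omega⟩
    obtain ⟨t, ht⟩ : ∃ t, l = m + r + t := ⟨l - (m + r), by omega⟩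
    have e1 : l - m + (m + r) - l = r := by omega
    have e2 : 2 * l - (l - m + (m + r)) = m + t := by omega
    have e3 : l - (m + r) = t := by omega
    have f0 : m + r - m = r := by omega
    have f1 : l + m + r - l = m + r := by omega
    have f2 : 2 * l - (l + m + r) = t := by omega
    have f3 : l - r = m + t := by omega
    have e6 : (-1 : ℝ) ^ m * (-1) ^ m = 1 := by rw [← mul_pow]; simp
    simp only [f0, e1, e2, e3, f1, f2, f3, midDenom]
    rw [pow_add (-1 : ℝ) m r]
    linear_combination (-((-1) ^ r * Real.cos (β / 2) ^ (m + t + t) *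
      Real.sin (β / 2) ^ (r + (m + r)) / ((t.factorial : ℝ) * ((m + r).factorial : ℝ) *
        (r.factorial : ℝ) * ((m + t).factorial : ℝ)))) * e6

/-- Rodrigues' formula and Wigner's formula agree in the middle column. For orders `m < 0` the
negative power of `sin β` in `assocLegendre` cancels, which needs `sin β ≠ 0`. -/
theorem assocLegendre_cos (l : ℕ) (i : Fin (2 * l + 1)) {β : ℝ} (hβ : 0 < Real.sin β) :
    assocLegendre l (order l i) (Real.cos β) =
      ((i : ℕ).factorial : ℝ) * (l.factorial : ℝ) * midSum l i β := by
  have hi : ((l : ℤ) + order l i).toNat = (i : ℕ) := by simp [order]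
  have hsq : Real.sqrt (1 - Real.cos β ^ 2) = Real.sin β := by
    rw [← Real.sin_sq, Real.sqrt_sq hβ.le]
  have hl : (l.factorial : ℝ) ≠ 0 := Nat.cast_ne_zero.2 (Nat.factorial_ne_zero _)
  have hs : Real.sin β ≠ 0 := hβ.ne'
  rw [assocLegendre, hi, hsq]
  change _ * (rodrigues l i).eval (Real.cos β) = _
  have e6 (m : ℕ) : (-1 : ℝ) ^ m * (-1) ^ m = 1 := by rw [← mul_pow]; simp
  rcases le_total l (i : ℕ) with h | h
  · obtain ⟨m, hm⟩ := Nat.exists_eq_add_of_le h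
    have ho : order l i = (m : ℤ) := by simp [order, hm]
    have hk := pow_mul_eval_rodrigues l m (by omega) β
    rw [ho, zpow_natCast, zpow_natCast, mul_assoc, hm, hk]
    field_simp
    linear_combination midSum l (l + m) β * e6 m
  · obtain ⟨m, hm, hml⟩ : ∃ m, (i : ℕ) = l - m ∧ m ≤ l := ⟨l - i, by omega, by omega⟩
    have ho : order l i = -(m : ℤ) := by simp [order, hm, hml]
    rw [ho, _root_.zpow_neg, _root_.zpow_neg, zpow_natCast, zpow_natCast, hm,
      eval_rodrigues_sub l m hml]
    field_simp

theorem normConst_eq (l : ℕ) (i : Fin (2 * l + 1)) :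
    normConst l (order l i) = normConst l 0 *
      Real.sqrt (((2 * l - (i : ℕ)).factorial : ℝ) / ((i : ℕ).factorial : ℝ)) := by
  have h1 : ((l : ℤ) + order l i).toNat = (i : ℕ) := by simp [order]
  have h2 : ((l : ℤ) - order l i).toNat = 2 * l - (i : ℕ) := by
    have := i.2
    simp only [order]
    omega
  have h3 : (l.factorial : ℝ) ≠ 0 := Nat.cast_ne_zero.2 (Nat.factorial_ne_zero _)
  rw [normConst, normConst, h1, h2, Real.sqrt_mul (by positivity)]
  simp [h3]

/-- Rodrigues' definition of the spherical harmonics agrees with the Wigner matrices off the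
poles. -/
theorem sphHarm_eq_sphY (l : ℕ) {u : S2} (hu : Real.sin (colat u) ≠ 0) (i : Fin (2 * l + 1)) :
    sphHarm l u i = sphY l u i := by
  have hpos : 0 < Real.sin (colat u) := lt_of_le_of_ne (sin_colat_nonneg u) (Ne.symm hu)
  have hY := sphY_sphPoint l (colat u) (lon u) i
  rw [sphPoint_colat_lon] at hY
  rw [hY, sphHarm, assocLegendre_cos l i hpos, normConst_eq, littleD_mid]
  have h1 : (0 : ℝ) < ((i : ℕ).factorial : ℝ) := Nat.cast_pos.2 (Nat.factorial_pos _)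
  have h2 : (0 : ℝ) < ((2 * l - (i : ℕ)).factorial : ℝ) := Nat.cast_pos.2 (Nat.factorial_pos _)
  have h3 : Real.sqrt (((2 * l - (i : ℕ)).factorial : ℝ) / ((i : ℕ).factorial : ℝ)) *
      ((i : ℕ).factorial : ℝ) =
      Real.sqrt (((i : ℕ).factorial : ℝ) * ((2 * l - (i : ℕ)).factorial : ℝ)) := by
    rw [Real.sqrt_div h2.le, Real.sqrt_mul h1.le, div_mul_eq_mul_div,
      div_eq_iff (Real.sqrt_pos.2 h1).ne']
    nth_rw 1 [← Real.mul_self_sqrt h1.le]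
    ring
  rw [← h3]
  push_cast
  ring

theorem normConst_zero_pos (l : ℕ) : 0 < normConst l 0 := by
  have h : (0 : ℝ) < (l.factorial : ℝ) := Nat.cast_pos.2 (Nat.factorial_pos _)
  rw [normConst]
  simp only [sub_zero, add_zero, Int.toNat_natCast]
  positivity

theorem normConst_zero_sq (l : ℕ) : normConst l 0 ^ 2 = (2 * (l : ℝ) + 1) / (4 * π) := by
  have h : (l.factorial : ℝ) ≠ 0 := Nat.cast_ne_zero.2 (Nat.factorial_ne_zero _)
  rw [normConst, Real.sq_sqrt (by positivity)]
  simp [h]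

/-! ### The surface measure -/

theorem colatMeasure_univ : colatMeasure Set.univ = ENNReal.ofReal 2 := by
  rw [colatMeasure, withDensity_apply _ MeasurableSet.univ, Measure.restrict_univ,
    ← ofReal_integral_eq_lintegral_ofReal]
  · rw [integral_Icc_eq_integral_Ioc, ← intervalIntegral.integral_of_le Real.pi_pos.le,
      integral_sin]
    norm_num
  · exact (Real.continuous_sin.continuousOn).integrableOn_Icc
  · exact (ae_restrict_iff' measurableSet_Icc).2
      (Filter.Eventually.of_forall fun x hx => Real.sin_nonneg_of_mem_Icc hx)

theorem circMeasure_univ : circMeasure Set.univ = ENNReal.ofReal (2 * π) := by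
  simp [circMeasure]

instance : IsFiniteMeasure colatMeasure := ⟨by simp [colatMeasure_univ]⟩

instance : IsFiniteMeasure circMeasure := ⟨by rw [circMeasure_univ]; exact ENNReal.ofReal_lt_top⟩

theorem continuous_sphPoint : Continuous fun p : ℝ × ℝ => sphPoint p.1 p.2 := by
  refine Continuous.subtype_mk ((PiLp.continuous_toLp 2 _).comp (continuous_pi fun i => ?_)) _
  fin_cases i <;> simp <;> fun_prop

instance : IsFiniteMeasure sphMeasure :=
  Measure.isFiniteMeasure_map _ _

theorem integral_colatMeasure (g : ℝ → ℂ) :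
    ∫ β, g β ∂colatMeasure = ∫ β in (0 : ℝ)..π, (Real.sin β : ℂ) * g β := by
  rw [colatMeasure, integral_withDensity_eq_integral_toReal_smul (by fun_prop) (by simp),
    intervalIntegral.integral_of_le Real.pi_pos.le, ← integral_Icc_eq_integral_Ioc]
  refine setIntegral_congr_fun measurableSet_Icc fun β hβ => ?_
  simp only [ENNReal.toReal_ofReal (Real.sin_nonneg_of_mem_Icc hβ), Complex.real_smul]

theorem integral_circMeasure (g : ℝ → ℂ) :
    ∫ α, g α ∂circMeasure = ∫ α in (0 : ℝ)..(2 * π), g α := by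
  rw [circMeasure, intervalIntegral.integral_of_le (by positivity), ← integral_Icc_eq_integral_Ioc]

theorem colatMeasure_ae_sin_pos : ∀ᵐ β ∂colatMeasure, 0 < Real.sin β ∧ β ∈ Set.Icc 0 π := by
  have hac : colatMeasure ≪ volume.restrict (Set.Icc 0 π) := withDensity_absolutelyContinuous _ _
  refine hac.ae_le ?_
  rw [← Measure.restrict_congr_set Ioo_ae_eq_Icc]
  refine (ae_restrict_iff' measurableSet_Ioo).2 ?_
  exact Filter.Eventually.of_forall fun x hx =>
    ⟨Real.sin_pos_of_mem_Ioo hx, Set.Ioo_subset_Icc_self hx⟩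

theorem colat_sphPoint {β : ℝ} (hβ : β ∈ Set.Icc 0 π) (α : ℝ) : colat (sphPoint β α) = β := by
  simp only [colat, sphPoint, Matrix.cons_val]
  exact Real.arccos_cos hβ.1 hβ.2

theorem continuous_colat : Continuous colat := by
  unfold colat
  refine Real.continuous_arccos.comp ?_
  exact (PiLp.continuous_apply 2 _ 2).comp continuous_subtype_val

/-- The poles are negligible. -/
theorem sphMeasure_ae_sin_colat_pos : ∀ᵐ u ∂sphMeasure, 0 < Real.sin (colat u) := by
  have hm : MeasurableSet {u : S2 | 0 < Real.sin (colat u)} :=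
    measurableSet_lt measurable_const (Real.continuous_sin.comp continuous_colat).measurable
  rw [sphMeasure, ae_map_iff continuous_sphPoint.measurable.aemeasurable hm]
  have h := (Measure.quasiMeasurePreserving_fst (μ := colatMeasure) (ν := circMeasure)).ae
    colatMeasure_ae_sin_pos
  filter_upwards [h] with p hp
  rw [colat_sphPoint hp.2]
  exact hp.1

theorem sphHarm_ae_eq (l : ℕ) : ∀ᵐ u ∂sphMeasure, ∀ i, sphHarm l u i = sphY l u i := by
  filter_upwards [sphMeasure_ae_sin_colat_pos] with u hu i
  exact sphHarm_eq_sphY l hu.ne' i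

/-- In the coefficients, `sphHarm` may be replaced by its continuous version. -/
theorem sphCoeff_eq (f : S2 → ℂ) (l : ℕ) (i : Fin (2 * l + 1)) :
    sphCoeff f l i = ∫ u, f u * star (sphY l u i) ∂sphMeasure := by
  refine integral_congr_ae ?_
  filter_upwards [sphHarm_ae_eq l] with u hu
  rw [hu]

/-! ### Integrals of spherical harmonics -/

theorem integral_exp_circ {m : ℤ} (hm : m ≠ 0) :
    ∫ α, Complex.exp (-Complex.I * (m : ℂ) * (α : ℂ)) ∂circMeasure = 0 := by
  rw [integral_circMeasure, integral_exp_mul_complex (by simp [hm])]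
  have : -Complex.I * (m : ℂ) * ((2 * π : ℝ) : ℂ) = ((-m : ℤ) : ℂ) * (2 * π * Complex.I) := by
    push_cast; ring
  rw [this, Complex.exp_int_mul_two_pi_mul_I]
  simp

theorem littleD_mid_mid (l : ℕ) (β : ℝ) : littleD l β (mid l) (mid l) =
    (2 ^ l * (l.factorial : ℝ))⁻¹ * (rodrigues l l).eval (Real.cos β) := by
  have h := pow_mul_eval_rodrigues l 0 (Nat.zero_le _) β
  have h2 : 2 * l - l = l := by omega
  have hl : (l.factorial : ℝ) ≠ 0 := Nat.cast_ne_zero.2 (Nat.factorial_ne_zero _)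
  simp only [pow_zero, one_mul, add_zero] at h
  rw [littleD_mid, h]
  simp only [mid, h2]
  rw [Real.sqrt_mul_self (by positivity)]
  field_simp

theorem rodrigues_eval_eq_zero {l i : ℕ} (hi : i < l) {x : ℝ} (hx : x ^ 2 = 1) :
    (rodrigues l i).eval x = 0 := by
  have h := Polynomial.pow_sub_dvd_iterate_derivative_of_pow_dvd i
    (dvd_refl ((Polynomial.X ^ 2 - 1 : Polynomial ℝ) ^ l))
  obtain ⟨q, hq⟩ := (dvd_pow_self (Polynomial.X ^ 2 - 1 : Polynomial ℝ)
    (show l - i ≠ 0 by omega)).trans h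
  rw [rodrigues, hq]
  simp [hx]

theorem derivative_rodrigues (l i : ℕ) :
    Polynomial.derivative (rodrigues l i) = rodrigues l (i + 1) := by
  rw [rodrigues, rodrigues, Function.iterate_succ_apply']

/-- The spherical harmonics of positive degree have mean zero: for orders `m ≠ 0` by integration
over the longitude, for `m = 0` because `P_ℓ` is the derivative of a polynomial with zeros at `±1`,
by Rodrigues' formula. -/
theorem integral_sphY {l : ℕ} (hl : l ≠ 0) (i : Fin (2 * l + 1)) :
    ∫ u, sphY l u i ∂sphMeasure = 0 := by
  rw [sphMeasure, integral_map continuous_sphPoint.measurable.aemeasurable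
    (continuous_sphY l i).aestronglyMeasurable]
  have h (p : ℝ × ℝ) : sphY l (sphPoint p.1 p.2) i = ((normConst l 0 : ℂ) *
      (littleD l p.1 i (mid l) : ℂ)) * Complex.exp (-Complex.I * (order l i : ℂ) * (p.2 : ℂ)) := by
    rw [sphY_sphPoint]
    ring
  simp only [h]
  rw [integral_prod_mul (fun β : ℝ => (normConst l 0 : ℂ) * (littleD l β i (mid l) : ℂ))
    (fun α : ℝ => Complex.exp (-Complex.I * (order l i : ℂ) * (α : ℂ)))]
  by_cases hi : i = mid l
  · subst hi
    refine mul_eq_zero_of_left ?_ _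
    rw [integral_const_mul, integral_colatMeasure]
    refine mul_eq_zero_of_right _ ?_
    obtain ⟨k, rfl⟩ := Nat.exists_eq_succ_of_ne_zero hl
    have h1 : ∀ β ∈ Set.uIcc 0 π, HasDerivAt
        (fun β : ℝ => -(rodrigues (k + 1) k).eval (Real.cos β))
        (Real.sin β * (rodrigues (k + 1) (k + 1)).eval (Real.cos β)) β := by
      intro β _
      have := ((rodrigues (k + 1) k).hasDerivAt (Real.cos β)).comp β (Real.hasDerivAt_cos β)
      rw [derivative_rodrigues] at this
      exact this.neg.congr_deriv (by ring)
    have h2 := intervalIntegral.integral_eq_sub_of_hasDerivAt h1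
      (Continuous.intervalIntegrable (by fun_prop) _ _)
    rw [rodrigues_eval_eq_zero (by omega) (by simp), rodrigues_eval_eq_zero (by omega) (by simp)]
      at h2
    have h3 (β : ℝ) : (Real.sin β : ℂ) *
        (littleD (k + 1) β (mid (k + 1)) (mid (k + 1)) : ℂ) =
        ((2 ^ (k + 1) * ((k + 1).factorial : ℝ))⁻¹ : ℝ) *
          ((Real.sin β * (rodrigues (k + 1) (k + 1)).eval (Real.cos β) : ℝ) : ℂ) := by
      rw [littleD_mid_mid]
      push_cast
      ring
    simp only [Nat.succ_eq_add_one, h3]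
    rw [intervalIntegral.integral_const_mul, intervalIntegral.integral_ofReal, h2]
    simp
  · refine mul_eq_zero_of_right _ (integral_exp_circ ?_)
    intro h0
    refine hi (Fin.ext ?_)
    simp only [order] at h0
    simp only [mid]
    omega

/-! ### Density of the span of the spherical harmonics -/

/-- The spherical harmonics as continuous functions. -/
def sphYC (l : ℕ) (i : Fin (2 * l + 1)) : C(S2, ℂ) := ⟨fun u => sphY l u i, continuous_sphY l i⟩

/-- The span of the spherical harmonics. -/
def harmSpan : Submodule ℂ C(S2, ℂ) :=
  Submodule.span ℂ (Set.range fun p : Σ l : ℕ, Fin (2 * l + 1) => sphYC p.1 p.2)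

/-- The function `x - i y` on the sphere. -/
def zetaC : C(S2, ℂ) where
  toFun u := (u.1 0 : ℂ) - (u.1 1 : ℂ) * Complex.I
  continuous_toFun := by
    have (i : Fin 3) : Continuous fun u : S2 => u.1 i :=
      (PiLp.continuous_apply 2 _ i).comp continuous_subtype_val
    fun_prop

/-- The function `z` on the sphere. -/
def zC : C(S2, ℂ) where
  toFun u := (u.1 2 : ℂ)
  continuous_toFun := Complex.continuous_ofReal.comp
    ((PiLp.continuous_apply 2 _ 2).comp continuous_subtype_val)

theorem zetaC_sphPoint (β α : ℝ) :
    zetaC (sphPoint β α) = (Real.sin β : ℂ) * Complex.exp (-Complex.I * (α : ℂ)) := by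
  have : Complex.exp (-Complex.I * (α : ℂ)) = (Real.cos α : ℂ) - (Real.sin α : ℂ) * Complex.I := by
    rw [show -Complex.I * (α : ℂ) = (-(α : ℂ)) * Complex.I by ring, Complex.exp_mul_I]
    simp
    ring
  rw [this]
  simp [zetaC, sphPoint]
  ring

theorem aeval_zC_apply (p : Polynomial ℝ) (u : S2) :
    Polynomial.aeval zC p u = ((p.eval (u.1 2) : ℝ) : ℂ) := by
  have h : Polynomial.aeval zC p u = Polynomial.aeval (zC u) p := by
    induction p using Polynomial.induction_on' with
    | add p q hp hq => simp [hp, hq]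
    | monomial n a => simp [Polynomial.aeval_monomial]
  rw [h]
  change Polynomial.aeval ((u.1 2 : ℝ) : ℂ) p = _
  rw [show ((u.1 2 : ℝ) : ℂ) = algebraMap ℝ ℂ (u.1 2) from rfl, Polynomial.aeval_algebraMap_apply]
  simp [Polynomial.aeval_def]

theorem sphY_eq_midSum (l : ℕ) (β α : ℝ) (i : Fin (2 * l + 1)) :
    sphY l (sphPoint β α) i = ((normConst l 0 * (Real.sqrt ((i : ℕ).factorial *
      (2 * l - (i : ℕ)).factorial) * l.factorial) : ℝ) : ℂ) *
      (Complex.exp (-Complex.I * (order l i : ℂ) * (α : ℂ)) * (midSum l i β : ℂ)) := by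
  rw [sphY_sphPoint, littleD_mid]
  push_cast
  ring

theorem sphY_const_ne_zero (l : ℕ) (i : ℕ) : ((normConst l 0 * (Real.sqrt (i.factorial *
      (2 * l - i).factorial) * l.factorial) : ℝ) : ℂ) ≠ 0 := by
  have h0 := normConst_zero_pos l
  have h1 : (0 : ℝ) < (i.factorial : ℝ) := Nat.cast_pos.2 (Nat.factorial_pos _)
  have h2 : (0 : ℝ) < ((2 * l - i).factorial : ℝ) := Nat.cast_pos.2 (Nat.factorial_pos _)
  have h3 : (0 : ℝ) < (l.factorial : ℝ) := Nat.cast_pos.2 (Nat.factorial_pos _)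
  have : 0 < Real.sqrt ((i.factorial : ℝ) * ((2 * l - i).factorial : ℝ)) :=
    Real.sqrt_pos.2 (by positivity)
  exact Complex.ofReal_ne_zero.2 (by positivity)

theorem mem_harmSpan_of_eq_midSum {l : ℕ} (i : Fin (2 * l + 1)) {F : C(S2, ℂ)} {κ : ℂ}
    (h : ∀ β α : ℝ, F (sphPoint β α) =
      κ * (Complex.exp (-Complex.I * (order l i : ℂ) * (α : ℂ)) * (midSum l i β : ℂ))) :
    F ∈ harmSpan := by
  have hne := sphY_const_ne_zero l (i : ℕ)
  rw [← Submodule.smul_mem_iff _ hne]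
  have h' : ((normConst l 0 * (Real.sqrt ((i : ℕ).factorial *
      (2 * l - (i : ℕ)).factorial) * l.factorial) : ℝ) : ℂ) • F = κ • sphYC l i := by
    ext u
    have h1 := h (colat u) (lon u)
    have h2 := sphY_eq_midSum l (colat u) (lon u) i
    rw [sphPoint_colat_lon] at h1 h2
    rw [ContinuousMap.smul_apply, ContinuousMap.smul_apply, smul_eq_mul, smul_eq_mul, h1]
    change _ = κ * sphY l u i
    rw [h2]
    ring
  rw [h']
  exact Submodule.smul_mem _ _ (Submodule.subset_span ⟨⟨l, i⟩, rfl⟩)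

theorem sphPoint_z (β α : ℝ) : (sphPoint β α).1 2 = Real.cos β := by simp [sphPoint]

theorem zeta_pow_mul_rodrigues_mem (l m : ℕ) (hm : m ≤ l) :
    zetaC ^ m * Polynomial.aeval zC (rodrigues l (l + m)) ∈ harmSpan := by
  refine mem_harmSpan_of_eq_midSum (l := l) ⟨l + m, by omega⟩
    (κ := (((-1) ^ m * 2 ^ l * ((l + m).factorial : ℝ) * (l.factorial : ℝ) ^ 2 : ℝ) : ℂ)) ?_
  intro β α
  have ho : order l ⟨l + m, by omega⟩ = m := by simp [order]
  rw [ContinuousMap.mul_apply, ContinuousMap.pow_apply, zetaC_sphPoint, aeval_zC_apply, ho,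
    sphPoint_z, mul_pow, ← Complex.exp_nat_mul]
  have h := congrArg (fun x : ℝ => (x : ℂ)) (pow_mul_eval_rodrigues l m hm β)
  simp only [Complex.ofReal_mul _ (midSum _ _ _), Complex.ofReal_mul (_ ^ _) (Polynomial.eval _ _),
    Complex.ofReal_pow (Real.sin _)] at h
  rw [show (m : ℂ) * (-Complex.I * (α : ℂ)) = -Complex.I * ((m : ℤ) : ℂ) * (α : ℂ) by
    push_cast; ring]
  linear_combination Complex.exp (-Complex.I * ((m : ℤ) : ℂ) * (α : ℂ)) * h

theorem star_zeta_pow_mul_rodrigues_mem (l m : ℕ) (hm : m ≤ l) :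
    (star zetaC) ^ m * Polynomial.aeval zC (rodrigues l (l + m)) ∈ harmSpan := by
  refine mem_harmSpan_of_eq_midSum (l := l) ⟨l - m, by omega⟩
    (κ := ((2 ^ l * ((l + m).factorial : ℝ) * (l.factorial : ℝ) ^ 2 : ℝ) : ℂ)) ?_
  intro β α
  have ho : order l ⟨l - m, by omega⟩ = -(m : ℤ) := by simp [order, hm]
  have hs : star (Complex.exp (-Complex.I * (α : ℂ))) = Complex.exp (Complex.I * (α : ℂ)) := by
    rw [Complex.star_def, ← Complex.exp_conj]
    simp
  have h := pow_mul_eval_rodrigues l m hm β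
  rw [show (-1 : ℝ) ^ m * 2 ^ l * ((l + m).factorial : ℝ) * (l.factorial : ℝ) ^ 2 *
    midSum l (l + m) β = 2 ^ l * ((l + m).factorial : ℝ) * (l.factorial : ℝ) ^ 2 *
      ((-1) ^ m * midSum l (l + m) β) by ring, ← midSum_sub l m hm] at h
  rw [ContinuousMap.mul_apply, ContinuousMap.pow_apply, ContinuousMap.star_apply, zetaC_sphPoint,
    star_mul', hs, aeval_zC_apply, ho, sphPoint_z, mul_pow, ← Complex.exp_nat_mul,
    Complex.star_def, Complex.conj_ofReal]
  have h := congrArg (fun x : ℝ => (x : ℂ)) h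
  simp only [Complex.ofReal_mul _ (midSum _ _ _), Complex.ofReal_mul (_ ^ _) (Polynomial.eval _ _),
    Complex.ofReal_pow (Real.sin _)] at h
  rw [show (m : ℂ) * (Complex.I * (α : ℂ)) = -Complex.I * ((-(m : ℤ) : ℤ) : ℂ) * (α : ℂ) by
    push_cast; ring]
  linear_combination Complex.exp (-Complex.I * ((-(m : ℤ) : ℤ) : ℂ) * (α : ℂ)) * h

theorem degree_rodrigues (n m : ℕ) : (rodrigues (n + m) (n + m + m)).degree = n := by
  have hmon : (Polynomial.X ^ 2 - 1 : Polynomial ℝ).Monic := by monicity!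
  have hdeg : ((Polynomial.X ^ 2 - 1 : Polynomial ℝ) ^ (n + m)).natDegree = 2 * (n + m) := by
    rw [hmon.natDegree_pow, show (Polynomial.X ^ 2 - 1 : Polynomial ℝ).natDegree = 2 by
      compute_degree!]
    ring
  refine Polynomial.degree_eq_of_le_of_coeff_ne_zero ?_ ?_
  · rw [rodrigues]
    refine Polynomial.degree_le_of_natDegree_le
      ((Polynomial.natDegree_iterate_derivative _ _).trans ?_)
    rw [hdeg]
    omega
  · rw [rodrigues, Polynomial.coeff_iterate_derivative, show n + (n + m + m) = 2 * (n + m) by ring,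
      ← hdeg, (hmon.pow _).coeff_natDegree, hdeg, nsmul_eq_mul, mul_one, Nat.cast_ne_zero]
    exact Nat.descFactorial_eq_zero_iff_lt.not.2 (by omega)

/-- For fixed `m`, the polynomials of Rodrigues' formula have degrees `0, 1, 2, …`. -/
def rodriguesSeq (m : ℕ) : Polynomial.Sequence ℝ where
  elems' n := rodrigues (n + m) (n + m + m)
  degree_eq' n := degree_rodrigues n m

/-- The polynomials of Rodrigues' formula, for fixed `m`, span all polynomials in `z`. -/
theorem mul_aeval_mem_harmSpan {w : C(S2, ℂ)} (m : ℕ)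
    (hw : ∀ n, w * Polynomial.aeval zC (rodrigues (n + m) (n + m + m)) ∈ harmSpan)
    (p : Polynomial ℝ) : w * Polynomial.aeval zC p ∈ harmSpan := by
  have hp : p ∈ Submodule.span ℝ (Set.range (rodriguesSeq m)) := by
    rw [(rodriguesSeq m).span fun n => ?_]
    · trivial
    · exact isUnit_iff_ne_zero.2 (Polynomial.leadingCoeff_ne_zero.2 ((rodriguesSeq m).ne_zero n))
  induction hp using Submodule.span_induction with
  | mem q hq =>
    obtain ⟨n, rfl⟩ := hq
    exact hw n
  | zero => simp
  | add p q _ _ hp hq =>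
    rw [map_add, mul_add]
    exact add_mem hp hq
  | smul a p _ hp =>
    have : w * Polynomial.aeval zC (a • p) = (a : ℂ) • (w * Polynomial.aeval zC p) := by
      rw [map_smul, mul_smul_comm]
      ext u
      simp
    rw [this]
    exact Submodule.smul_mem _ _ hp

theorem zeta_pow_mul_aeval_mem (m : ℕ) (p : Polynomial ℝ) :
    zetaC ^ m * Polynomial.aeval zC p ∈ harmSpan :=
  mul_aeval_mem_harmSpan m (fun n => zeta_pow_mul_rodrigues_mem (n + m) m (by omega)) p

theorem star_zeta_pow_mul_aeval_mem (m : ℕ) (p : Polynomial ℝ) :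
    (star zetaC) ^ m * Polynomial.aeval zC p ∈ harmSpan :=
  mul_aeval_mem_harmSpan m (fun n => star_zeta_pow_mul_rodrigues_mem (n + m) m (by omega)) p

theorem zeta_mul_star_zeta :
    zetaC * star zetaC = Polynomial.aeval zC (1 - Polynomial.X ^ 2 : Polynomial ℝ) := by
  ext u
  have h := sq_sum_eq_one u
  rw [aeval_zC_apply]
  simp only [ContinuousMap.mul_apply, ContinuousMap.star_apply, zetaC, ContinuousMap.coe_mk]
  have h' : (u.1 0 : ℂ) ^ 2 + (u.1 1 : ℂ) ^ 2 + (u.1 2 : ℂ) ^ 2 = 1 := by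
    have := congrArg Complex.ofReal h
    push_cast at this
    exact this
  simp only [Polynomial.eval_sub, Polynomial.eval_one, Polynomial.eval_pow, Polynomial.eval_X,
    star_sub, star_mul', Complex.star_def, Complex.conj_ofReal, Complex.conj_I]
  push_cast
  linear_combination h' - (u.1 1 : ℂ) ^ 2 * Complex.I_sq

/-- The monomials `(x ∓ i y)^m p(z)`. -/
def monoSet : Set C(S2, ℂ) :=
  {F | ∃ (m : ℕ) (p : Polynomial ℝ), F = zetaC ^ m * Polynomial.aeval zC p ∨
    F = (star zetaC) ^ m * Polynomial.aeval zC p}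

theorem zeta_mul_monoSet {F : C(S2, ℂ)} (hF : F ∈ monoSet) : zetaC * F ∈ monoSet := by
  obtain ⟨m, p, rfl | rfl⟩ := hF
  · exact ⟨m + 1, p, Or.inl (by ring)⟩
  · rcases m with _ | m
    · exact ⟨1, p, Or.inl (by ring)⟩
    · refine ⟨m, (1 - Polynomial.X ^ 2) * p, Or.inr ?_⟩
      rw [map_mul, ← zeta_mul_star_zeta]
      ring

theorem star_zeta_mul_monoSet {F : C(S2, ℂ)} (hF : F ∈ monoSet) : star zetaC * F ∈ monoSet := by
  obtain ⟨m, p, rfl | rfl⟩ := hF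
  · rcases m with _ | m
    · exact ⟨1, p, Or.inr (by ring)⟩
    · refine ⟨m, (1 - Polynomial.X ^ 2) * p, Or.inl ?_⟩
      rw [map_mul, ← zeta_mul_star_zeta]
      ring
  · exact ⟨m + 1, p, Or.inr (by ring)⟩

theorem z_mul_monoSet {F : C(S2, ℂ)} (hF : F ∈ monoSet) : zC * F ∈ monoSet := by
  obtain ⟨m, p, rfl | rfl⟩ := hF
  · refine ⟨m, Polynomial.X * p, Or.inl ?_⟩
    rw [map_mul, Polynomial.aeval_X]
    ring
  · refine ⟨m, Polynomial.X * p, Or.inr ?_⟩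
    rw [map_mul, Polynomial.aeval_X]
    ring

theorem star_zC : star zC = zC := by
  ext u
  simp [zC]

/-- The algebra of polynomial functions on the sphere. -/
def polyAlg : StarSubalgebra ℂ C(S2, ℂ) := StarAlgebra.adjoin ℂ {zetaC, zC}

theorem mul_mem_span_of_forall {w : C(S2, ℂ)} {s : Set C(S2, ℂ)} (h : ∀ F ∈ s, w * F ∈ s)
    {F : C(S2, ℂ)} (hF : F ∈ Submodule.span ℂ s) : w * F ∈ Submodule.span ℂ s := by
  induction hF using Submodule.span_induction with
  | mem q hq => exact Submodule.subset_span (h q hq)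
  | zero => simp
  | add p q _ _ hp hq =>
    rw [mul_add]
    exact add_mem hp hq
  | smul a p _ hp =>
    rw [mul_smul_comm]
    exact Submodule.smul_mem _ _ hp

/-- The span of the monomials `(x ∓ i y)^m p(z)` is stable under multiplication by polynomial
functions, because `(x - i y) (x + i y) = 1 - z²`. -/
theorem polyAlg_mul_span {w : C(S2, ℂ)} (hw : w ∈ polyAlg) :
    ∀ F ∈ Submodule.span ℂ monoSet, w * F ∈ Submodule.span ℂ monoSet := by
  have hw' : w ∈ Algebra.adjoin ℂ ({zetaC, zC} ∪ star {zetaC, zC}) := by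
    rw [← StarAlgebra.adjoin_toSubalgebra]
    exact hw
  clear hw
  induction hw' using Algebra.adjoin_induction with
  | mem x hx =>
    intro F hF
    rcases hx with hx | hx
    · rcases hx with rfl | rfl
      · exact mul_mem_span_of_forall (fun _ => zeta_mul_monoSet) hF
      · exact mul_mem_span_of_forall (fun _ => z_mul_monoSet) hF
    · have hx' : x = star zetaC ∨ x = zC := by
        rcases hx with hx | hx
        · exact Or.inl (by rw [← hx, star_star])
        · exact Or.inr (by rw [← star_star x, Set.mem_singleton_iff.1 hx, star_zC])
      rcases hx' with rfl | rfl
      · exact mul_mem_span_of_forall (fun _ => star_zeta_mul_monoSet) hF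
      · exact mul_mem_span_of_forall (fun _ => z_mul_monoSet) hF
  | algebraMap r =>
    intro F hF
    rw [← Algebra.smul_def]
    exact Submodule.smul_mem _ _ hF
  | add x y _ _ hx hy =>
    intro F hF
    rw [add_mul]
    exact add_mem (hx F hF) (hy F hF)
  | mul x y _ _ hx hy =>
    intro F hF
    rw [mul_assoc]
    exact hx _ (hy F hF)

theorem polyAlg_le_harmSpan {w : C(S2, ℂ)} (hw : w ∈ polyAlg) : w ∈ harmSpan := by
  have h1 : (1 : C(S2, ℂ)) ∈ Submodule.span ℂ monoSet :=
    Submodule.subset_span ⟨0, 1, Or.inl (by simp)⟩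
  have h2 := polyAlg_mul_span hw 1 h1
  rw [mul_one] at h2
  refine Submodule.span_le.2 ?_ h2
  rintro F ⟨m, p, rfl | rfl⟩
  · exact zeta_pow_mul_aeval_mem m p
  · exact star_zeta_pow_mul_aeval_mem m p

theorem polyAlg_separatesPoints : polyAlg.SeparatesPoints := by
  intro u v huv
  by_contra! h
  have hz : zetaC u = zetaC v :=
    h zetaC ⟨zetaC, StarAlgebra.subset_adjoin ℂ _ (by simp), rfl⟩
  have hz2 : zC u = zC v := h zC ⟨zC, StarAlgebra.subset_adjoin ℂ _ (by simp), rfl⟩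
  refine huv (sphere_ext fun i => ?_)
  have hre := congrArg Complex.re hz
  have him := congrArg Complex.im hz
  have h2 := congrArg Complex.re hz2
  simp [zetaC, zC] at hre him h2
  fin_cases i
  · exact hre
  · exact him
  · exact h2

/-- Stone–Weierstrass: the span of the spherical harmonics contains all polynomial functions. -/
theorem dense_harmSpan : Dense (harmSpan : Set C(S2, ℂ)) := by
  have h := ContinuousMap.starSubalgebra_topologicalClosure_eq_top_of_separatesPoints polyAlg
    polyAlg_separatesPoints
  intro F
  have hF : F ∈ polyAlg.topologicalClosure := by rw [h]; trivial
  exact closure_mono (fun w hw => polyAlg_le_harmSpan hw) hF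

/-- A continuous linear functional on `C(S²)` is determined by the spherical harmonics. -/
theorem functional_ext {φ ψ : C(S2, ℂ) →L[ℂ] ℂ} (h : ∀ l i, φ (sphYC l i) = ψ (sphYC l i)) :
    φ = ψ := by
  refine ContinuousLinearMap.ext_on dense_harmSpan ?_
  rintro _ ⟨p, rfl⟩
  exact h p.1 p.2

/-- The functional `g ↦ ∫ k g` of an integrable function. -/
def pairing (P : Measure S2) (k : S2 → ℂ) (hk : Integrable k P) : C(S2, ℂ) →L[ℂ] ℂ :=
  LinearMap.mkContinuous
    { toFun := fun g => ∫ u, k u * g u ∂P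
      map_add' := fun g g' => by
        simp only [ContinuousMap.add_apply, mul_add]
        exact integral_add (hk.mul_bdd (c := ‖g‖) g.continuous.aestronglyMeasurable
          (Filter.Eventually.of_forall g.norm_coe_le_norm)) (hk.mul_bdd (c := ‖g'‖)
            g'.continuous.aestronglyMeasurable (Filter.Eventually.of_forall g'.norm_coe_le_norm))
      map_smul' := fun c g => by
        simp only [ContinuousMap.smul_apply, smul_eq_mul, RingHom.id_apply]
        rw [← integral_const_mul]
        congr 1
        funext u
        ring }
    (∫ u, ‖k u‖ ∂P) fun g => by
      simp only [LinearMap.coe_mk, AddHom.coe_mk]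
      rw [← integral_mul_const]
      refine norm_integral_le_of_norm_le (hk.norm.mul_const _)
        (Filter.Eventually.of_forall fun u => ?_)
      rw [norm_mul]
      gcongr
      exact g.norm_coe_le_norm u

theorem pairing_apply (P : Measure S2) (k : S2 → ℂ) (hk : Integrable k P) (g : C(S2, ℂ)) :
    pairing P k hk g = ∫ u, k u * g u ∂P := rfl

/-- A finite measure on the sphere is determined by the integrals of the spherical harmonics. -/
theorem measure_ext_sphY {P Q : Measure S2} [IsFiniteMeasure P] [IsFiniteMeasure Q]
    (h : ∀ l i, ∫ u, sphY l u i ∂P = ∫ u, sphY l u i ∂Q) : P = Q := by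
  have hφ : pairing P (fun _ => 1) (integrable_const 1) =
      pairing Q (fun _ => 1) (integrable_const 1) := by
    refine functional_ext fun l i => ?_
    simp only [pairing_apply, one_mul]
    exact h l i
  refine ext_of_forall_integral_eq_of_IsFiniteMeasure fun f => ?_
  have h1 := DFunLike.congr_fun hφ ⟨fun u => (f u : ℂ), by fun_prop⟩
  simp only [pairing_apply, one_mul, ContinuousMap.coe_mk] at h1
  rw [integral_complex_ofReal, integral_complex_ofReal] at h1
  exact_mod_cast h1

/-- **Completeness of the spherical harmonics** in `L¹`. -/
theorem ae_eq_zero_of_sphY {f : S2 → ℂ} (hf : Integrable f sphMeasure)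
    (h : ∀ l i, ∫ u, f u * star (sphY l u i) ∂sphMeasure = 0) : f =ᵐ[sphMeasure] 0 := by
  have hk : Integrable (fun u => star (f u)) sphMeasure :=
    (Complex.conjCLE : ℂ →L[ℝ] ℂ).integrable_comp hf
  have hφ : pairing sphMeasure (fun u => star (f u)) hk = 0 := by
    refine functional_ext fun l i => ?_
    have h0 := integral_conj (μ := sphMeasure) (f := fun u => f u * star (sphY l u i))
    rw [h l i, map_zero] at h0
    rw [pairing_apply, _root_.zero_apply, ← h0]
    congr 1
    funext u
    simp [sphYC]
  -- `f` annihilates all continuous functions, in particular the smooth ones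
  refine ae_eq_zero_of_integral_contMDiff_smul_eq_zero
    (modelWithCornersSelf ℝ (EuclideanSpace ℝ (Fin 2))) hf.locallyIntegrable fun g hg _ => ?_
  have h1 := DFunLike.congr_fun hφ ⟨fun u => (g u : ℂ), by have := hg.continuous; fun_prop⟩
  simp only [pairing_apply, ContinuousMap.coe_mk, _root_.zero_apply] at h1
  have h0 := integral_conj (μ := sphMeasure) (f := fun u => star (f u) * (g u : ℂ))
  rw [h1, map_zero] at h0
  rw [← h0]
  congr 1
  funext u
  simp [mul_comm]

/-- An integrable function on the sphere is determined by its coefficients. -/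
theorem ae_eq_of_sphCoeff {f g : S2 → ℂ} (hf : Integrable f sphMeasure)
    (hg : Integrable g sphMeasure) (h : ∀ l, sphCoeff f l = sphCoeff g l) :
    f =ᵐ[sphMeasure] g := by
  have h0 : f - g =ᵐ[sphMeasure] 0 := by
    refine ae_eq_zero_of_sphY (hf.sub hg) fun l i => ?_
    have hb (k : S2 → ℂ) (hk : Integrable k sphMeasure) :
        Integrable (fun u => k u * star (sphY l u i)) sphMeasure :=
      hk.mul_bdd (c := ‖sphYC l i‖) ((continuous_sphY l i).star.aestronglyMeasurable)
        (Filter.Eventually.of_forall fun u => by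
          rw [norm_star]; exact (sphYC l i).norm_coe_le_norm u)
    have hl := congrFun (h l) i
    rw [sphCoeff_eq, sphCoeff_eq] at hl
    simp only [Pi.sub_apply, sub_mul]
    rw [integral_sub (hb f hf) (hb g hg), hl, sub_self]
  filter_upwards [h0] with u hu
  exact sub_eq_zero.1 hu

/-! ### Rotation invariance of the two measures -/

theorem wignerD_zero (R : SO3) (i j : Fin (2 * 0 + 1)) : wignerD 0 R i j = 1 := by
  obtain ⟨q, hq, h⟩ := exists_quat R
  rw [wignerD_eq_spinRep 0 hq h]
  have hi : (i : ℕ) = 0 := by omega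
  have hj : (j : ℕ) = 0 := by omega
  have hs : splitRange 0 0 0 = {0} := by
    ext s
    rw [mem_splitRange, Finset.mem_singleton]
    omega
  have hij : i = 0 ∧ j = 0 := ⟨Fin.ext hi, Fin.ext hj⟩
  rw [hij.1, hij.2]
  simp [spinRep, symCoeff, spinWeight, hs]

theorem integrable_sphY (l : ℕ) (i : Fin (2 * l + 1)) :
    Integrable (fun u => sphY l u i) sphMeasure :=
  (continuous_sphY l i).integrable_of_hasCompactSupport (HasCompactSupport.of_compactSpace _)

/-- The surface measure is rotation invariant: a rotation maps the spherical harmonics of degree `ℓ`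
into their span, and for `ℓ > 0` they all have mean zero. -/
theorem map_smul_sphMeasure (R : SO3) : sphMeasure.map (fun u => R • u) = sphMeasure := by
  have hc : Continuous fun u : S2 => R • u := continuous_const_smul R
  have : IsFiniteMeasure (sphMeasure.map fun u => R • u) :=
    Measure.isFiniteMeasure_map _ _
  refine measure_ext_sphY fun l i => ?_
  rw [integral_map hc.measurable.aemeasurable (continuous_sphY l i).aestronglyMeasurable]
  simp only [sphY_smul]
  rw [integral_finsetSum]
  · simp only [integral_const_mul]
    by_cases hl : l = 0
    · subst hl
      simp only [wignerD_zero, one_mul]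
      rw [Finset.sum_eq_single i]
      · intro j _ hj
        exact absurd (Fin.ext (by omega)) hj
      · exact fun h => absurd (Finset.mem_univ _) h
    · rw [integral_sphY hl]
      simp [integral_sphY hl]
  · intro k _
    exact (integrable_sphY l k).const_mul _

theorem lintegral_circ_add {g : ℝ → ENNReal} (hg : Function.Periodic g (2 * π)) (t : ℝ) :
    ∫⁻ γ, g (t + γ) ∂circMeasure = ∫⁻ γ, g γ ∂circMeasure := by
  have hpos : Fact (0 < 2 * π) := ⟨by positivity⟩
  have h0 := AddCircle.lintegral_preimage (2 * π) 0 hg.lift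
  have ht := AddCircle.lintegral_preimage (2 * π) t hg.lift
  simp only [Function.Periodic.lift_coe, zero_add] at h0 ht
  rw [circMeasure, restrict_Ioc_eq_restrict_Icc.symm, h0, ← ht]
  have hmp : MeasurePreserving (fun γ : ℝ => t + γ) volume volume := measurePreserving_add_left _ t
  have hemb : MeasurableEmbedding fun γ : ℝ => t + γ := measurableEmbedding_addLeft t
  rw [← (hmp.restrict_preimage_emb hemb (Set.Ioc t (t + 2 * π))).lintegral_comp_emb hemb]
  simp

theorem rotZ_periodic : Function.Periodic rotZ (2 * π) := by
  intro t
  refine Subtype.ext ?_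
  simp [rotZ]

theorem continuous_rotZ : Continuous rotZ := by
  refine Continuous.subtype_mk (continuous_matrix fun i j => ?_) _
  fin_cases i <;> fin_cases j <;> simp <;> fun_prop

theorem continuous_rotY : Continuous rotY := by
  refine Continuous.subtype_mk (continuous_matrix fun i j => ?_) _
  fin_cases i <;> fin_cases j <;> simp <;> fun_prop

theorem continuous_euler : Continuous fun p : ℝ × ℝ × ℝ => euler p.1 p.2.1 p.2.2 :=
  ((continuous_rotZ.comp continuous_fst).mul
    (continuous_rotY.comp (continuous_fst.comp continuous_snd))).mul
      (continuous_rotZ.comp (continuous_snd.comp continuous_snd))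

theorem rotZ_zero : rotZ 0 = 1 := by
  refine Subtype.ext ?_
  ext i j
  fin_cases i <;> fin_cases j <;> simp [rotZ]

theorem euler_eq_mul_rotZ (α β γ : ℝ) : euler α β γ = euler α β 0 * rotZ γ := by
  simp [euler, rotZ_zero]

/-- The integral over the fibre of `R ↦ R n` above `u`. -/
def fiberIntegral (g : SO3 → ENNReal) (u : S2) : ENNReal :=
  ∫⁻ γ, g (euler (lon u) (colat u) γ) ∂circMeasure

theorem fiberIntegral_eq (g : SO3 → ENNReal) (u : S2) : fiberIntegral g u =
    ∫⁻ γ, g (euler (lon u) (colat u) 0 * rotZ γ) ∂circMeasure :=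
  lintegral_congr fun γ => congrArg g (euler_eq_mul_rotZ _ _ γ)

/-- The fibre integral may be computed from any rotation in the fibre. -/
theorem lintegral_mul_rotZ (g : SO3 → ENNReal) (V : SO3) :
    ∫⁻ γ, g (V * rotZ γ) ∂circMeasure = fiberIntegral g (V • north) := by
  obtain ⟨t, ht⟩ := exists_mul_rotZ (euler_lon_colat_smul_north (V • north) 0).symm
  rw [fiberIntegral_eq, ht]
  simp only [mul_assoc, ← rotZ_add]
  exact (lintegral_circ_add (g := fun γ => g (V * rotZ γ))
    (fun γ => by simp only [rotZ_periodic γ]) t).symm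

theorem lintegral_euler (g : SO3 → ENNReal) (α β : ℝ) :
    ∫⁻ γ, g (euler α β γ) ∂circMeasure = fiberIntegral g (sphPoint β α) := by
  rw [← euler_smul_north α β 0, ← lintegral_mul_rotZ]
  exact lintegral_congr fun γ => congrArg g (euler_eq_mul_rotZ _ _ γ)

theorem measurable_lon : Measurable lon := by
  have (i : Fin 3) : Measurable fun u : S2 => u.1 i :=
    ((PiLp.continuous_apply 2 _ i).comp continuous_subtype_val).measurable
  exact Complex.measurable_arg.comp (Complex.measurableEquivRealProd.symm.measurable.comp
    ((this 0).prodMk (this 1)))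

theorem measurable_fiberIntegral {g : SO3 → ENNReal} (hg : Measurable g) :
    Measurable (fiberIntegral g) := by
  have h1 : Measurable fun p : S2 × ℝ => ((lon p.1, colat p.1, p.2) : ℝ × ℝ × ℝ) :=
    (measurable_lon.comp measurable_fst).prodMk
      ((continuous_colat.measurable.comp measurable_fst).prodMk measurable_snd)
  have h0 : Measurable fun p : ℝ × ℝ × ℝ => g (euler p.1 p.2.1 p.2.2) :=
    hg.comp continuous_euler.measurable
  have h3 := (h0.comp h1).lintegral_prod_right' (ν := circMeasure)
  exact h3

/-- Disintegration of `dR` over the sphere, along `R ↦ R n`. -/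
theorem lintegral_rotMeasure {g : SO3 → ENNReal} (hg : Measurable g) :
    ∫⁻ R, g R ∂rotMeasure =
      ENNReal.ofReal ((8 * π ^ 2)⁻¹) * ∫⁻ u, fiberIntegral g u ∂sphMeasure := by
  have h1 : Measurable fun p : ℝ × ℝ × ℝ => g (euler p.1 p.2.1 p.2.2) :=
    hg.comp continuous_euler.measurable
  have h2 : Measurable fun p : ℝ × ℝ => fiberIntegral g (sphPoint p.1 p.2) :=
    (measurable_fiberIntegral hg).comp continuous_sphPoint.measurable
  rw [rotMeasure, lintegral_smul_measure, lintegral_map hg continuous_euler.measurable,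
    sphMeasure, lintegral_map (measurable_fiberIntegral hg) continuous_sphPoint.measurable,
    lintegral_prod _ h1.aemeasurable, lintegral_prod_symm _ h2.aemeasurable, smul_eq_mul]
  congr 1
  refine lintegral_congr fun α => ?_
  have h3 : Measurable fun p : ℝ × ℝ => g (euler α p.1 p.2) := by
    have h := h1.comp (measurable_prodMk_left (x := α))
    simp only [Function.comp_def] at h
    exact h
  simp only
  rw [lintegral_prod _ h3.aemeasurable]
  simp only [lintegral_euler]

/-- Left invariance of `dR` follows from the invariance of the surface measure, because a left
translation maps fibres to fibres and the fibre measure is invariant under `rotZ`. -/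
theorem map_mul_left_rotMeasure (S : SO3) : rotMeasure.map (fun R => S * R) = rotMeasure := by
  refine Measure.ext_of_lintegral _ fun g hg => ?_
  have hm : Measurable fun R : SO3 => S * R := (continuous_const_mul S).measurable
  have hgm : Measurable fun R : SO3 => g (S * R) := hg.comp hm
  rw [lintegral_map hg hm, lintegral_rotMeasure hg, lintegral_rotMeasure hgm]
  have h (u : S2) : fiberIntegral (fun R => g (S * R)) u = fiberIntegral g (S • u) := by
    rw [fiberIntegral_eq]
    simp only [← mul_assoc]
    rw [lintegral_mul_rotZ, mul_smul, euler_lon_colat_smul_north]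
  simp only [h]
  rw [← lintegral_map (measurable_fiberIntegral hg) (continuous_const_smul S).measurable,
    map_smul_sphMeasure]

instance : rotMeasure.IsMulLeftInvariant := ⟨map_mul_left_rotMeasure⟩

instance : SMulInvariantMeasure SO3 S2 sphMeasure :=
  ⟨fun R s hs => by
    rw [← Measure.map_apply (continuous_const_smul R).measurable hs, map_smul_sphMeasure]⟩

/-- The image of `dR` under `R ↦ R n` is the normalized surface measure. -/
theorem map_smul_north_rotMeasure :
    rotMeasure.map (fun R => R • north) = ENNReal.ofReal ((4 * π)⁻¹) • sphMeasure := by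
  refine Measure.ext_of_lintegral _ fun g hg => ?_
  have hm : Measurable fun R : SO3 => R • north := continuous_smul_north.measurable
  have hgm : Measurable fun R : SO3 => g (R • north) := hg.comp hm
  rw [lintegral_map hg hm, lintegral_rotMeasure hgm, lintegral_smul_measure]
  have h (u : S2) : fiberIntegral ((fun R => g (R • north))) u =
      ENNReal.ofReal (2 * π) * g u := by
    simp only [fiberIntegral, euler_lon_colat_smul_north, lintegral_const, circMeasure_univ]
    rw [mul_comm]
  simp only [h]
  rw [lintegral_const_mul _ hg, ← mul_assoc, ← ENNReal.ofReal_mul (by positivity), smul_eq_mul]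
  congr 2
  field_simp
  norm_num

instance : IsProbabilityMeasure rotMeasure := by
  refine ⟨?_⟩
  rw [rotMeasure, Measure.smul_apply,
    Measure.map_apply continuous_euler.measurable MeasurableSet.univ, Set.preimage_univ,
    ← Set.univ_prod_univ, Measure.prod_prod, ← Set.univ_prod_univ, Measure.prod_prod,
    circMeasure_univ, colatMeasure_univ, smul_eq_mul, ← ENNReal.ofReal_mul (by positivity),
    ← ENNReal.ofReal_mul (by positivity), ← ENNReal.ofReal_mul (by positivity)]
  rw [← ENNReal.ofReal_one]
  congr 1
  field_simp
  norm_num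

theorem integral_smul_north {f : S2 → ℂ} (hf : AEStronglyMeasurable f sphMeasure) :
    ∫ R : SO3, f (R • north) ∂rotMeasure = ((4 * π : ℝ) : ℂ)⁻¹ * ∫ u, f u ∂sphMeasure := by
  rw [← integral_map continuous_smul_north.measurable.aemeasurable, map_smul_north_rotMeasure,
    integral_smul_measure, ENNReal.toReal_ofReal (by positivity), Complex.real_smul]
  · push_cast
    rfl
  · rw [map_smul_north_rotMeasure]
    exact hf.mono_ac Measure.smul_absolutelyContinuous

theorem integrable_smul_north {f : S2 → ℂ} (hf : Integrable f sphMeasure) :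
    Integrable (fun R : SO3 => f (R • north)) rotMeasure := by
  have h : Integrable f (rotMeasure.map fun R => R • north) := by
    rw [map_smul_north_rotMeasure]
    exact hf.smul_measure ENNReal.ofReal_ne_top
  exact h.comp_measurable continuous_smul_north.measurable

theorem ae_smul_north {p : S2 → Prop} (h : ∀ᵐ u ∂sphMeasure, p u) :
    ∀ᵐ R : SO3 ∂rotMeasure, p (R • north) := by
  refine ae_of_ae_map continuous_smul_north.measurable.aemeasurable ?_
  rw [map_smul_north_rotMeasure]
  exact Measure.smul_absolutelyContinuous.ae_le h

/-! ### Schur orthogonality -/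

theorem integrable_wignerD_mul_star (l l' : ℕ) (i j : Fin (2 * l + 1)) (k j' : Fin (2 * l' + 1)) :
    Integrable (fun R => wignerD l R i j * star (wignerD l' R k j')) rotMeasure :=
  ((continuous_wignerD_apply l i j).mul
    (continuous_wignerD_apply l' k j').star).integrable_of_hasCompactSupport
      (HasCompactSupport.of_compactSpace _)

/-- The average of `D_ℓ(R) E D_ℓ'(R)†` over the rotation group, where `E` is the matrix unit at
`(j, j')`; it intertwines the two representations. -/
def schurMatrix (l l' : ℕ) (j : Fin (2 * l + 1)) (j' : Fin (2 * l' + 1)) :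
    Matrix (Fin (2 * l + 1)) (Fin (2 * l' + 1)) ℂ :=
  Matrix.of fun i k => ∫ R, wignerD l R i j * star (wignerD l' R k j') ∂rotMeasure

/-- Left invariance of `dR`. -/
theorem schurMatrix_eq (l l' : ℕ) (j : Fin (2 * l + 1)) (j' : Fin (2 * l' + 1)) (S : SO3) :
    schurMatrix l l' j j' = wignerD l S * schurMatrix l l' j j' * (wignerD l' S)ᴴ := by
  ext i k
  have h := integral_mul_left_eq_self (μ := rotMeasure)
    (fun R => wignerD l R i j * star (wignerD l' R k j')) S
  simp only [wignerD_mul, Matrix.mul_apply, star_sum, star_mul', Finset.sum_mul_sum] at h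
  rw [Matrix.mul_apply]
  simp only [Matrix.mul_apply, schurMatrix, Matrix.of_apply, Matrix.conjTranspose_apply]
  rw [← h, integral_finsetSum]
  · simp only [Finset.sum_mul]
    rw [Finset.sum_comm]
    refine Finset.sum_congr rfl fun a _ => ?_
    rw [integral_finsetSum]
    · refine Finset.sum_congr rfl fun b _ => ?_
      rw [← integral_const_mul, ← integral_mul_const]
      congr 1
      funext R
      ring
    · intro b _
      refine ((integrable_wignerD_mul_star l l' a j b j').const_mul
        (wignerD l S i a * star (wignerD l' S k b))).congr (Filter.Eventually.of_forall fun R => ?_)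
      simp only
      ring
  · intro a _
    refine integrable_finsetSum _ fun b _ => ?_
    refine ((integrable_wignerD_mul_star l l' a j b j').const_mul
      (wignerD l S i a * star (wignerD l' S k b))).congr (Filter.Eventually.of_forall fun R => ?_)
    simp only
    ring

theorem schurMatrix_comm (l l' : ℕ) (j : Fin (2 * l + 1)) (j' : Fin (2 * l' + 1)) (S : SO3) :
    wignerD l S * schurMatrix l l' j j' = schurMatrix l l' j j' * wignerD l' S := by
  conv_rhs => rw [schurMatrix_eq l l' j j' S]
  rw [Matrix.mul_assoc, wignerD_conjTranspose_mul, Matrix.mul_one]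

/-- An intertwiner preserves the weights of the rotations about the `z` axis. -/
theorem schurMatrix_eq_zero_of_order_ne (l l' : ℕ) (j : Fin (2 * l + 1)) (j' : Fin (2 * l' + 1))
    {i : Fin (2 * l + 1)} {k : Fin (2 * l' + 1)} (h : order l i ≠ order l' k) :
    schurMatrix l l' j j' i k = 0 := by
  have hd : ((order l i : ℂ) - (order l' k : ℂ)) ≠ 0 := by
    rw [← Int.cast_sub]
    exact_mod_cast sub_ne_zero.2 h
  have hd' : ((order l i : ℝ) - (order l' k : ℝ)) ≠ 0 := by
    rw [← Int.cast_sub]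
    exact_mod_cast sub_ne_zero.2 h
  -- at this angle the characters of the two weights have opposite signs
  set t : ℝ := π / ((order l i : ℝ) - (order l' k : ℝ))
  have hc := congrFun (congrFun (schurMatrix_comm l l' j j' (rotZ t)) i) k
  rw [wignerD_rotZ, wignerD_rotZ, Matrix.diagonal_mul, Matrix.mul_diagonal] at hc
  have he : Complex.exp (-Complex.I * (order l i : ℂ) * (t : ℂ)) =
      -Complex.exp (-Complex.I * (order l' k : ℂ) * (t : ℂ)) := by
    have : -Complex.I * (order l i : ℂ) * (t : ℂ) =
        -Complex.I * (order l' k : ℂ) * (t : ℂ) - π * Complex.I := by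
      simp only [t]
      push_cast
      field_simp
      ring
    rw [this, Complex.exp_sub_pi_mul_I]
  rw [he] at hc
  have h2 : (2 * Complex.exp (-Complex.I * (order l' k : ℂ) * (t : ℂ))) *
      schurMatrix l l' j j' i k = 0 := by linear_combination -hc
  exact (mul_eq_zero.1 h2).resolve_left (mul_ne_zero two_ne_zero (Complex.exp_ne_zero _))

/-- The column of highest order of `d_ℓ(π / 2)` has no zeros; together with the distinct weights
this makes the Wigner representations irreducible. -/
theorem littleD_last_ne_zero (l : ℕ) (i : Fin (2 * l + 1)) :
    littleD l (π / 2) i (Fin.last (2 * l)) ≠ 0 := by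
  have hi := Nat.lt_succ_iff.1 i.2
  have hc : Real.cos (π / 2 / 2) ≠ 0 := by
    rw [show π / 2 / 2 = π / 4 by ring, Real.cos_pi_div_four]; positivity
  have hs : Real.sin (π / 2 / 2) ≠ 0 := by
    rw [show π / 2 / 2 = π / 4 by ring, Real.sin_pi_div_four]; positivity
  have hset : (Finset.range (2 * l + 1)).filter (fun s => s ≤ ((Fin.last (2 * l) : Fin _) : ℕ) ∧
      ((Fin.last (2 * l) : Fin _) : ℕ) ≤ (i : ℕ) + s ∧ (i : ℕ) + s ≤ 2 * l) =
      {2 * l - (i : ℕ)} := by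
    ext s
    simp only [Finset.mem_filter, Finset.mem_range, Fin.val_last, Finset.mem_singleton]
    omega
  rw [littleD, hset, Finset.sum_singleton]
  refine mul_ne_zero (Real.sqrt_pos.2 ?_).ne' (div_ne_zero ?_ ?_)
  · have := Nat.factorial_pos
    positivity
  · exact mul_ne_zero (mul_ne_zero (pow_ne_zero _ (by norm_num)) (pow_ne_zero _ hc))
      (pow_ne_zero _ hs)
  · have := Nat.factorial_pos
    positivity

theorem wignerD_rotY_last_ne_zero (l : ℕ) (i : Fin (2 * l + 1)) :
    wignerD l (rotY (π / 2)) i (Fin.last (2 * l)) ≠ 0 := by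
  rw [wignerD_rotY]
  exact Complex.ofReal_ne_zero.2 (littleD_last_ne_zero l i)

theorem order_injective (l : ℕ) : Function.Injective (order l) := by
  intro i k h
  simp only [order] at h
  exact Fin.ext (by omega)

/-- A diagonal intertwiner is scalar: compare the columns of highest order of both sides of the
intertwining relation for the rotation by `π / 2` about the `y` axis. -/
theorem schurMatrix_self_diag (l : ℕ) (j j' : Fin (2 * l + 1)) (i : Fin (2 * l + 1)) :
    schurMatrix l l j j' i i = schurMatrix l l j j' (Fin.last _) (Fin.last _) := by
  have hc := congrFun (congrFun (schurMatrix_comm l l j j' (rotY (π / 2))) i) (Fin.last _)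
  rw [Matrix.mul_apply, Matrix.mul_apply, Finset.sum_eq_single (Fin.last _),
    Finset.sum_eq_single i, mul_comm] at hc
  · exact (mul_right_cancel₀ (wignerD_rotY_last_ne_zero l i) hc).symm
  · intro k _ hk
    rw [schurMatrix_eq_zero_of_order_ne _ _ _ _ ((order_injective l).ne hk.symm), zero_mul]
  · exact fun h => absurd (Finset.mem_univ _) h
  · intro k _ hk
    rw [schurMatrix_eq_zero_of_order_ne _ _ _ _ ((order_injective l).ne hk), mul_zero]
  · exact fun h => absurd (Finset.mem_univ _) h

/-- Schur orthogonality within one degree; the scalar is found from the trace. -/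
theorem integral_wignerD_mul_star_self (l : ℕ) (i j k j' : Fin (2 * l + 1)) :
    ∫ R, wignerD l R i j * star (wignerD l R k j') ∂rotMeasure =
      if i = k ∧ j = j' then ((2 * l + 1 : ℂ))⁻¹ else 0 := by
  change schurMatrix l l j j' i k = _
  by_cases hik : i = k
  · subst hik
    have htr : ∑ a, schurMatrix l l j j' a a = if j = j' then 1 else 0 := by
      simp only [schurMatrix, Matrix.of_apply]
      rw [← integral_finsetSum _ fun a _ => integrable_wignerD_mul_star l l a j a j']
      have h (R : SO3) : ∑ a, wignerD l R a j * star (wignerD l R a j') =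
          if j = j' then 1 else 0 := by
        have h1 := congrFun (congrFun (wignerD_conjTranspose_mul l R) j') j
        rw [Matrix.mul_apply, Matrix.one_apply] at h1
        simp only [eq_comm (a := j), ← h1]
        exact Finset.sum_congr rfl fun a _ => mul_comm _ _
      simp only [h, integral_const, probReal_univ, one_smul]
    simp only [schurMatrix_self_diag l j j', Finset.sum_const, Finset.card_univ,
      Fintype.card_fin, nsmul_eq_mul] at htr
    rw [schurMatrix_self_diag]
    have hne : (2 * l + 1 : ℂ) ≠ 0 := by exact_mod_cast Nat.succ_ne_zero (2 * l)
    push_cast at htr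
    simp only [true_and]
    split_ifs at htr ⊢ with hj
    · exact eq_inv_of_mul_eq_one_right htr
    · exact (mul_eq_zero.1 htr).resolve_left hne
  · rw [schurMatrix_eq_zero_of_order_ne _ _ _ _ ((order_injective l).ne hik)]
    simp [hik]

/-- For `ℓ < ℓ'`, the order `ℓ'` does not occur in degree `ℓ`, hence the column of order `ℓ'` of the
intertwiner vanishes; the relation at `rotY (π / 2)` spreads this to the other columns. -/
theorem integral_wignerD_mul_star_of_lt {l l' : ℕ} (h : l < l') (i j : Fin (2 * l + 1))
    (k j' : Fin (2 * l' + 1)) :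
    ∫ R, wignerD l R i j * star (wignerD l' R k j') ∂rotMeasure = 0 := by
  change schurMatrix l l' j j' i k = _
  by_cases hik : order l i = order l' k
  · have hc := congrFun (congrFun (schurMatrix_comm l l' j j' (rotY (π / 2))) i) (Fin.last _)
    rw [Matrix.mul_apply, Matrix.mul_apply, Finset.sum_eq_zero, Finset.sum_eq_single k] at hc
    · exact (mul_eq_zero.1 hc.symm).resolve_right (wignerD_rotY_last_ne_zero l' k)
    · intro b _ hb
      rw [schurMatrix_eq_zero_of_order_ne, zero_mul]
      rw [hik]
      exact (order_injective l').ne hb.symm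
    · exact fun h => absurd (Finset.mem_univ _) h
    · intro a _
      rw [schurMatrix_eq_zero_of_order_ne, mul_zero]
      have := a.2
      simp only [order, Fin.val_last]
      omega
  · exact schurMatrix_eq_zero_of_order_ne _ _ _ _ hik

theorem integral_wignerD_mul_star_of_ne {l l' : ℕ} (h : l ≠ l') (i j : Fin (2 * l + 1))
    (k j' : Fin (2 * l' + 1)) :
    ∫ R, wignerD l R i j * star (wignerD l' R k j') ∂rotMeasure = 0 := by
  rcases lt_or_gt_of_ne h with h | h
  · exact integral_wignerD_mul_star_of_lt h i j k j'
  · have h1 := integral_wignerD_mul_star_of_lt h k j' i j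
    have h2 := integral_conj (μ := rotMeasure)
      (f := fun R => wignerD l' R k j' * star (wignerD l R i j))
    rw [h1, map_zero] at h2
    rw [← h2]
    congr 1
    funext R
    simp [mul_comm]

/-! ### Convolution with a function on the rotation group -/

section Action

variable {X : Type*} [MeasurableSpace X] [MulAction SO3 X]

/-- The convolution `x ↦ ∫ a(R) b(R⁻¹ x) dR` of a function on the rotation group with a function on
a space on which the rotation group acts. -/
def actConv (a : SO3 → ℂ) (b : X → ℂ) (x : X) : ℂ := ∫ R, a R * b (R⁻¹ • x) ∂rotMeasure

variable [MeasurableSMul₂ SO3 X] {ν : Measure X} [SFinite ν] [SMulInvariantMeasure SO3 X ν]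
  {a : SO3 → ℂ} {b : X → ℂ}

variable (ν) in
theorem measurePreserving_inv_smul :
    MeasurePreserving (fun p : SO3 × X => (p.1, p.1⁻¹ • p.2)) (rotMeasure.prod ν)
      (rotMeasure.prod ν) := by
  refine (MeasurePreserving.id rotMeasure).skew_product (g := fun R x => R⁻¹ • x) ?_ ?_
  · exact measurable_fst.inv.smul measurable_snd
  · exact Filter.Eventually.of_forall fun R => (measurePreserving_smul R⁻¹ ν).map_eq

theorem integrable_prod_actConv (ha : Integrable a rotMeasure) (hb : Integrable b ν) :
    Integrable (fun p : SO3 × X => a p.1 * b (p.1⁻¹ • p.2)) (rotMeasure.prod ν) :=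
  (measurePreserving_inv_smul ν).integrable_comp_of_integrable (ha.mul_prod hb)

/-- Fubini's theorem; the shear `(R, x) ↦ (R, R⁻¹ x)` preserves the product measure. -/
theorem ae_integrable_actConv (ha : Integrable a rotMeasure) (hb : Integrable b ν) :
    ∀ᵐ x ∂ν, Integrable (fun R => a R * b (R⁻¹ • x)) rotMeasure :=
  (integrable_prod_actConv ha hb).prod_left_ae

theorem integrable_actConv (ha : Integrable a rotMeasure) (hb : Integrable b ν) :
    Integrable (actConv a b) ν :=
  (integrable_prod_actConv ha hb).integral_prod_right

/-- The Cauchy–Schwarz inequality for the finite measure with density `w`. -/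
theorem sq_integral_mul_le {α : Type*} [MeasurableSpace α] {μ : Measure α} {w f : α → ℝ}
    (hw0 : ∀ x, 0 ≤ w x) (hw : Integrable w μ) (hwf : Integrable (fun x => w x * f x) μ)
    (hwf2 : Integrable (fun x => w x * f x ^ 2) μ) :
    (∫ x, w x * f x ∂μ) ^ 2 ≤ (∫ x, w x ∂μ) * ∫ x, w x * f x ^ 2 ∂μ := by
  have h (t : ℝ) : 0 ≤ (∫ x, w x ∂μ) * (t * t) + (-2 * ∫ x, w x * f x ∂μ) * t +
      ∫ x, w x * f x ^ 2 ∂μ := by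
    have h1 : 0 ≤ ∫ x, (t * t) * w x + (-2 * t) * (w x * f x) + w x * f x ^ 2 ∂μ := by
      refine integral_nonneg fun x => ?_
      have := mul_nonneg (hw0 x) (sq_nonneg (f x - t))
      simp only [Pi.zero_apply]
      linarith
    have hi1 : Integrable (fun x => (t * t) * w x + (-2 * t) * (w x * f x)) μ :=
      (hw.const_mul _).add (hwf.const_mul _)
    rw [integral_add hi1 hwf2, integral_add (hw.const_mul _) (hwf.const_mul _),
      integral_const_mul, integral_const_mul] at h1
    linarith
  have := discrim_le_zero h
  rw [discrim] at this
  linarith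

/-- Young's inequality `L¹ ⋆ L² ⊆ L²`: by Cauchy–Schwarz, `|a ⋆ b|²` is at most `‖a‖₁` times the
integrable function `|a| ⋆ |b|²`. -/
theorem memLp_two_actConv (ha : Integrable a rotMeasure) (hb : Integrable b ν)
    (hb2 : MemLp b 2 ν) : MemLp (actConv a b) 2 ν := by
  have hm := (integrable_actConv ha hb).aestronglyMeasurable
  rw [memLp_two_iff_integrable_sq_norm hm]
  have ha' : Integrable (fun R => ((‖a R‖ : ℝ) : ℂ)) rotMeasure := ha.norm.ofReal
  have hb1' : Integrable (fun x => ((‖b x‖ : ℝ) : ℂ)) ν := hb.norm.ofReal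
  have hb2' : Integrable (fun x => ((‖b x‖ ^ 2 : ℝ) : ℂ)) ν :=
    ((memLp_two_iff_integrable_sq_norm hb2.1).1 hb2).ofReal
  refine ((integrable_actConv ha' hb2').norm.const_mul (∫ R, ‖a R‖ ∂rotMeasure)).mono'
    (hm.norm.pow 2) ?_
  filter_upwards [ae_integrable_actConv ha' hb2', ae_integrable_actConv ha' hb1'] with x h2 h1
  have h1' : Integrable (fun R => ‖a R‖ * ‖b (R⁻¹ • x)‖) rotMeasure := by
    have := h1.re
    simpa using this
  have h2' : Integrable (fun R => ‖a R‖ * ‖b (R⁻¹ • x)‖ ^ 2) rotMeasure := by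
    have := h2.re
    simpa [← Complex.ofReal_pow] using this
  have hcs := sq_integral_mul_le (fun R => norm_nonneg (a R)) ha.norm h1' h2'
  have hn : ‖actConv a b x‖ ≤ ∫ R, ‖a R‖ * ‖b (R⁻¹ • x)‖ ∂rotMeasure := by
    refine (norm_integral_le_integral_norm _).trans_eq ?_
    simp only [norm_mul]
  have heq : actConv (fun R => ((‖a R‖ : ℝ) : ℂ)) (fun x => ((‖b x‖ ^ 2 : ℝ) : ℂ)) x =
      ((∫ R, ‖a R‖ * ‖b (R⁻¹ • x)‖ ^ 2 ∂rotMeasure : ℝ) : ℂ) := by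
    rw [actConv, ← integral_complex_ofReal]
    simp only [Complex.ofReal_mul]
  rw [heq, Complex.norm_real, Real.norm_of_nonneg (by positivity),
    Real.norm_of_nonneg (integral_nonneg fun R => by positivity)]
  exact (pow_le_pow_left₀ (norm_nonneg _) hn 2).trans hcs

/-- Integrating a convolution against a bounded function. -/
theorem integral_actConv_mul (ha : Integrable a rotMeasure) (hb : Integrable b ν) {φ : X → ℂ}
    (hφ : Measurable φ) {C : ℝ} (hC : ∀ x, ‖φ x‖ ≤ C) :
    ∫ x, actConv a b x * φ x ∂ν =
      ∫ R, a R * ∫ x, b x * φ (R • x) ∂ν ∂rotMeasure := by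
  have hint : Integrable (fun p : SO3 × X => (a p.1 * b (p.1⁻¹ • p.2)) * φ p.2)
      (rotMeasure.prod ν) :=
    (integrable_prod_actConv ha hb).mul_bdd (c := C)
      (hφ.comp measurable_snd).aestronglyMeasurable (Filter.Eventually.of_forall fun p => hC p.2)
  have hswap := integral_integral_swap (f := fun R x => (a R * b (R⁻¹ • x)) * φ x) hint
  simp only [actConv]
  calc ∫ x, (∫ R, a R * b (R⁻¹ • x) ∂rotMeasure) * φ x ∂ν
      = ∫ x, ∫ R, (a R * b (R⁻¹ • x)) * φ x ∂rotMeasure ∂ν := by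
        simp only [integral_mul_const]
    _ = ∫ R, ∫ x, (a R * b (R⁻¹ • x)) * φ x ∂ν ∂rotMeasure := hswap.symm
    _ = _ := by
        congr 1
        funext R
        rw [← integral_const_mul]
        have h := (measurePreserving_smul R⁻¹ ν).integral_comp
          (measurableEmbedding_const_smul R⁻¹) (fun x => a R * (b x * φ (R • x)))
        rw [← h]
        simp only [smul_inv_smul, mul_assoc]

end Action

theorem wignerD_conjTranspose_mul_apply (l : ℕ) (R V : SO3) (i j : Fin (2 * l + 1)) :
    star (wignerD l (R * V) j i) = ∑ k, star (wignerD l R j k) * star (wignerD l V k i) := by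
  rw [wignerD_mul, Matrix.mul_apply, star_sum]
  simp only [star_mul']

theorem integrable_mul_star_wignerD {h : SO3 → ℂ} (hh : Integrable h rotMeasure) (l : ℕ)
    (i j : Fin (2 * l + 1)) : Integrable (fun R => h R * star (wignerD l R i j)) rotMeasure :=
  hh.mul_bdd (c := 1) (continuous_wignerD_apply l i j).star.aestronglyMeasurable
    (Filter.Eventually.of_forall fun R => by
      rw [norm_star]; exact norm_wignerD_apply_le l R i j)

theorem so3Coeff_apply (h : SO3 → ℂ) (l : ℕ) (i j : Fin (2 * l + 1)) :
    so3Coeff h l i j = ∫ R, h R * star (wignerD l R j i) ∂rotMeasure := rfl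

theorem norm_sphY_le (l : ℕ) (u : S2) (i : Fin (2 * l + 1)) : ‖sphY l u i‖ ≤ normConst l 0 := by
  rw [sphY, norm_mul, Complex.norm_real, Real.norm_of_nonneg (normConst_zero_pos l).le]
  exact mul_le_of_le_one_right (normConst_zero_pos l).le (norm_wignerD_apply_le l _ _ _)

theorem integrable_mul_star_sphY {f : S2 → ℂ} (hf : Integrable f sphMeasure) (l : ℕ)
    (i : Fin (2 * l + 1)) : Integrable (fun u => f u * star (sphY l u i)) sphMeasure :=
  hf.mul_bdd (c := normConst l 0) (continuous_sphY l i).star.aestronglyMeasurable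
    (Filter.Eventually.of_forall fun u => by rw [norm_star]; exact norm_sphY_le l u i)

/-- Integrals against rotated spherical harmonics. -/
theorem integral_mul_star_sphY_smul {f : S2 → ℂ} (hf : Integrable f sphMeasure) (l : ℕ)
    (i : Fin (2 * l + 1)) (R : SO3) :
    ∫ u, f u * star (sphY l (R • u) i) ∂sphMeasure =
      ∑ k, star (wignerD l R i k) * sphCoeff f l k := by
  simp only [sphY_smul, star_sum, star_mul', Finset.mul_sum, sphCoeff_eq]
  rw [integral_finsetSum]
  · refine Finset.sum_congr rfl fun k _ => ?_
    rw [← integral_const_mul]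
    congr 1
    funext u
    ring
  · intro k _
    refine ((integrable_mul_star_sphY hf l k).const_mul (star (wignerD l R i k))).congr
      (Filter.Eventually.of_forall fun u => ?_)
    simp only
    ring

instance : MeasurableSMul₂ SO3 S2 := ⟨continuous_smul.measurable⟩

/-- The coefficients of a convolution on the sphere. -/
theorem sphCoeff_actConv {a : SO3 → ℂ} {b : S2 → ℂ} (ha : Integrable a rotMeasure)
    (hb : Integrable b sphMeasure) (l : ℕ) :
    sphCoeff (actConv a b) l = sphCoeff b l ᵥ* so3Coeff a l := by
  funext i
  rw [sphCoeff_eq, integral_actConv_mul ha hb (continuous_sphY l i).star.measurable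
    (C := normConst l 0) (fun u => by rw [norm_star]; exact norm_sphY_le l u i)]
  simp only [integral_mul_star_sphY_smul hb, Finset.mul_sum, Matrix.vecMul, dotProduct,
    so3Coeff_apply]
  rw [integral_finsetSum]
  · refine Finset.sum_congr rfl fun k _ => ?_
    rw [← integral_const_mul]
    congr 1
    funext R
    ring
  · intro k _
    refine ((integrable_mul_star_wignerD ha l i k).mul_const (sphCoeff b l k)).congr
      (Filter.Eventually.of_forall fun R => ?_)
    simp only
    ring

theorem so3Conv_eq_actConv (f h : SO3 → ℂ) : so3Conv f h = actConv h f := rfl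

/-- The coefficients of a convolution on the rotation group. -/
theorem so3Coeff_so3Conv {h₁ h₂ : SO3 → ℂ} (hh₁ : Integrable h₁ rotMeasure)
    (hh₂ : Integrable h₂ rotMeasure) (l : ℕ) :
    so3Coeff (so3Conv h₁ h₂) l = so3Coeff h₁ l * so3Coeff h₂ l := by
  ext i j
  rw [so3Coeff_apply, so3Conv_eq_actConv,
    integral_actConv_mul hh₂ hh₁ (continuous_wignerD_apply l j i).star.measurable
    (C := 1) (fun u => by rw [norm_star]; exact norm_wignerD_apply_le l u j i)]
  simp only [smul_eq_mul, wignerD_conjTranspose_mul_apply, Finset.mul_sum, Matrix.mul_apply,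
    so3Coeff_apply]
  have hk (R : SO3) : ∫ V, ∑ k, h₁ V * (star (wignerD l R j k) * star (wignerD l V k i))
      ∂rotMeasure = ∑ k, star (wignerD l R j k) * so3Coeff h₁ l i k := by
    rw [integral_finsetSum]
    · refine Finset.sum_congr rfl fun k _ => ?_
      rw [so3Coeff_apply, ← integral_const_mul]
      congr 1
      funext V
      ring
    · intro k _
      refine ((integrable_mul_star_wignerD hh₁ l k i).const_mul (star (wignerD l R j k))).congr
        (Filter.Eventually.of_forall fun V => ?_)
      simp only
      ring
  simp only [hk, Finset.mul_sum]
  rw [integral_finsetSum]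
  · refine Finset.sum_congr rfl fun k _ => ?_
    rw [so3Coeff_apply, ← integral_const_mul]
    congr 1
    funext R
    ring
  · intro k _
    refine ((integrable_mul_star_wignerD hh₂ l j k).mul_const (so3Coeff h₁ l i k)).congr
      (Filter.Eventually.of_forall fun R => ?_)
    simp only
    ring

/-! ### The projected convolution -/

/-- The projection of a function that is constant on the fibre over `u`, where it has the value `c`.
No measurability is needed. -/
theorem proj_eq_of_forall {g : SO3 → ℂ} {u : S2} {c : ℂ}
    (h : ∀ V : SO3, V • north = u → g V = c) : proj g u = c := by
  have h1 (γ : ℝ) : g (euler (lon u) (colat u) γ) = c := h _ (euler_lon_colat_smul_north u γ)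
  have hpi : (π : ℂ) ≠ 0 := Complex.ofReal_ne_zero.2 Real.pi_ne_zero
  simp only [proj, h1, intervalIntegral.integral_const, sub_zero, Complex.real_smul]
  push_cast
  field_simp

theorem lift_inv_mul (f : S2 → ℂ) (R V : SO3) : lift f (R⁻¹ * V) = f (R⁻¹ • V • north) := by
  rw [lift, rot_eq_smul, mul_smul]

theorem so3Conv_lift (f : S2 → ℂ) (h : SO3 → ℂ) (V : SO3) :
    so3Conv (lift f) h V = actConv h f (V • north) := by
  simp only [so3Conv, actConv, lift_inv_mul]

/-- The inner convolution at `V` depends on `V n` only, so the projection has no effect. -/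
theorem projConv_eq_actConv (f : S2 → ℂ) (h : SO3 → ℂ) : projConv f h = actConv h f := by
  funext u
  refine proj_eq_of_forall fun V hV => ?_
  rw [so3Conv_lift, hV]

theorem leftConv_eq_actConv (f h : S2 → ℂ) : leftConv f h = actConv (lift f) h := rfl

theorem integrable_lift {f : S2 → ℂ} (hf : Integrable f sphMeasure) :
    Integrable (lift f) rotMeasure := integrable_smul_north hf

theorem integrable_projConv {f : S2 → ℂ} {h : SO3 → ℂ} (hf : Integrable f sphMeasure)
    (hh : Integrable h rotMeasure) : Integrable (projConv f h) sphMeasure := by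
  rw [projConv_eq_actConv]
  exact integrable_actConv hh hf

theorem sphCoeff_projConv {f : S2 → ℂ} {h : SO3 → ℂ} (hf : Integrable f sphMeasure)
    (hh : Integrable h rotMeasure) (l : ℕ) :
    sphCoeff (projConv f h) l = sphCoeff f l ᵥ* so3Coeff h l := by
  rw [projConv_eq_actConv, sphCoeff_actConv hh hf]

/-! ### Axially symmetric kernels -/

/-- An axially symmetric function has only coefficients of order `0`. -/
theorem sphCoeff_eq_zero_of_isAxial {h : S2 → ℂ} (hh : Integrable h sphMeasure) (hax : IsAxial h)
    {l : ℕ} {i : Fin (2 * l + 1)} (hi : i ≠ mid l) : sphCoeff h l i = 0 := by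
  have ho : order l i ≠ 0 := by
    rw [← order_mid l]
    exact (order_injective l).ne hi
  have hoc : (order l i : ℂ) ≠ 0 := Int.cast_ne_zero.2 ho
  -- the rotation by `t` about the `z` axis changes the sign of the harmonic of this order
  set t : ℝ := π / (order l i : ℝ)
  have h1 := (measurePreserving_smul (rotZ t) sphMeasure).integral_comp
    (measurableEmbedding_const_smul (rotZ t)) (fun u => h u * star (sphY l u i))
  have h2 (u : S2) : h (rotZ t • u) = h u := hax (rotZ t) (rotZ_smul_north t) u
  simp only [h2] at h1
  rw [integral_mul_star_sphY_smul hh, ← sphCoeff_eq, wignerD_rotZ,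
    Finset.sum_eq_single i, Matrix.diagonal_apply_eq] at h1
  · have he : Complex.exp (-Complex.I * (order l i : ℂ) * (t : ℂ)) = -1 := by
      rw [show -Complex.I * (order l i : ℂ) * (t : ℂ) = -(π * Complex.I) by
        simp only [t]
        push_cast
        field_simp, Complex.exp_neg, Complex.exp_pi_mul_I]
      norm_num
    rw [he] at h1
    simp only [star_neg, star_one] at h1
    have : 2 * sphCoeff h l i = 0 := by linear_combination -h1
    exact (mul_eq_zero.1 this).resolve_left two_ne_zero
  · intro k _ hk
    rw [Matrix.diagonal_apply_ne _ hk.symm, star_zero, zero_mul]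
  · exact fun h => absurd (Finset.mem_univ _) h

/-- The middle row of the coefficient matrix of a lift; the factor `4π` compares `dR` with `du`. -/
theorem so3Coeff_lift_mid {f : S2 → ℂ} (hf : Integrable f sphMeasure) (l : ℕ)
    (i : Fin (2 * l + 1)) :
    so3Coeff (lift f) l (mid l) i = sphCoeff f l i / ((4 * π * normConst l 0 : ℝ) : ℂ) := by
  have hc : (normConst l 0 : ℂ) ≠ 0 := Complex.ofReal_ne_zero.2 (normConst_zero_pos l).ne'
  have h := integral_smul_north (integrable_mul_star_sphY hf l i).aestronglyMeasurable
  simp only [sphY_smul_north, ← sphCoeff_eq] at h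
  rw [so3Coeff_apply, eq_div_iff (Complex.ofReal_ne_zero.2
    (mul_pos (by positivity) (normConst_zero_pos l)).ne'), ← integral_mul_const]
  have h2 : ∫ R, (f (R • north) * star ((normConst l 0 : ℂ) * wignerD l R i (mid l))) *
      ((4 * π : ℝ) : ℂ) ∂rotMeasure = sphCoeff f l i := by
    rw [integral_mul_const, h]
    have : ((4 * π : ℝ) : ℂ) ≠ 0 := Complex.ofReal_ne_zero.2 (by positivity)
    field_simp
  rw [← h2]
  congr 1
  funext R
  rw [star_mul', Complex.star_def, Complex.conj_ofReal, lift, rot_eq_smul]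
  push_cast
  ring

/-- The coefficients of the convolution with an axially symmetric kernel. -/
theorem sphCoeff_leftConv {f h : S2 → ℂ} (hf : Integrable f sphMeasure)
    (hh : Integrable h sphMeasure) (hax : IsAxial h) (l : ℕ) :
    sphCoeff (leftConv f h) l =
      (sphCoeff h l (mid l) / ((4 * π * normConst l 0 : ℝ) : ℂ)) • sphCoeff f l := by
  rw [leftConv_eq_actConv, sphCoeff_actConv (integrable_lift hf) hh]
  funext i
  rw [Matrix.vecMul, dotProduct, Finset.sum_eq_single (mid l), so3Coeff_lift_mid hf,
    Pi.smul_apply, smul_eq_mul]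
  · ring
  · intro k _ hk
    rw [sphCoeff_eq_zero_of_isAxial hh hax hk, zero_mul]
  · exact fun h => absurd (Finset.mem_univ _) h

theorem integrable_leftConv {f h : S2 → ℂ} (hf : Integrable f sphMeasure)
    (hh : Integrable h sphMeasure) : Integrable (leftConv f h) sphMeasure := by
  rw [leftConv_eq_actConv]
  exact integrable_actConv (integrable_lift hf) hh

theorem projConv_ae_eq_leftConv {h : S2 → ℂ} (hh : Integrable h sphMeasure) (hax : IsAxial h)
    {k : SO3 → ℂ} (hk : Integrable k rotMeasure)
    (hkh : ∀ l : ℕ, so3Coeff k l =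
      (sphCoeff h l (mid l) / ((4 * π * normConst l 0 : ℝ) : ℂ)) • 1)
    {f : S2 → ℂ} (hf : Integrable f sphMeasure) : projConv f k =ᵐ[sphMeasure] leftConv f h := by
  refine ae_eq_of_sphCoeff (integrable_projConv hf hk) (integrable_leftConv hf hh) fun l => ?_
  rw [sphCoeff_projConv hf hk, sphCoeff_leftConv hf hh hax, hkh, Matrix.vecMul_smul,
    Matrix.vecMul_one]

/-! ### Square-integrable kernels -/

open scoped InnerProductSpace

/-- The matrix element `D_ℓ^{ij}` as element of `L²`. -/
def wignerLp (l : ℕ) (i j : Fin (2 * l + 1)) : Lp ℂ 2 rotMeasure :=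
  ((continuous_wignerD_apply l i j).memLp_of_hasCompactSupport
    (HasCompactSupport.of_compactSpace _)).toLp _

theorem wignerLp_coe (l : ℕ) (i j : Fin (2 * l + 1)) :
    wignerLp l i j =ᵐ[rotMeasure] fun R => wignerD l R i j := MemLp.coeFn_toLp _

theorem inner_wignerLp (l : ℕ) (i j : Fin (2 * l + 1)) (k : Lp ℂ 2 rotMeasure) :
    ⟪wignerLp l i j, k⟫_ℂ = so3Coeff k l j i := by
  rw [L2.inner_def, so3Coeff_apply]
  refine integral_congr_ae ?_
  filter_upwards [wignerLp_coe l i j] with R hR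
  rw [hR, RCLike.inner_apply]
  rfl

theorem so3Coeff_congr {h k : SO3 → ℂ} (hk : h =ᵐ[rotMeasure] k) (l : ℕ) :
    so3Coeff h l = so3Coeff k l := by
  ext i j
  rw [so3Coeff_apply, so3Coeff_apply]
  refine integral_congr_ae ?_
  filter_upwards [hk] with R hR
  rw [hR]

theorem inner_wignerLp_self (l : ℕ) (i j k j' : Fin (2 * l + 1)) :
    ⟪wignerLp l i j, wignerLp l k j'⟫_ℂ = if k = i ∧ j' = j then (2 * l + 1 : ℂ)⁻¹ else 0 := by
  rw [inner_wignerLp, so3Coeff_congr (wignerLp_coe l k j'), so3Coeff_apply,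
    integral_wignerD_mul_star_self]

theorem inner_wignerLp_of_ne {l l' : ℕ} (h : l ≠ l') (i j : Fin (2 * l + 1))
    (k j' : Fin (2 * l' + 1)) : ⟪wignerLp l i j, wignerLp l' k j'⟫_ℂ = 0 := by
  rw [inner_wignerLp, so3Coeff_congr (wignerLp_coe l' k j'), so3Coeff_apply,
    integral_wignerD_mul_star_of_ne h.symm]

/-- The character of the Wigner representation, as element of `L²`. -/
def charLp (l : ℕ) : Lp ℂ 2 rotMeasure := ∑ i, wignerLp l i i

theorem inner_wignerLp_charLp (l : ℕ) (i j : Fin (2 * l + 1)) :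
    ⟪wignerLp l j i, charLp l⟫_ℂ = if i = j then (2 * l + 1 : ℂ)⁻¹ else 0 := by
  rw [charLp, inner_sum]
  simp only [inner_wignerLp_self]
  split_ifs with h
  · subst h
    simp
  · refine Finset.sum_eq_zero fun k _ => if_neg ?_
    rintro ⟨rfl, rfl⟩
    exact h rfl

theorem inner_wignerLp_charLp_of_ne {l l' : ℕ} (h : l ≠ l') (i j : Fin (2 * l + 1)) :
    ⟪wignerLp l j i, charLp l'⟫_ℂ = 0 := by
  rw [charLp, inner_sum]
  exact Finset.sum_eq_zero fun k _ => inner_wignerLp_of_ne h _ _ _ _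

/-- The characters are orthonormal. -/
theorem orthonormal_charLp : Orthonormal ℂ charLp := by
  classical
  rw [orthonormal_iff_ite]
  intro l l'
  have hne : (2 * l + 1 : ℂ) ≠ 0 := by exact_mod_cast Nat.succ_ne_zero (2 * l)
  conv_lhs => rw [charLp, sum_inner]
  split_ifs with h
  · subst h
    simp [inner_wignerLp_charLp, hne]
  · exact Finset.sum_eq_zero fun k _ => inner_wignerLp_charLp_of_ne h _ _

theorem inner_charLp (l : ℕ) (k : Lp ℂ 2 rotMeasure) :
    ⟪charLp l, k⟫_ℂ = (so3Coeff k l).trace := by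
  rw [charLp, sum_inner]
  simp only [inner_wignerLp]
  rfl

/-- A square-integrable kernel with scalar Fourier coefficients `a_ℓ I` exists if and only if
`∑ (2ℓ + 1)² |a_ℓ|²` converges: the necessity is Bessel's inequality for the characters, and the
kernel is `∑ (2ℓ + 1) a_ℓ χ_ℓ`. -/
theorem exists_memLp_so3Coeff_scalar_iff (a : ℕ → ℂ) :
    (∃ k : SO3 → ℂ, MemLp k 2 rotMeasure ∧ ∀ l : ℕ, so3Coeff k l = a l • 1) ↔
      Summable fun l : ℕ => ‖(2 * l + 1 : ℂ) * a l‖ ^ 2 := by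
  constructor
  · rintro ⟨k, hk, hka⟩
    have h := orthonormal_charLp.inner_products_summable (hk.toLp k)
    refine h.congr fun l => ?_
    rw [inner_charLp, so3Coeff_congr hk.coeFn_toLp, hka, Matrix.trace_smul, Matrix.trace_one,
      Fintype.card_fin, smul_eq_mul, mul_comm]
    push_cast
    rfl
  · intro h
    have hs : Summable fun l : ℕ => ((2 * l + 1 : ℂ) * a l) • charLp l := by
      have := (orthonormal_charLp.orthogonalFamily.summable_iff_norm_sq_summable
        fun l => (2 * l + 1 : ℂ) * a l).2 h
      simpa using this
    refine ⟨_, Lp.memLp (∑' l : ℕ, ((2 * l + 1 : ℂ) * a l) • charLp l), fun l => ?_⟩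
    ext i j
    have hne : (2 * l + 1 : ℂ) ≠ 0 := by exact_mod_cast Nat.succ_ne_zero (2 * l)
    have h1 := hs.hasSum.mapL (innerSL ℂ (wignerLp l j i))
    rw [← inner_wignerLp]
    refine h1.unique ?_
    have h2 := hasSum_single (f := fun l' : ℕ => (innerSL ℂ (wignerLp l j i))
      (((2 * l' + 1 : ℂ) * a l') • charLp l')) l (fun l' hl' => by
        rw [innerSL_apply_apply, inner_smul_right, inner_wignerLp_charLp_of_ne hl'.symm, mul_zero])
    have h3 : (innerSL ℂ (wignerLp l j i)) (((2 * l + 1 : ℂ) * a l) • charLp l) =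
        (a l • (1 : Matrix (Fin (2 * l + 1)) (Fin (2 * l + 1)) ℂ)) i j := by
      rw [innerSL_apply_apply, inner_smul_right, inner_wignerLp_charLp, Matrix.smul_apply,
        Matrix.one_apply, smul_eq_mul]
      split_ifs
      · field_simp
      · simp
    rw [← h3]
    exact h2

/-- The factor `(2ℓ + 1)² / (4π c_ℓ⁰)²` of `|H_ℓ⁰|²` is `(2ℓ + 1) / (4π)`. -/
theorem exists_memLp_kernel_iff (h : S2 → ℂ) :
    (∃ k : SO3 → ℂ, MemLp k 2 rotMeasure ∧ ∀ l : ℕ, so3Coeff k l =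
      (sphCoeff h l (mid l) / ((4 * π * normConst l 0 : ℝ) : ℂ)) • 1) ↔
      Summable fun l : ℕ => (2 * (l : ℝ) + 1) * ‖sphCoeff h l (mid l)‖ ^ 2 := by
  rw [exists_memLp_so3Coeff_scalar_iff fun l =>
    sphCoeff h l (mid l) / ((4 * π * normConst l 0 : ℝ) : ℂ)]
  have hpi : (4 * π)⁻¹ ≠ 0 := by positivity
  rw [← summable_mul_left_iff hpi (f := fun l : ℕ =>
    (2 * (l : ℝ) + 1) * ‖sphCoeff h l (mid l)‖ ^ 2)]
  refine summable_congr fun l => ?_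
  have hn := normConst_zero_pos l
  have h1 : ‖(2 * l + 1 : ℂ)‖ = 2 * (l : ℝ) + 1 := by
    rw [show (2 * l + 1 : ℂ) = ((2 * (l : ℝ) + 1 : ℝ) : ℂ) by push_cast; rfl, Complex.norm_real,
      Real.norm_of_nonneg (by positivity)]
  rw [norm_mul, norm_div, h1, Complex.norm_real, Real.norm_of_nonneg (by positivity), mul_pow,
    div_pow, mul_pow, normConst_zero_sq]
  field_simp

/-! ### Band-limited kernels -/

/-- The kernel `∑ (2ℓ + 1) tr (M_ℓ D_ℓ(R))`, over `ℓ < L`. -/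
def bandKernel (L : ℕ) (M : ∀ l : ℕ, Matrix (Fin (2 * l + 1)) (Fin (2 * l + 1)) ℂ) (R : SO3) : ℂ :=
  ∑ l ∈ Finset.range L, ∑ a, ∑ b, ((2 * l + 1 : ℂ) * M l a b) * wignerD l R b a

theorem continuous_bandKernel (L : ℕ)
    (M : ∀ l : ℕ, Matrix (Fin (2 * l + 1)) (Fin (2 * l + 1)) ℂ) : Continuous (bandKernel L M) := by
  unfold bandKernel
  exact continuous_finsetSum _ fun l _ => continuous_finsetSum _ fun a _ =>
    continuous_finsetSum _ fun b _ => continuous_const.mul (continuous_wignerD_apply l b a)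

theorem so3Coeff_bandKernel (L : ℕ)
    (M : ∀ l : ℕ, Matrix (Fin (2 * l + 1)) (Fin (2 * l + 1)) ℂ) (l : ℕ) :
    so3Coeff (bandKernel L M) l = if l < L then M l else 0 := by
  ext i j
  have hi (l' : ℕ) (a b : Fin (2 * l' + 1)) : Integrable (fun R =>
      ((2 * l' + 1 : ℂ) * M l' a b) * wignerD l' R b a * star (wignerD l R j i)) rotMeasure := by
    refine ((integrable_wignerD_mul_star l' l b a j i).const_mul
      ((2 * l' + 1 : ℂ) * M l' a b)).congr (Filter.Eventually.of_forall fun R => ?_)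
    simp only
    ring
  rw [so3Coeff_apply]
  simp only [bandKernel, Finset.sum_mul]
  rw [integral_finsetSum _ fun l' _ => integrable_finsetSum _ fun a _ =>
    integrable_finsetSum _ fun b _ => hi l' a b]
  have h1 (l' : ℕ) : ∫ R, ∑ a, ∑ b, ((2 * l' + 1 : ℂ) * M l' a b) * wignerD l' R b a *
      star (wignerD l R j i) ∂rotMeasure = ∑ a, ∑ b, ((2 * l' + 1 : ℂ) * M l' a b) *
        ∫ R, wignerD l' R b a * star (wignerD l R j i) ∂rotMeasure := by
    rw [integral_finsetSum _ fun a _ => integrable_finsetSum _ fun b _ => hi l' a b]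
    refine Finset.sum_congr rfl fun a _ => ?_
    rw [integral_finsetSum _ fun b _ => hi l' a b]
    refine Finset.sum_congr rfl fun b _ => ?_
    rw [← integral_const_mul]
    simp only [mul_assoc]
  simp only [h1]
  have h2 : ∀ l' ≠ l, ∑ a, ∑ b, ((2 * l' + 1 : ℂ) * M l' a b) *
        ∫ R, wignerD l' R b a * star (wignerD l R j i) ∂rotMeasure = 0 := by
    intro l' hl'
    simp [integral_wignerD_mul_star_of_ne hl', -Complex.star_def, -RCLike.star_def]
  split_ifs with hL
  · rw [Finset.sum_eq_single l (fun l' _ hl' => h2 l' hl')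
      (fun h => absurd (Finset.mem_range.2 hL) h)]
    have hne : (2 * l + 1 : ℂ) ≠ 0 := by exact_mod_cast Nat.succ_ne_zero (2 * l)
    simp only [integral_wignerD_mul_star_self]
    rw [Finset.sum_eq_single i, Finset.sum_eq_single j]
    · simp only [and_self, if_true]
      field_simp
    · intro b _ hb
      rw [if_neg (fun h => hb h.1), mul_zero]
    · exact fun h => absurd (Finset.mem_univ _) h
    · intro a _ ha
      refine Finset.sum_eq_zero fun b _ => ?_
      rw [if_neg (fun h => ha h.2), mul_zero]
    · exact fun h => absurd (Finset.mem_univ _) h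
  · rw [Matrix.zero_apply]
    refine Finset.sum_eq_zero fun l' hl' => h2 l' ?_
    rintro rfl
    exact hL (Finset.mem_range.1 hl')

/-! ### Complex measures as kernels -/

/-- Integrability against the density `‖h‖`, which is the variation of the complex measure with
density `h`. -/
theorem integrable_variation_withDensityᵥ {X : Type*} [MeasurableSpace X] {μ : Measure X}
    {h : X → ℂ} (hh : Integrable h μ) {φ : X → ℂ}
    (hφ : Integrable (fun x => ((‖h x‖ : ℝ) : ℂ) * φ x) μ) :
    (μ.withDensityᵥ h).Integrable φ := by
  rw [VectorMeasure.Integrable, Measure.variation_withDensityᵥ hh]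
  rw [integrable_withDensity_iff_integrable_smul₀' hh.1.enorm
    (Filter.Eventually.of_forall fun x => enorm_lt_top)]
  simpa only [toReal_enorm, Complex.real_smul] using hφ

/-- The right side is the norm of `φ` in `L¹` of the variation. -/
theorem norm_integral_mul_le {X : Type*} [MeasurableSpace X] {μ : Measure X}
    {h : X → ℂ} (hh : Integrable h μ) (φ : X → ℂ) :
    ‖∫ x, h x * φ x ∂μ‖ ≤ ∫ x, ‖φ x‖ ∂(μ.withDensityᵥ h).variation := by
  rw [Measure.variation_withDensityᵥ hh, integral_withDensity_eq_integral_toReal_smul₀ hh.1.enorm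
    (Filter.Eventually.of_forall fun x => enorm_lt_top)]
  refine (norm_integral_le_integral_norm _).trans_eq ?_
  simp only [toReal_enorm, smul_eq_mul, norm_mul]

theorem integrable_mul_of_variation {X : Type*} [MeasurableSpace X] {μ : Measure X}
    {h : X → ℂ} (hh : Integrable h μ) {φ : X → ℂ} (hφ : (μ.withDensityᵥ h).Integrable φ) :
    Integrable (fun x => h x * φ x) μ := by
  rw [VectorMeasure.Integrable, Measure.variation_withDensityᵥ hh] at hφ
  rw [integrable_withDensity_iff_integrable_smul₀' hh.1.enorm
    (Filter.Eventually.of_forall fun x => enorm_lt_top)] at hφ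
  -- `h φ` is `‖h‖ φ` multiplied by the bounded function `h / ‖h‖`
  have h1 : AEStronglyMeasurable (fun x => h x / ((‖h x‖ : ℝ) : ℂ)) μ :=
    (hh.1.aemeasurable.div
      (Complex.measurable_ofReal.comp_aemeasurable hh.1.norm.aemeasurable)).aestronglyMeasurable
  refine (hφ.bdd_mul (c := 1) h1 (Filter.Eventually.of_forall fun x => ?_)).congr
    (Filter.Eventually.of_forall fun x => ?_)
  · rw [norm_div, Complex.norm_real, norm_norm]
    exact div_self_le_one _
  · simp only [toReal_enorm, Complex.real_smul]
    by_cases h0 : h x = 0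
    · simp [h0]
    · have : ((‖h x‖ : ℝ) : ℂ) ≠ 0 := by simpa using h0
      field_simp

/-- Integration against the complex measure with density `h`. -/
theorem integral_withDensityᵥ {X : Type*} [MeasurableSpace X] {μ : Measure X}
    {h : X → ℂ} (hh : Integrable h μ) {φ : X → ℂ} (hφ : (μ.withDensityᵥ h).Integrable φ) :
    VectorMeasure.integral (μ.withDensityᵥ h) φ (ContinuousLinearMap.mul ℝ ℂ) =
      ∫ x, h x * φ x ∂μ := by
  refine Integrable.induction (P := fun φ => VectorMeasure.integral (μ.withDensityᵥ h) φ
    (ContinuousLinearMap.mul ℝ ℂ) = ∫ x, h x * φ x ∂μ) ?_ ?_ ?_ ?_ hφ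
  · intro c s hs hc
    have : IsFiniteMeasure ((μ.withDensityᵥ h).variation.restrict s) := ⟨by simpa using hc⟩
    rw [VectorMeasure.integral_indicator_const c hs, withDensityᵥ_apply hh hs,
      ContinuousLinearMap.mul_apply', ← integral_const_mul, ← integral_indicator hs]
    refine integral_congr_ae (Filter.Eventually.of_forall fun x => ?_)
    by_cases hx : x ∈ s <;> simp [hx, mul_comm]
  · intro f g _ hf hg hf' hg'
    rw [VectorMeasure.integral_add hf hg, hf', hg', ← integral_add
      (integrable_mul_of_variation hh hf) (integrable_mul_of_variation hh hg)]
    simp only [Pi.add_apply, mul_add]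
  · refine isClosed_eq VectorMeasure.continuous_integral ?_
    refine LipschitzWith.continuous (K := 1) (LipschitzWith.of_dist_le_mul fun f g => ?_)
    rw [NNReal.coe_one, one_mul, dist_eq_norm, L1.dist_eq_integral_dist, ← integral_sub
      (integrable_mul_of_variation hh (L1.integrable_coeFn f))
      (integrable_mul_of_variation hh (L1.integrable_coeFn g))]
    simp only [← mul_sub, dist_eq_norm]
    exact norm_integral_mul_le hh _
  · intro f g hfg hf hf'
    rw [← VectorMeasure.integral_congr_ae hfg, hf']
    refine integral_congr_ae ?_
    rw [Measure.variation_withDensityᵥ hh] at hfg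
    have := (ae_withDensity_iff' hh.1.enorm).1 hfg
    filter_upwards [this] with x hx
    by_cases h0 : h x = 0
    · simp [h0]
    · rw [hx (by simpa using h0)]

theorem projConvMeasure_withDensityᵥ {f : S2 → ℂ} {h : SO3 → ℂ} (hf : Integrable f sphMeasure)
    (hh : Integrable h rotMeasure) :
    projConvMeasure f (rotMeasure.withDensityᵥ h) =ᵐ[sphMeasure] projConv f h := by
  have hn : Integrable (fun R => ((‖h R‖ : ℝ) : ℂ)) rotMeasure := hh.norm.ofReal
  filter_upwards [ae_integrable_actConv hn hf] with u hu
  rw [projConv_eq_actConv]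
  refine proj_eq_of_forall fun V hV => ?_
  simp only [so3ConvMeasure, lift_inv_mul, hV]
  exact integral_withDensityᵥ hh (integrable_variation_withDensityᵥ hh hu)

theorem so3CoeffMeasure_withDensityᵥ {h : SO3 → ℂ} (hh : Integrable h rotMeasure) (l : ℕ) :
    so3CoeffMeasure (rotMeasure.withDensityᵥ h) l = so3Coeff h l := by
  ext i j
  have hn : Integrable (fun R => ((‖h R‖ : ℝ) : ℂ)) rotMeasure := hh.norm.ofReal
  exact integral_withDensityᵥ hh
    (integrable_variation_withDensityᵥ hh (integrable_mul_star_wignerD hn l j i))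

/-! ### Finite sums of point masses -/

/-- The integral against a finite sum of point masses is a finite sum, for any function: every
function is integrable for a point mass. -/
theorem integral_firKernel {N : ℕ} (b : Fin N → ℂ) (R : Fin N → SO3) (φ : SO3 → ℂ) :
    VectorMeasure.integral (firKernel b R) φ (ContinuousLinearMap.mul ℝ ℂ) =
      ∑ k, b k * φ (R k)⁻¹ := by
  rw [firKernel, VectorMeasure.integral_finsetSum_vectorMeasure]
  · refine Finset.sum_congr rfl fun k _ => ?_
    rw [VectorMeasure.integral_dirac, ContinuousLinearMap.mul_apply', mul_comm]
  · intro k _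
    rw [VectorMeasure.Integrable, VectorMeasure.variation_dirac]
    exact (integrable_dirac enorm_lt_top).smul_measure enorm_ne_top

theorem projConvMeasure_firKernel {N : ℕ} (b : Fin N → ℂ) (R : Fin N → SO3) (f : S2 → ℂ) :
    projConvMeasure f (firKernel b R) = fir b R f := by
  funext u
  refine proj_eq_of_forall fun V hV => ?_
  simp only [so3ConvMeasure, integral_firKernel, lift_inv_mul, hV, inv_inv]
  rfl

theorem so3CoeffMeasure_firKernel {N : ℕ} (b : Fin N → ℂ) (R : Fin N → SO3) (l : ℕ) :
    so3CoeffMeasure (firKernel b R) l = ∑ k, b k • wignerD l (R k) := by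
  ext i j
  refine (integral_firKernel b R _).trans ?_
  simp only [wignerD_inv, Matrix.conjTranspose_conjTranspose, Matrix.sum_apply, Matrix.smul_apply,
    smul_eq_mul]

theorem sphCoeff_fir {N : ℕ} (b : Fin N → ℂ) (R : Fin N → SO3) {f : S2 → ℂ}
    (hf : Integrable f sphMeasure) (l : ℕ) :
    sphCoeff (fir b R f) l = sphCoeff f l ᵥ* ∑ k, b k • wignerD l (R k) := by
  funext i
  have hi (k : Fin N) : Integrable (fun u => f (R k • u)) sphMeasure :=
    (measurePreserving_smul (R k) sphMeasure).integrable_comp_of_integrable hf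
  have h1 (k : Fin N) : ∫ u, f (R k • u) * star (sphY l u i) ∂sphMeasure =
      ∑ j, sphCoeff f l j * wignerD l (R k) j i := by
    have := (measurePreserving_smul (R k) sphMeasure).integral_comp
      (MeasurableEquiv.smul (R k)).measurableEmbedding
      (fun u => f u * star (sphY l ((R k)⁻¹ • u) i))
    simp only [inv_smul_smul] at this
    rw [this, integral_mul_star_sphY_smul hf, wignerD_inv]
    simp only [Matrix.conjTranspose_apply, star_star, mul_comm]
  rw [sphCoeff_eq]
  simp only [fir, rot_eq_smul, Finset.sum_mul, mul_assoc]
  rw [integral_finsetSum _ fun k _ => (integrable_mul_star_sphY (hi k) l i).const_mul (b k)]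
  simp only [integral_const_mul, h1, Matrix.vecMul, dotProduct, Matrix.sum_apply,
    Matrix.smul_apply, smul_eq_mul, Finset.mul_sum]
  rw [Finset.sum_comm]
  exact Finset.sum_congr rfl fun j _ => Finset.sum_congr rfl fun k _ => by ring

/-! ### A directional filter -/

/-- The spherical harmonics are orthogonal within each degree. -/
theorem sphCoeff_sphY (l : ℕ) (i j : Fin (2 * l + 1)) :
    sphCoeff (fun u => sphY l u i) l j = if i = j then 1 else 0 := by
  have h := integral_smul_north
    (integrable_mul_star_sphY (integrable_sphY l i) l j).aestronglyMeasurable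
  have hpi : ((4 * π : ℝ) : ℂ) ≠ 0 := Complex.ofReal_ne_zero.2 (by positivity)
  have hl : (2 * l + 1 : ℂ) ≠ 0 := by exact_mod_cast Nat.succ_ne_zero (2 * l)
  have hc : (normConst l 0 : ℂ) * (normConst l 0 : ℂ) = (2 * l + 1) / ((4 * π : ℝ) : ℂ) := by
    rw [← Complex.ofReal_mul, ← pow_two, normConst_zero_sq]
    push_cast
    rfl
  have h1 (R : SO3) : (normConst l 0 : ℂ) * wignerD l R i (mid l) *
      star ((normConst l 0 : ℂ) * wignerD l R j (mid l)) =
      (2 * l + 1) / ((4 * π : ℝ) : ℂ) *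
        (wignerD l R i (mid l) * star (wignerD l R j (mid l))) := by
    rw [star_mul', Complex.star_def, Complex.conj_ofReal, ← hc]
    ring
  simp only [sphY_smul_north, ← sphCoeff_eq, h1, integral_const_mul,
    integral_wignerD_mul_star_self, and_true] at h
  have h2 : sphCoeff (fun u => sphY l u i) l j =
      ((4 * π : ℝ) : ℂ) * ((((4 * π : ℝ) : ℂ))⁻¹ * sphCoeff (fun u => sphY l u i) l j) := by
    field_simp
  rw [h2, ← h]
  split_ifs
  · field_simp
  · simp

theorem littleD_one_mid_mid (β : ℝ) :
    littleD 1 β (mid 1) (mid 1) = Real.cos (β / 2) ^ 2 - Real.sin (β / 2) ^ 2 := by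
  have h : (Finset.range (2 * 1 + 1)).filter
      (fun s => s ≤ ((mid 1 : Fin _) : ℕ) ∧ ((mid 1 : Fin _) : ℕ) ≤ ((mid 1 : Fin _) : ℕ) + s ∧
        ((mid 1 : Fin _) : ℕ) + s ≤ 2 * 1) = {0, 1} := by decide
  rw [littleD, h]
  simp [mid]
  ring

theorem littleD_one_two_two (β : ℝ) : littleD 1 β 2 2 = Real.cos (β / 2) ^ 2 := by
  have h : (Finset.range (2 * 1 + 1)).filter
      (fun s => s ≤ ((2 : Fin (2 * 1 + 1)) : ℕ) ∧
        ((2 : Fin (2 * 1 + 1)) : ℕ) ≤ ((2 : Fin (2 * 1 + 1)) : ℕ) + s ∧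
        ((2 : Fin (2 * 1 + 1)) : ℕ) + s ≤ 2 * 1) = {0} := by decide
  rw [littleD, h]
  have h2 : Real.sqrt (2 * 2) = 2 := by
    rw [← pow_two, Real.sqrt_sq zero_le_two]
  simp [h2]
  ring

/-- The filter with three taps averaging over rotations about the `y` axis is directional: its
transfer matrix of degree one has two different diagonal entries. -/
theorem not_exists_axial_kernel {β : ℝ} (h0 : 0 < β) (hπ : β < π) :
    ¬ ∃ h : S2 → ℂ, Integrable h sphMeasure ∧ IsAxial h ∧
      ∀ f : S2 → ℂ, Continuous f →
        projConvMeasure f (firKernel ![1 / 2, 1 / 4, 1 / 4] ![1, rotY β, (rotY β)⁻¹])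
          =ᵐ[sphMeasure] leftConv f h := by
  rintro ⟨h, hh, hax, H⟩
  -- an axially symmetric kernel acts on the harmonics of degree one by the scalar `a`
  set a : ℂ := sphCoeff h 1 (mid 1) / ((4 * π * normConst 1 0 : ℝ) : ℂ)
  have key (i : Fin (2 * 1 + 1)) : (1 / 2 + 1 / 2 * (littleD 1 β i i : ℂ)) = a := by
    have hf := H _ (continuous_sphY 1 i)
    rw [projConvMeasure_firKernel] at hf
    have h1 : sphCoeff _ 1 = sphCoeff _ 1 := funext fun i => by
      exact integral_congr_ae (hf.mono fun u hu => congrArg (· * star (sphHarm 1 u i)) hu)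
    rw [sphCoeff_fir _ _ (integrable_sphY 1 i),
      sphCoeff_leftConv (integrable_sphY 1 i) hh hax] at h1
    have h2 := congrFun h1 i
    simp only [Matrix.vecMul, dotProduct, sphCoeff_sphY, ite_mul, one_mul, zero_mul,
      Finset.sum_ite_eq, Finset.mem_univ, if_true, Pi.smul_apply, smul_eq_mul, mul_one,
      Fin.sum_univ_three, Matrix.add_apply, Matrix.smul_apply, Matrix.cons_val, wignerD_one,
      Matrix.one_apply_eq, wignerD_inv, Matrix.conjTranspose_apply, wignerD_rotY, Matrix.map_apply,
      Matrix.of_apply] at h2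
    rw [Complex.star_def, Complex.conj_ofReal] at h2
    rw [show a = _ from h2.symm]
    ring
  have h2 := (key (mid 1)).trans (key 2).symm
  rw [littleD_one_mid_mid, littleD_one_two_two] at h2
  have h3 : Real.sin (β / 2) ^ 2 = 0 := by
    have : ((Real.sin (β / 2) ^ 2 : ℝ) : ℂ) = 0 := by
      push_cast at h2 ⊢
      linear_combination -2 * h2
    exact_mod_cast this
  have h4 := Real.sin_pos_of_pos_of_lt_pi (x := β / 2) (by linarith) (by linarith)
  exact h4.ne' (pow_eq_zero_iff two_ne_zero |>.1 h3)

end SphFilter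

end

theorem theorem1 :
    -- well-posedness, F1, and the Fourier representation
    (∀ (f : S2 → ℂ) (h : SO3 → ℂ),
      Integrable f sphMeasure → Integrable h rotMeasure →
        (∀ᵐ V ∂rotMeasure,
          Integrable (fun R => h R * lift f (R⁻¹ * V)) rotMeasure) ∧
        (∀ᵐ u ∂sphMeasure,
          Integrable (fun R => h R * f (rot R⁻¹ u)) rotMeasure) ∧
        Integrable (projConv f h) sphMeasure ∧
        (MemLp f 2 sphMeasure →
          MemLp (projConv f h) 2 sphMeasure) ∧
        (∀ V : SO3,
          so3Conv (lift f) h V =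
            projConv f h (rot V north)) ∧
        ∀ l : ℕ, sphCoeff (projConv f h) l =
          sphCoeff f l ᵥ* so3Coeff h l) ∧
    -- F2, axially symmetric kernels
    (∀ h : S2 → ℂ, Integrable h sphMeasure → IsAxial h →
        (∀ k : SO3 → ℂ, Integrable k rotMeasure →
          (∀ l : ℕ, so3Coeff k l =
            (sphCoeff h l (mid l) /
              ((4 * π * normConst l 0 : ℝ) : ℂ)) • 1) →
          ∀ f : S2 → ℂ, Integrable f sphMeasure →
            projConv f k =ᵐ[sphMeasure] leftConv f h) ∧
        ((∃ k : SO3 → ℂ, MemLp k 2 rotMeasure ∧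
          ∀ l : ℕ, so3Coeff k l =
            (sphCoeff h l (mid l) /
              ((4 * π * normConst l 0 : ℝ) : ℂ)) • 1) ↔
          Summable fun l : ℕ =>
            (2 * (l : ℝ) + 1) * ‖sphCoeff h l (mid l)‖ ^ 2)) ∧
    -- F2, directional kernels: transfer functions are arbitrary up to any bandwidth,
    -- and there are filters that no axially symmetric kernel gives
    (∀ (L : ℕ) (M : ∀ l : ℕ, Matrix (Fin (2 * l + 1)) (Fin (2 * l + 1)) ℂ),
      ∃ h : SO3 → ℂ, Continuous h ∧
        ∀ l : ℕ, so3Coeff h l = if l < L then M l else 0) ∧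
    (∀ β : ℝ, 0 < β → β < π →
      ¬ ∃ h : S2 → ℂ, Integrable h sphMeasure ∧ IsAxial h ∧
        ∀ f : S2 → ℂ, Continuous f →
          projConvMeasure f
              (firKernel ![1 / 2, 1 / 4, 1 / 4]
                ![1, rotY β, (rotY β)⁻¹])
            =ᵐ[sphMeasure] leftConv f h) ∧
    -- F3, associativity
    (∀ (f : S2 → ℂ) (h₁ h₂ : SO3 → ℂ),
      Integrable f sphMeasure → Integrable h₁ rotMeasure →
      Integrable h₂ rotMeasure →
        (∀ᵐ V ∂rotMeasure,
          Integrable (fun R => h₂ R * h₁ (R⁻¹ * V)) rotMeasure) ∧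
        Integrable (so3Conv h₁ h₂) rotMeasure ∧
        projConv (projConv f h₁) h₂ =ᵐ[sphMeasure]
          projConv f (so3Conv h₁ h₂) ∧
        ∀ l : ℕ, so3Coeff (so3Conv h₁ h₂) l =
          so3Coeff h₁ l * so3Coeff h₂ l) ∧
    -- F4: measure kernels extend function kernels, and finite sums of point masses are
    -- the finite-impulse-response filters
    (∀ h : SO3 → ℂ, Integrable h rotMeasure →
        (∀ f : S2 → ℂ, Integrable f sphMeasure →
          projConvMeasure f (rotMeasure.withDensityᵥ h)
            =ᵐ[sphMeasure] projConv f h) ∧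
        ∀ l : ℕ, so3CoeffMeasure (rotMeasure.withDensityᵥ h) l =
          so3Coeff h l) ∧
    (∀ (N : ℕ) (b : Fin N → ℂ) (R : Fin N → SO3),
        (∀ f : S2 → ℂ,
          projConvMeasure f (firKernel b R) = fir b R f) ∧
        (∀ l : ℕ, so3CoeffMeasure (firKernel b R) l =
          ∑ k, b k • wignerD l (R k)) ∧
        ∀ f : S2 → ℂ, Integrable f sphMeasure →
          ∀ l : ℕ, sphCoeff (fir b R f) l =
            sphCoeff f l ᵥ* ∑ k, b k • wignerD l (R k)) := by
  refine ⟨fun f h hf hh => ⟨?_, ae_integrable_actConv hh hf, integrable_projConv hf hh, ?_, ?_,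
      sphCoeff_projConv hf hh⟩,
    fun h hh hax => ⟨fun k hk hkh f hf => projConv_ae_eq_leftConv hh hax hk hkh hf,
      exists_memLp_kernel_iff h⟩,
    fun L M => ⟨bandKernel L M, continuous_bandKernel L M, so3Coeff_bandKernel L M⟩,
    fun β => not_exists_axial_kernel,
    fun f h₁ h₂ hf hh₁ hh₂ => ⟨ae_integrable_actConv hh₂ hh₁, integrable_actConv hh₂ hh₁, ?_,
      so3Coeff_so3Conv hh₁ hh₂⟩,
    fun h hh => ⟨fun f hf => projConvMeasure_withDensityᵥ hf hh, so3CoeffMeasure_withDensityᵥ hh⟩,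
    fun N b R => ⟨projConvMeasure_firKernel b R, so3CoeffMeasure_firKernel b R,
      fun f hf => sphCoeff_fir b R hf⟩⟩
  · simp only [lift_inv_mul]
    exact ae_smul_north (ae_integrable_actConv hh hf)
  · intro hf2
    rw [projConv_eq_actConv]
    exact memLp_two_actConv hh hf hf2
  · intro V
    rw [so3Conv_lift, projConv_eq_actConv, rot_eq_smul]
  · -- both sides have the coefficients `F H₁ H₂`, and an integrable function on the sphere is
    -- determined by its coefficients
    have h12 : Integrable (so3Conv h₁ h₂) rotMeasure := integrable_actConv hh₂ hh₁
    refine ae_eq_of_sphCoeff (integrable_projConv (integrable_projConv hf hh₁) hh₂)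
      (integrable_projConv hf h12) fun l => ?_
    rw [sphCoeff_projConv (integrable_projConv hf hh₁) hh₂, sphCoeff_projConv hf hh₁,
      sphCoeff_projConv hf h12, so3Coeff_so3Conv hh₁ hh₂, Matrix.vecMul_vecMul]
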